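/- A Lie algebra structure on $\mathbb C^4$ is an alternating bilinear bracket on $\mathbb C^4$ satisfying the Jacobi identity; two structures are identified if the Lie algebras they define are isomorphic. Let $e_1,e_2,e_3,e_4$ be the standard basis, and consider the following Lie algebra structures, where all brackets $[e_i,e_j]$ ($i<j$) not listed are zero. Families: - $d_3(\lambda:\mu:\nu)$, for $(\lambda,\mu,\nu)\neq(0,0,0)$: $[e_1,e_4]=\lambda e_1,\ [e_2,e_4]=e_1+\mu e_2,\ [e_3,e_4]=e_2+\nu e_3$; - $d_1(\lambda:\mu)$, for $(\lambda,\mu)\neq(0,0)$: $[e_2,e_3]=e_1,\ [e_1,e_4]=(\lambda+\mu)e_1,\ [e_2,e_4]=\lambda e_2,\ [e_3,e_4]=e_2+\mu e_3$; - $d_3(\lambda:\mu)$, for $(\lambda,\mu)\neq(0,0)$: $[e_1,e_4]=\lambda e_1,\ [e_2,e_4]=\lambda e_2,\ [e_3,e_4]=e_2+\mu e_3$. Single structures: - $d_1$: $[e_2,e_4]=e_1$; - $d_1^\sharp$: $[e_2,e_3]=e_1,\ [e_1,e_4]=2e_1,\ [e_2,e_4]=e_2,\ [e_3,e_4]=e_3$;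 - $d_2^*$: $[e_2,e_4]=e_1,\ [e_3,e_4]=e_2$; - $d_2^\sharp$: $[e_1,e_2]=e_1,\ [e_3,e_4]=e_3$; - $d_3$: $[e_1,e_2]=e_3,\ [e_1,e_3]=e_2,\ [e_2,e_3]=e_1$; - $d_3^*$: $[e_1,e_4]=e_1,\ [e_2,e_4]=e_2,\ [e_3,e_4]=e_3$. Let the symmetric group $\Sigma_n$ act on $\mathbb P^{n-1}(\mathbb C)$ by permuting the homogeneous coordinates. Then: 1. The isomorphism class of $d_3(\lambda:\mu:\nu)$ depends only on the class of $(\lambda:\mu:\nu)$ in $\mathbb P^2(\mathbb C)/\Sigma_3$, that of $d_1(\lambda:\mu)$ only on the class of $(\lambda:\mu)$ in $\mathbb P^1(\mathbb C)/\Sigma_2$, and that of $d_3(\lambda:\mu)$ only on the point $(\lambda:\mu)\in\mathbb P^1(\mathbb C)$. 2. Every nonzero (that is, nonabelian) Lie algebra structure on $\mathbb C^4$ is isomorphic to exactly one element of the list, and no element of the list is abelian. That is, the map from the disjoint union $$\mathbb P^2(\mathbb C)/\Sigma_3\ \sqcup\ \mathbb P^1(\mathbb C)/\Sigma_2\ \sqcup\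 \mathbb P^1(\mathbb C)\ \sqcup\ \{d_1,d_1^\sharp,d_2^*,d_2^\sharp,d_3,d_3^*\}$$ to the set of isomorphism classes of Lie algebra structures on $\mathbb C^4$ which sends a parameter to the class of the corresponding structure is well defined and injective, and its image consists of all classes except that of the zero structure. -/

import Mathlib

open scoped LinearAlgebra.Projectivization

namespace FourDimLie

/-- The underlying vector space `ℂ⁴`. Its standard basis `e₁, e₂, e₃, e₄` is indexed by
`0, 1, 2, 3 : Fin 4`. -/
abbrev V : Type := Fin 4 → ℂ

/-- A complex Lie algebra structure on `ℂ⁴`: an alternating bilinear bracket satisfying the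
Jacobi identity. -/
@[ext]
structure LieStructure where
  bracket : V →ₗ[ℂ] V →ₗ[ℂ] V
  alt : ∀ x, bracket x x = 0
  jacobi : ∀ x y z, bracket x (bracket y z) = bracket (bracket x y) z + bracket y (bracket x z)

/-- The vector space `ℂ⁴` viewed as a Lie algebra with the bracket of `d`. -/
def LieStructure.Carrier (_d : LieStructure) : Type := V

namespace LieStructure

variable (d : LieStructure)

instance : AddCommGroup d.Carrier := inferInstanceAs (AddCommGroup V)

instance : Module ℂ d.Carrier := inferInstanceAs (Module ℂ V)

instance : LieRing d.Carrier where
  bracket x y := d.bracket x y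
  add_lie x y z := LinearMap.map_add₂ d.bracket x y z
  lie_add x y z := (d.bracket x).map_add y z
  lie_self x := d.alt x
  leibniz_lie x y z := d.jacobi x y z

instance : LieAlgebra ℂ d.Carrier where
  lie_smul c x y := (d.bracket x).map_smul c y

/-- The zero (abelian) Lie algebra structure. -/
instance : Zero LieStructure := ⟨⟨0, by simp, by simp⟩⟩

/-- Two Lie algebra structures on `ℂ⁴` are equivalent if they define isomorphic Lie algebras. -/
instance isoSetoid : Setoid LieStructure where
  r d d' := Nonempty (d.Carrier ≃ₗ⁅ℂ⁆ d'.Carrier)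
  iseqv := ⟨fun _ => ⟨LieEquiv.refl⟩, fun ⟨f⟩ => ⟨f.symm⟩, fun ⟨f⟩ ⟨g⟩ => ⟨f.trans g⟩⟩

end LieStructure

/-- The moduli space (as a set): isomorphism classes of Lie algebra structures on `ℂ⁴`. -/
abbrev ModuliSpace : Type := Quotient LieStructure.isoSetoid

/-- The isomorphism class of a Lie algebra structure. -/
def isoClass (d : LieStructure) : ModuliSpace := Quotient.mk _ d

/-- The elementary cochain `ψ_k^{ij}` (for `i ≠ j`): the alternating bilinear map which sends `(e_i, e_j)` to
`e_k` and vanishes on the other pairs `(e_r, e_s)` with `{r, s} ≠ {i, j}`. -/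
def psi (i j k : Fin 4) : V →ₗ[ℂ] V →ₗ[ℂ] V :=
  LinearMap.mk₂ ℂ (fun x y => (x i * y j - x j * y i) • (Pi.single k 1 : V))
    (fun x x' y => by simp only [Pi.add_apply, ← add_smul]; congr 1; ring)
    (fun c x y => by simp only [Pi.smul_apply, smul_eq_mul, smul_smul]; congr 1; ring)
    (fun x y y' => by simp only [Pi.add_apply, ← add_smul]; congr 1; ring)
    (fun c x y => by simp only [Pi.smul_apply, smul_eq_mul, smul_smul]; congr 1; ring)

theorem psi_apply (i j k : Fin 4) (x y : V) :
    psi i j k x y = (x i * y j - x j * y i) • (Pi.single k 1 : V) := rfl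

/-- The structure `d₁(a : b)`:
`[e₂,e₃] = e₁, [e₁,e₄] = (a + b)e₁, [e₂,e₄] = a e₂, [e₃,e₄] = e₂ + b e₃`. -/
def d1Family (a b : ℂ) : LieStructure where
  bracket := psi 1 2 0 + (a + b) • psi 0 3 0 + a • psi 1 3 1 + psi 2 3 1 + b • psi 2 3 2
  alt x := by ext m; simp [psi_apply, mul_comm]
  jacobi x y z := by ext m; fin_cases m <;> simp [psi_apply] <;> ring

/-- The structure `d₃(a : b : c)`:
`[e₁,e₄] = a e₁, [e₂,e₄] = e₁ + b e₂, [e₃,e₄] = e₂ + c e₃`. -/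
def d3Family (a b c : ℂ) : LieStructure where
  bracket := a • psi 0 3 0 + psi 1 3 0 + b • psi 1 3 1 + psi 2 3 1 + c • psi 2 3 2
  alt x := by ext m; simp [psi_apply, mul_comm]
  jacobi x y z := by ext m; fin_cases m <;> simp [psi_apply] <;> ring

/-- The structure `d₃(a : b)`:
`[e₁,e₄] = a e₁, [e₂,e₄] = a e₂, [e₃,e₄] = e₂ + b e₃`. -/
def d3SmallFamily (a b : ℂ) : LieStructure where
  bracket := a • psi 0 3 0 + a • psi 1 3 1 + psi 2 3 1 + b • psi 2 3 2
  alt x := by ext m; simp [psi_apply, mul_comm]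
  jacobi x y z := by ext m; fin_cases m <;> simp [psi_apply] <;> ring

/-- The structure `d₁`: `[e₂,e₄] = e₁`. -/
def d1 : LieStructure where
  bracket := psi 1 3 0
  alt x := by ext m; simp [psi_apply, mul_comm]
  jacobi x y z := by ext m; fin_cases m <;> simp [psi_apply]

/-- The structure `d₁♯`: `[e₂,e₃] = e₁, [e₁,e₄] = 2e₁, [e₂,e₄] = e₂, [e₃,e₄] = e₃`. -/
def d1Sharp : LieStructure where
  bracket := psi 1 2 0 + (2 : ℂ) • psi 0 3 0 + psi 1 3 1 + psi 2 3 2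
  alt x := by ext m; simp [psi_apply, mul_comm]
  jacobi x y z := by ext m; fin_cases m <;> simp [psi_apply] <;> ring

/-- The structure `d₂*`: `[e₂,e₄] = e₁, [e₃,e₄] = e₂`. -/
def d2Star : LieStructure where
  bracket := psi 1 3 0 + psi 2 3 1
  alt x := by ext m; simp [psi_apply, mul_comm]
  jacobi x y z := by ext m; fin_cases m <;> simp [psi_apply]; ring

/-- The structure `d₂♯`: `[e₁,e₂] = e₁, [e₃,e₄] = e₃`. -/
def d2Sharp : LieStructure where
  bracket := psi 0 1 0 + psi 2 3 2
  alt x := by ext m; simp [psi_apply, mul_comm]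
  jacobi x y z := by ext m; fin_cases m <;> simp [psi_apply] <;> ring

/-- The structure `d₃`: `[e₁,e₂] = e₃, [e₁,e₃] = e₂, [e₂,e₃] = e₁`. -/
def d3 : LieStructure where
  bracket := psi 0 1 2 + psi 0 2 1 + psi 1 2 0
  alt x := by ext m; simp [psi_apply, mul_comm]
  jacobi x y z := by ext m; fin_cases m <;> simp [psi_apply] <;> ring

/-- The structure `d₃*`: `[e₁,e₄] = e₁, [e₂,e₄] = e₂, [e₃,e₄] = e₃`. -/
def d3Star : LieStructure where
  bracket := psi 0 3 0 + psi 1 3 1 + psi 2 3 2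
  alt x := by ext m; simp [psi_apply, mul_comm]
  jacobi x y z := by ext m; fin_cases m <;> simp [psi_apply] <;> ring

/-- The complex projective space `ℙⁿ⁻¹(ℂ)`, with `n` homogeneous coordinates. -/
abbrev ProjSpace (n : ℕ) : Type := ℙ ℂ (Fin n → ℂ)

/-- The quotient of `ℙⁿ⁻¹(ℂ)` by the symmetric group `Σ_n` permuting the homogeneous
coordinates: the class of `σ` in `(Perm (Fin n))ᵈᵐᵃ` acts on coordinate vectors by
`v ↦ v ∘ σ`. -/
abbrev ProjOrbifold (n : ℕ) : Type :=
  MulAction.orbitRel.Quotient (Equiv.Perm (Fin n))ᵈᵐᵃ (ProjSpace n)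

/-- The orbit in `ℙⁿ⁻¹(ℂ)/Σ_n` of the point with homogeneous coordinates `v`. -/
noncomputable def ProjOrbifold.mk {n : ℕ} (v : Fin n → ℂ) (hv : v ≠ 0) : ProjOrbifold n :=
  Quotient.mk _ (Projectivization.mk ℂ v hv)

/-- Names for the six singleton points. -/
inductive SinglePoint : Type
  | d1 | d1Sharp | d2Star | d2Sharp | d3 | d3Star

/-- The Lie algebra structure at a singleton point. -/
def SinglePoint.structureAt : SinglePoint → LieStructure
  | .d1 => FourDimLie.d1
  | .d1Sharp => FourDimLie.d1Sharp
  | .d2Star => FourDimLie.d2Star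
  | .d2Sharp => FourDimLie.d2Sharp
  | .d3 => FourDimLie.d3
  | .d3Star => FourDimLie.d3Star

/-- The parameter space of the list: the disjoint union of `ℙ²/Σ₃`, `ℙ¹/Σ₂`, `ℙ¹` and six
points. -/
inductive ListParameter : Type
  | big (p : ProjOrbifold 3)
  | heisenberg (p : ProjOrbifold 2)
  | small (p : ProjSpace 2)
  | single (s : SinglePoint)

end FourDimLie

/-! The existence half rests on the fact that a four-dimensional complex Lie algebra `L` is never
perfect (`exists_linearForm_lie_eq_zero`). If it were, it would be unimodular, so for every linear
form `f` the four-form `df ∧ df = d(f ∧ df)` would vanish. The two-forms `df` would then make up a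
four-dimensional isotropic subspace of the six-dimensional space of two-forms with its nondegenerate
wedge pairing, where isotropic subspaces have dimension at most three.

Hence some nonzero `f` kills all brackets, `I = ker f` is an ideal of codimension one, and the cases
are split by the dimension of `J = [I, I]` (`kerBrackets f`). If `J = 0`, then `I` is abelian and
`L` is given by one endomorphism of a three-space: scalar, or scalar plus rank one, or cyclic
(`normalForm_three`). If `dim J = 3`, then `I` is `𝔰𝔩₂`, all of whose derivations are inner, and `L`
is `𝔰𝔩₂ ⊕ ℂ` (`isListed_d3`). In dimensions one and two, `L` turns out to have an abelian or a
Heisenberg ideal of codimension one, or to be the sum of two nonabelian planes (`isListed_d2Sharp`).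
An algebra with a Heisenberg ideal is governed by an endomorphism of the plane complementary to the
centre, to which `normalForm_two` applies.

The families are well defined because the triangular matrices with unit superdiagonal are cyclic,
hence determined up to conjugacy by their spectrum (`IsoTo.d3Family_of_symm`,
`IsoTo.d1Family_swap`), and rescaling `e₄` rescales the spectrum.

For injectivity, a number `LieStructure.kind`, built from properties of ad-nilpotent elements,
separates the three families and the six single structures. Within a family, an isomorphism carries
`e₄` to an element with fourth coordinate `t`, and comparing characteristic polynomials of the
adjoint maps shows that the spectra agree up to the factor `t`
(`LieStructure.IsTriangular.exists_multiset_eq`). -/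

namespace FourDimLie

/-! ### Recognizing a structure from a basis with its bracket table -/

section Tables

variable {L : Type*} [LieRing L] [LieAlgebra ℂ L]

/-- A basis of a four-dimensional Lie algebra `L` whose bracket table is that of `d` gives an
isomorphism of `L` with `d`. -/
theorem nonempty_lieEquiv_of_table (d : LieStructure) (b : Module.Basis (Fin 4) ℂ L)
    (h : ∀ i j, i < j → ⁅b i, b j⁆ =
      ∑ k, d.bracket (Pi.single i 1) (Pi.single j 1) k • b k) :
    Nonempty (L ≃ₗ⁅ℂ⁆ d.Carrier) := by
  have halt : ∀ x y, d.bracket x y = - d.bracket y x := fun x y => by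
    have := d.alt (x + y)
    simp only [map_add, LinearMap.add_apply, d.alt, zero_add, add_zero] at this
    exact eq_neg_of_add_eq_zero_left (by rw [add_comm] at this; exact this)
  have hall : ∀ i j, ⁅b i, b j⁆ =
      ∑ k, d.bracket (Pi.single i 1) (Pi.single j 1) k • b k := fun i j => by
    rcases lt_trichotomy i j with hij | rfl | hij
    · exact h i j hij
    · simp [d.alt]
    · rw [← lie_skew, h j i hij, halt (Pi.single i 1)]
      simp
  have key : ∀ x y, b.equivFun ⁅x, y⁆ = d.bracket (b.equivFun x) (b.equivFun y) := by
    have : (LieModule.toEnd ℂ L L : L →ₗ[ℂ] _).compr₂ (b.equivFun : L →ₗ[ℂ] V) =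
        d.bracket.compl₁₂ (b.equivFun : L →ₗ[ℂ] V) (b.equivFun : L →ₗ[ℂ] V) := by
      refine b.ext fun i => b.ext fun j => ?_
      simp only [LinearMap.compr₂_apply, LinearMap.compl₁₂_apply, LinearEquiv.coe_coe]
      change b.equivFun ⁅b i, b j⁆ = _
      rw [hall, map_sum]
      ext k
      have e : ∀ i : Fin 4, b.equivFun (b i) = Pi.single i 1 := fun i => by
        ext j; rw [Module.Basis.equivFun_self]; simp [Pi.single_apply, eq_comm]
      simp only [map_smul, e, Finset.sum_apply, Pi.smul_apply, smul_eq_mul]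
      rw [Finset.sum_eq_single k (fun m _ hm => by simp [hm.symm]) (by simp)]
      simp
    exact fun x y => LinearMap.congr_fun₂ this x y
  exact ⟨{ b.equivFun with map_lie' := fun {x y} => key x y }⟩

/-- Linear independence of four vectors, spelled out. -/
theorem linearIndependent_four {E : Type*} [AddCommGroup E] [Module ℂ E] {e₁ e₂ e₃ e₄ : E} :
    LinearIndependent ℂ ![e₁, e₂, e₃, e₄] ↔ ∀ a b c d : ℂ,
      a • e₁ + b • e₂ + c • e₃ + d • e₄ = 0 → a = 0 ∧ b = 0 ∧ c = 0 ∧ d = 0 := by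
  rw [Fintype.linearIndependent_iff]
  constructor
  · intro h a b c d hs
    have := h ![a, b, c, d] (by simpa [Fin.sum_univ_four] using hs)
    exact ⟨this 0, this 1, this 2, this 3⟩
  · intro h g hs
    have := h (g 0) (g 1) (g 2) (g 3) (by simpa [Fin.sum_univ_four] using hs)
    intro i
    fin_cases i <;> simp [this]

/-- Linear independence of three vectors, spelled out. -/
theorem linearIndependent_three {E : Type*} [AddCommGroup E] [Module ℂ E] {e₁ e₂ e₃ : E} :
    LinearIndependent ℂ ![e₁, e₂, e₃] ↔ ∀ a b c : ℂ,
      a • e₁ + b • e₂ + c • e₃ = 0 → a = 0 ∧ b = 0 ∧ c = 0 := by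
  rw [Fintype.linearIndependent_iff]
  constructor
  · intro h a b c hs
    have := h ![a, b, c] (by simpa [Fin.sum_univ_three] using hs)
    exact ⟨this 0, this 1, this 2⟩
  · intro h g hs
    have := h (g 0) (g 1) (g 2) (by simpa [Fin.sum_univ_three] using hs)
    intro i
    fin_cases i <;> simp [this]

variable (L) in
/-- `L` is isomorphic to the Lie algebra of `d`. -/
def IsoTo (d : LieStructure) : Prop := Nonempty (L ≃ₗ⁅ℂ⁆ d.Carrier)

theorem isoTo_of_table (hL : Module.finrank ℂ L = 4) (d : LieStructure) {e₁ e₂ e₃ e₄ : L}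
    (hli : ∀ a b c d : ℂ,
      a • e₁ + b • e₂ + c • e₃ + d • e₄ = 0 → a = 0 ∧ b = 0 ∧ c = 0 ∧ d = 0)
    (h : ∀ i j, i < j → ⁅![e₁, e₂, e₃, e₄] i, ![e₁, e₂, e₃, e₄] j⁆ =
      ∑ k, d.bracket (Pi.single i 1) (Pi.single j 1) k • ![e₁, e₂, e₃, e₄] k) :
    IsoTo L d := by
  have := nonempty_lieEquiv_of_table d (basisOfLinearIndependentOfCardEqFinrank
    (linearIndependent_four.2 hli) (by simp [hL]))
  simp only [coe_basisOfLinearIndependentOfCardEqFinrank] at this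
  exact this h

theorem forall_fin_four_lt {p : Fin 4 → Fin 4 → Prop} (h01 : p 0 1) (h02 : p 0 2) (h03 : p 0 3)
    (h12 : p 1 2) (h13 : p 1 3) (h23 : p 2 3) : ∀ i j, i < j → p i j := by
  intro i j hij
  fin_cases i <;> fin_cases j <;> first | assumption | (exact absurd hij (by decide))

variable (hL : Module.finrank ℂ L = 4) {e₁ e₂ e₃ e₄ : L}
  (hli : ∀ a b c d : ℂ,
    a • e₁ + b • e₂ + c • e₃ + d • e₄ = 0 → a = 0 ∧ b = 0 ∧ c = 0 ∧ d = 0)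

include hL hli

theorem isoTo_d3Family (a b c : ℂ) (h₁₂ : ⁅e₁, e₂⁆ = 0) (h₁₃ : ⁅e₁, e₃⁆ = 0) (h₂₃ : ⁅e₂, e₃⁆ = 0)
    (h₁₄ : ⁅e₁, e₄⁆ = a • e₁) (h₂₄ : ⁅e₂, e₄⁆ = e₁ + b • e₂) (h₃₄ : ⁅e₃, e₄⁆ = e₂ + c • e₃) :
    IsoTo L (d3Family a b c) :=
  isoTo_of_table hL _ hli <| forall_fin_four_lt
    (by simp [d3Family, psi_apply, h₁₂])
    (by simp [d3Family, psi_apply, h₁₃])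
    (by simp [d3Family, psi_apply, Fin.sum_univ_four, h₁₄])
    (by simp [d3Family, psi_apply, h₂₃])
    (by simp [d3Family, psi_apply, Fin.sum_univ_four, h₂₄])
    (by simp [d3Family, psi_apply, Fin.sum_univ_four, h₃₄])

theorem isoTo_d1Family (a b : ℂ) (h₁₂ : ⁅e₁, e₂⁆ = 0) (h₁₃ : ⁅e₁, e₃⁆ = 0) (h₂₃ : ⁅e₂, e₃⁆ = e₁)
    (h₁₄ : ⁅e₁, e₄⁆ = (a + b) • e₁) (h₂₄ : ⁅e₂, e₄⁆ = a • e₂) (h₃₄ : ⁅e₃, e₄⁆ = e₂ + b • e₃) :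
    IsoTo L (d1Family a b) :=
  isoTo_of_table hL _ hli <| forall_fin_four_lt
    (by simp [d1Family, psi_apply, h₁₂])
    (by simp [d1Family, psi_apply, h₁₃])
    (by simp [d1Family, psi_apply, Fin.sum_univ_four, h₁₄])
    (by simp [d1Family, psi_apply, h₂₃])
    (by simp [d1Family, psi_apply, Fin.sum_univ_four, h₂₄])
    (by simp [d1Family, psi_apply, Fin.sum_univ_four, h₃₄])

theorem isoTo_d3SmallFamily (a b : ℂ) (h₁₂ : ⁅e₁, e₂⁆ = 0) (h₁₃ : ⁅e₁, e₃⁆ = 0)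
    (h₂₃ : ⁅e₂, e₃⁆ = 0) (h₁₄ : ⁅e₁, e₄⁆ = a • e₁) (h₂₄ : ⁅e₂, e₄⁆ = a • e₂)
    (h₃₄ : ⁅e₃, e₄⁆ = e₂ + b • e₃) :
    IsoTo L (d3SmallFamily a b) :=
  isoTo_of_table hL _ hli <| forall_fin_four_lt
    (by simp [d3SmallFamily, psi_apply, h₁₂])
    (by simp [d3SmallFamily, psi_apply, h₁₃])
    (by simp [d3SmallFamily, psi_apply, Fin.sum_univ_four, h₁₄])
    (by simp [d3SmallFamily, psi_apply, h₂₃])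
    (by simp [d3SmallFamily, psi_apply, Fin.sum_univ_four, h₂₄])
    (by simp [d3SmallFamily, psi_apply, Fin.sum_univ_four, h₃₄])

theorem isoTo_d1 (h₁₂ : ⁅e₁, e₂⁆ = 0) (h₁₃ : ⁅e₁, e₃⁆ = 0) (h₂₃ : ⁅e₂, e₃⁆ = 0)
    (h₁₄ : ⁅e₁, e₄⁆ = 0) (h₂₄ : ⁅e₂, e₄⁆ = e₁) (h₃₄ : ⁅e₃, e₄⁆ = 0) :
    IsoTo L d1 :=
  isoTo_of_table hL _ hli <| forall_fin_four_lt
    (by simp [d1, psi_apply, h₁₂]) (by simp [d1, psi_apply, h₁₃]) (by simp [d1, psi_apply, h₁₄])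
    (by simp [d1, psi_apply, h₂₃]) (by simp [d1, psi_apply, h₂₄])
    (by simp [d1, psi_apply, h₃₄])

theorem isoTo_d1Sharp (h₁₂ : ⁅e₁, e₂⁆ = 0) (h₁₃ : ⁅e₁, e₃⁆ = 0) (h₂₃ : ⁅e₂, e₃⁆ = e₁)
    (h₁₄ : ⁅e₁, e₄⁆ = (2 : ℂ) • e₁) (h₂₄ : ⁅e₂, e₄⁆ = e₂) (h₃₄ : ⁅e₃, e₄⁆ = e₃) :
    IsoTo L d1Sharp :=
  isoTo_of_table hL _ hli <| forall_fin_four_lt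
    (by simp [d1Sharp, psi_apply, h₁₂]) (by simp [d1Sharp, psi_apply, h₁₃])
    (by simp [d1Sharp, psi_apply, Fin.sum_univ_four, h₁₄])
    (by simp [d1Sharp, psi_apply, h₂₃])
    (by simp [d1Sharp, psi_apply, h₂₄])
    (by simp [d1Sharp, psi_apply, h₃₄])

theorem isoTo_d2Star (h₁₂ : ⁅e₁, e₂⁆ = 0) (h₁₃ : ⁅e₁, e₃⁆ = 0) (h₂₃ : ⁅e₂, e₃⁆ = 0)
    (h₁₄ : ⁅e₁, e₄⁆ = 0) (h₂₄ : ⁅e₂, e₄⁆ = e₁) (h₃₄ : ⁅e₃, e₄⁆ = e₂) :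
    IsoTo L d2Star :=
  isoTo_of_table hL _ hli <| forall_fin_four_lt
    (by simp [d2Star, psi_apply, h₁₂]) (by simp [d2Star, psi_apply, h₁₃])
    (by simp [d2Star, psi_apply, h₁₄]) (by simp [d2Star, psi_apply, h₂₃])
    (by simp [d2Star, psi_apply, h₂₄])
    (by simp [d2Star, psi_apply, h₃₄])

theorem isoTo_d2Sharp (h₁₂ : ⁅e₁, e₂⁆ = e₁) (h₁₃ : ⁅e₁, e₃⁆ = 0) (h₂₃ : ⁅e₂, e₃⁆ = 0)
    (h₁₄ : ⁅e₁, e₄⁆ = 0) (h₂₄ : ⁅e₂, e₄⁆ = 0) (h₃₄ : ⁅e₃, e₄⁆ = e₃) :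
    IsoTo L d2Sharp :=
  isoTo_of_table hL _ hli <| forall_fin_four_lt
    (by simp [d2Sharp, psi_apply, h₁₂]) (by simp [d2Sharp, psi_apply, h₁₃])
    (by simp [d2Sharp, psi_apply, h₁₄]) (by simp [d2Sharp, psi_apply, h₂₃])
    (by simp [d2Sharp, psi_apply, h₂₄])
    (by simp [d2Sharp, psi_apply, h₃₄])

theorem isoTo_d3 (h₁₂ : ⁅e₁, e₂⁆ = e₃) (h₁₃ : ⁅e₁, e₃⁆ = e₂) (h₂₃ : ⁅e₂, e₃⁆ = e₁)
    (h₁₄ : ⁅e₁, e₄⁆ = 0) (h₂₄ : ⁅e₂, e₄⁆ = 0) (h₃₄ : ⁅e₃, e₄⁆ = 0) :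
    IsoTo L d3 :=
  isoTo_of_table hL _ hli <| forall_fin_four_lt
    (by simp [d3, psi_apply, h₁₂])
    (by simp [d3, psi_apply, h₁₃])
    (by simp [d3, psi_apply, h₁₄]) (by simp [d3, psi_apply, h₂₃])
    (by simp [d3, psi_apply, h₂₄]) (by simp [d3, psi_apply, h₃₄])

theorem isoTo_d3Star (h₁₂ : ⁅e₁, e₂⁆ = 0) (h₁₃ : ⁅e₁, e₃⁆ = 0) (h₂₃ : ⁅e₂, e₃⁆ = 0)
    (h₁₄ : ⁅e₁, e₄⁆ = e₁) (h₂₄ : ⁅e₂, e₄⁆ = e₂) (h₃₄ : ⁅e₃, e₄⁆ = e₃) :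
    IsoTo L d3Star :=
  isoTo_of_table hL _ hli <| forall_fin_four_lt
    (by simp [d3Star, psi_apply, h₁₂]) (by simp [d3Star, psi_apply, h₁₃])
    (by simp [d3Star, psi_apply, h₁₄]) (by simp [d3Star, psi_apply, h₂₃])
    (by simp [d3Star, psi_apply, h₂₄])
    (by simp [d3Star, psi_apply, h₃₄])

theorem isoTo_zero (h₁₂ : ⁅e₁, e₂⁆ = 0) (h₁₃ : ⁅e₁, e₃⁆ = 0) (h₂₃ : ⁅e₂, e₃⁆ = 0)
    (h₁₄ : ⁅e₁, e₄⁆ = 0) (h₂₄ : ⁅e₂, e₄⁆ = 0) (h₃₄ : ⁅e₃, e₄⁆ = 0) :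
    IsoTo L 0 := by
  have h0 : (0 : LieStructure).bracket = 0 := rfl
  exact isoTo_of_table hL _ hli <| forall_fin_four_lt
    (by simp [h0, h₁₂]) (by simp [h0, h₁₃]) (by simp [h0, h₁₄]) (by simp [h0, h₂₃])
    (by simp [h0, h₂₄]) (by simp [h0, h₃₄])

end Tables

/-! ### Normal forms of endomorphisms in dimensions two and three -/

section NormalForms

theorem exists_add_eq_mul_eq (s p : ℂ) : ∃ b c : ℂ, b + c = s ∧ b * c = p := by
  obtain ⟨r, hr⟩ := IsAlgClosed.exists_eq_mul_self (s ^ 2 - 4 * p)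
  exact ⟨(s + r) / 2, (s - r) / 2, by ring, by linear_combination hr / 4⟩

variable {E : Type*} [AddCommGroup E] [Module ℂ E]

/-- A nonscalar endomorphism of a plane has a cyclic vector, and its matrix is triangular in
a suitable basis ending in that vector. -/
theorem normalForm_two (hE : Module.finrank ℂ E = 2) (T : E →ₗ[ℂ] E) :
    (∃ c : ℂ, ∀ x, T x = c • x) ∨
    ∃ (e₁ e₂ : E) (b c : ℂ), LinearIndependent ℂ ![e₁, e₂] ∧ T e₁ = b • e₁ ∧
      T e₂ = e₁ + c • e₂ := by
  by_cases h : ∀ v, ¬ LinearIndependent ℂ ![v, T v]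
  · obtain ⟨c, rfl⟩ := T.exists_eq_smul_id_of_forall_notLinearIndependent h
    exact .inl ⟨c, fun x => by simp⟩
  · push Not at h
    obtain ⟨v, hv⟩ := h
    have hspan := hv.span_eq_top_of_card_eq_finrank (by simp [hE])
    have hmem : T (T v) ∈ Submodule.span ℂ (Set.range ![v, T v]) := hspan ▸ Submodule.mem_top
    rw [Matrix.range_cons_cons_empty, Submodule.mem_span_pair] at hmem
    obtain ⟨α, β, hαβ⟩ := hmem
    -- Since `T² v = α v + β T v`, these are the roots of the characteristic polynomial. By
    -- Cayley–Hamilton, `(T - c) v` is killed by `T - b`.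
    obtain ⟨b, c, hs, hp⟩ := exists_add_eq_mul_eq β (-α)
    refine .inr ⟨T v - c • v, v, b, c, ?_, ?_, by module⟩
    · rw [LinearIndependent.pair_iff] at hv ⊢
      intro s t hst
      have := hv (t - s * c) s (by rw [← hst]; module)
      refine ⟨this.2, by linear_combination this.1 + c * this.2⟩
    · rw [map_sub, map_smul, ← hαβ, ← hs, show α = - (b * c) by rw [hp]; ring]
      module

/-- `T` is the scalar `a` on the plane `ker φ`. It therefore suffices to find `e₃` outside this
plane with `T e₃ - b e₃` a nonzero vector of the plane for some `b`, to call that vector `e₂`, and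
to complete it to a basis of the plane. -/
theorem normalForm_of_rank_le_one (hE : Module.finrank ℂ E = 3) (T : E →ₗ[ℂ] E)
    (a : ℂ) (φ : E →ₗ[ℂ] ℂ) (w : E) (hT : ∀ x, T x = a • x + φ x • w) :
    (∃ c : ℂ, ∀ x, T x = c • x) ∨
    ∃ (e₁ e₂ e₃ : E) (a b : ℂ), LinearIndependent ℂ ![e₁, e₂, e₃] ∧ T e₁ = a • e₁ ∧
      T e₂ = a • e₂ ∧ T e₃ = e₂ + b • e₃ := by
  by_cases hφ : φ = 0
  · exact .inl ⟨a, fun x => by simp [hT, hφ]⟩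
  by_cases hw : w = 0
  · exact .inl ⟨a, fun x => by simp [hT, hw]⟩
  have : Module.Finite ℂ E := Module.finite_of_finrank_pos (by omega)
  have hker : Module.finrank ℂ (LinearMap.ker φ) = 2 := by
    have := Module.Dual.finrank_ker_add_one_of_ne_zero (f := φ) hφ
    omega
  obtain ⟨e₂, e₃, b, he₂, hφ₂, hφ₃, h₃⟩ : ∃ (e₂ e₃ : E) (b : ℂ), e₂ ≠ 0 ∧ φ e₂ = 0 ∧ φ e₃ ≠ 0 ∧
      T e₃ = e₂ + b • e₃ := by
    by_cases hφw : φ w = 0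
    · obtain ⟨v, hv⟩ : ∃ v, φ v ≠ 0 := by
        by_contra! h
        exact hφ (LinearMap.ext h)
      exact ⟨φ v • w, v, a, smul_ne_zero hv hw, by simp [hφw], hv, by rw [hT]; module⟩
    · have : Nontrivial (LinearMap.ker φ) := Module.nontrivial_of_finrank_pos (R := ℂ) (by omega)
      obtain ⟨⟨k, hk⟩, hk0⟩ := exists_ne (0 : LinearMap.ker φ)
      have hk' : φ k = 0 := hk
      -- Here `w` is an eigenvector for `a + φ w`, so `T` is diagonalizable. Adding the
      -- `a`-eigenvector `k` to `w` creates the nonzero off-diagonal term which the normal form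
      -- requires.
      refine ⟨-(φ w) • k, w + k, a + φ w, ?_, by simp [hk'], by simpa [hk'], ?_⟩
      · refine smul_ne_zero (neg_ne_zero.2 hφw) fun h => hk0 (by simpa using h)
      · rw [hT, map_add, hk']; module
  obtain ⟨⟨e₁, h₁⟩, hli⟩ := exists_linearIndependent_pair_of_one_lt_finrank (R := ℂ)
    (by omega) (x := (⟨e₂, hφ₂⟩ : LinearMap.ker φ)) (fun h => he₂ (congrArg Subtype.val h))
  have hφ₁ : φ e₁ = 0 := h₁
  refine .inr ⟨e₁, e₂, e₃, a, b, ?_, by simp [hT, hφ₁], by simp [hT, hφ₂], h₃⟩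
  rw [linearIndependent_three]
  rw [LinearIndependent.pair_iff] at hli
  intro x y z h
  have hz : z = 0 := by
    have := congrArg φ h
    simpa [hφ₁, hφ₂, hφ₃] using this
  subst hz
  have := hli y x (by ext; simp only [zero_smul, add_zero] at h; simpa [add_comm] using h)
  exact ⟨this.2, this.1, rfl⟩

/-- Normal form of an endomorphism of a three-dimensional space: scalar, or diagonalizable or
nilpotent up to a scalar with a two-dimensional eigenspace, or cyclic. -/
theorem normalForm_three (hE : Module.finrank ℂ E = 3) (T : E →ₗ[ℂ] E) :
    (∃ c : ℂ, ∀ x, T x = c • x) ∨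
    (∃ (e₁ e₂ e₃ : E) (a b : ℂ), LinearIndependent ℂ ![e₁, e₂, e₃] ∧ T e₁ = a • e₁ ∧
      T e₂ = a • e₂ ∧ T e₃ = e₂ + b • e₃) ∨
    ∃ (e₁ e₂ e₃ : E) (a b c : ℂ), LinearIndependent ℂ ![e₁, e₂, e₃] ∧ T e₁ = a • e₁ ∧
      T e₂ = e₁ + b • e₂ ∧ T e₃ = e₂ + c • e₃ := by
  have : Module.Finite ℂ E := Module.finite_of_finrank_pos (by omega)
  have : Nontrivial E := Module.nontrivial_of_finrank_pos (R := ℂ) (by omega)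
  -- An eigenvector `φ` of the transpose gives the `T`-invariant plane `ker φ`, with `T` acting as
  -- `a` on the quotient line.
  obtain ⟨a, ha⟩ := Module.End.exists_eigenvalue (K := ℂ) (Module.Dual.transpose (R := ℂ) T :
    Module.End ℂ (Module.Dual ℂ E))
  obtain ⟨φ, hφ⟩ := ha.exists_hasEigenvector
  have hφ0 : φ ≠ 0 := hφ.2
  have hφT : ∀ x, φ (T x) = a * φ x := fun x => LinearMap.congr_fun hφ.apply_eq_smul x
  have hker : Module.finrank ℂ (LinearMap.ker φ) = 2 := by
    have := Module.Dual.finrank_ker_add_one_of_ne_zero (f := φ) hφ0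
    omega
  have hinv : ∀ x ∈ LinearMap.ker φ, T x ∈ LinearMap.ker φ := fun x hx => by
    rw [LinearMap.mem_ker] at hx ⊢
    rw [hφT, hx, mul_zero]
  obtain ⟨v, hv⟩ : ∃ v, φ v = 1 := by
    obtain ⟨v, hv⟩ : ∃ v, φ v ≠ 0 := by
      by_contra! h
      exact hφ0 (LinearMap.ext h)
    exact ⟨(φ v)⁻¹ • v, by simp [hv]⟩
  have rank_one : (∃ (a : ℂ) (ψ : E →ₗ[ℂ] ℂ) (w : E), ∀ x, T x = a • x + ψ x • w) → _ :=
    fun ⟨a, ψ, w, h⟩ => (normalForm_of_rank_le_one hE T a ψ w h).imp_right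
      (Or.inl (b := ∃ (e₁ e₂ e₃ : E) (a b c : ℂ), LinearIndependent ℂ ![e₁, e₂, e₃] ∧
        T e₁ = a • e₁ ∧ T e₂ = e₁ + b • e₂ ∧ T e₃ = e₂ + c • e₃))
  rcases normalForm_two hker (T.restrict hinv) with ⟨b, hb⟩ | ⟨⟨e₁, h₁⟩, ⟨e₂, h₂⟩, b, c, hli, he₁, he₂⟩
  -- If `T` is the scalar `b` on `ker φ`, then `T - b` factors through `φ`.
  · apply rank_one
    refine ⟨b, φ, T v - b • v, fun x => ?_⟩
    have hmem : φ (x - φ x • v) = 0 := by simp [hv]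
    have := congrArg Subtype.val (hb ⟨x - φ x • v, hmem⟩)
    simp only [LinearMap.coe_restrict_apply, SetLike.val_smul, map_sub, map_smul] at this
    linear_combination (norm := module) this
  have he₁' : T e₁ = b • e₁ := congrArg Subtype.val he₁
  have he₂' : T e₂ = e₁ + c • e₂ := congrArg Subtype.val he₂
  have hφ₁ : φ e₁ = 0 := h₁
  have hφ₂ : φ e₂ = 0 := h₂
  have hli' : LinearIndependent ℂ ![e₁, e₂, v] := by
    rw [linearIndependent_three]
    rw [LinearIndependent.pair_iff] at hli
    intro x y z h
    have hz : z = 0 := by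
      have := congrArg φ h
      simpa [hφ₁, hφ₂, hv] using this
    subst hz
    have := hli x y (by ext; simp only [zero_smul, add_zero] at h; simpa using h)
    exact ⟨this.1, this.2, rfl⟩
  let B := basisOfLinearIndependentOfCardEqFinrank hli' (by simp [hE])
  have hB : ⇑B = ![e₁, e₂, v] := by simp [B]
  have hext : ∀ (x : E), B.coord 0 x • e₁ + B.coord 1 x • e₂ + B.coord 2 x • v = x := fun x => by
    have := B.sum_repr x
    rwa [Fin.sum_univ_three, hB] at this
  obtain ⟨α, β, hTv⟩ : ∃ α β : ℂ, T v = a • v + α • e₁ + β • e₂ := by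
    have h := hext (T v - a • v)
    have h2 : B.coord 2 (T v - a • v) = 0 := by
      have h0 : φ (T v - a • v) = 0 := by rw [map_sub, hφT, map_smul, smul_eq_mul, sub_self]
      have := congrArg φ h
      rw [h0, map_add φ, map_add φ, map_smul φ, map_smul φ, map_smul φ, hφ₁, hφ₂, hv] at this
      simpa only [smul_eq_mul, mul_zero, mul_one, zero_add] using this
    exact ⟨B.coord 0 (T v - a • v), B.coord 1 (T v - a • v), by
      rw [h2] at h; linear_combination (norm := module) -h⟩
  -- The vector `v + r e₂ + s e₁` is tested for cyclicity. Applying `T - a` and then `T - c` yields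
  -- the other two basis vectors below; the two hypotheses say that their leading coefficients do
  -- not vanish. The remaining case analysis chooses `r` and `s`, or finds that `T` minus a scalar
  -- has rank at most one.
  have cyclic : ∀ r s : ℂ, β + r * (c - a) ≠ 0 →
      β + r * (c - a) - (c - b) * (α + s * (b - a) + r) ≠ 0 →
      ∃ (e₁ e₂ e₃ : E) (a b c : ℂ), LinearIndependent ℂ ![e₁, e₂, e₃] ∧ T e₁ = a • e₁ ∧
        T e₂ = e₁ + b • e₂ ∧ T e₃ = e₂ + c • e₃ := by
    intro r s h₁ h₂
    refine ⟨(β + r * (c - a) - (c - b) * (α + s * (b - a) + r)) • e₁,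
      (α + s * (b - a) + r) • e₁ + (β + r * (c - a)) • e₂, v + r • e₂ + s • e₁, b, c, a,
      ?_, ?_, ?_, ?_⟩
    · rw [linearIndependent_three] at hli' ⊢
      intro x y z h
      obtain ⟨hx, hy, rfl⟩ := hli' (x * (β + r * (c - a) - (c - b) * (α + s * (b - a) + r)) +
        y * (α + s * (b - a) + r) + z * s) (y * (β + r * (c - a)) + z * r) z (by rw [← h]; module)
      have hy' : y = 0 := by simpa [h₁] using hy
      subst hy'
      exact ⟨by simpa [h₂] using hx, rfl, rfl⟩
    · simp only [map_smul, he₁']; module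
    · simp only [map_add, map_smul, he₁', he₂']; module
    · simp only [map_add, map_smul, he₁', he₂', hTv]; module
  by_cases hca : c = a
  · subst hca
    by_cases hβ : β = 0
    · subst hβ
      refine rank_one ⟨c, (b - c) • B.coord 0 + B.coord 1 + α • B.coord 2, e₁, fun x => ?_⟩
      have := congrArg T (hext x)
      simp only [map_add, map_smul, he₁', he₂', hTv] at this
      rw [← this]
      conv_rhs => enter [1, 2]; rw [← hext x]
      simp only [LinearMap.add_apply, LinearMap.smul_apply, smul_eq_mul]
      module
    · refine .inr (.inr ?_)
      by_cases hbc : b = c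
      · subst hbc
        exact cyclic 0 0 (by simpa) (by simpa)
      -- The first coefficient is `β` whatever `r` is; `s` is chosen to make the second equal to
      -- `1`.
      · have : b - c ≠ 0 := sub_ne_zero.2 hbc
        refine cyclic 0 ((1 - β + (c - b) * α) / (b - c) / (b - c)) (by simpa) ?_
        rw [div_mul_cancel₀ _ this]
        convert one_ne_zero (α := ℂ) using 1
        field_simp
        ring
  · have hca' : c - a ≠ 0 := sub_ne_zero.2 hca
    by_cases hba : b = a
    · subst hba
      -- For `b = a` the second coefficient is `β - (c - b) α`, independent of `r` and `s`. If it
      -- vanishes, `T - b` has rank at most one.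
      by_cases hβ : β = (c - b) * α
      · subst hβ
        refine rank_one ⟨b, B.coord 1 + α • B.coord 2, e₁ + (c - b) • e₂, fun x => ?_⟩
        have := congrArg T (hext x)
        simp only [map_add, map_smul, he₁', he₂', hTv] at this
        rw [← this]
        conv_rhs => enter [1, 2]; rw [← hext x]
        simp only [LinearMap.add_apply, LinearMap.smul_apply, smul_eq_mul]
        module
      · refine .inr (.inr (cyclic ((1 - β) / (c - b)) 0 (by field_simp; simp) ?_))
        have := sub_ne_zero.2 hβ
        convert this using 1
        ring
    · have hba' : b - a ≠ 0 := sub_ne_zero.2 hba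
      have h1 : β + (1 - β) / (c - a) * (c - a) = 1 := by field_simp; ring
      by_cases hcb : c = b
      · subst hcb
        exact .inr (.inr (cyclic ((1 - β) / (c - a)) 0 (by simp [h1]) (by simp [h1])))
      · have hcb' : c - b ≠ 0 := sub_ne_zero.2 hcb
        -- For distinct eigenvalues, `r` makes the first coefficient `1` and `s` kills the
        -- `e₁`-coordinate of the image under `T - a`, so that the second coefficient is `1` too.
        refine .inr (.inr (cyclic ((1 - β) / (c - a)) (-(α + (1 - β) / (c - a)) / (b - a))
          (by simp [h1]) ?_))
        rw [h1, div_mul_cancel₀ _ hba']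
        convert one_ne_zero (α := ℂ) using 1
        ring

end NormalForms

/-! ### Lie algebras with a prescribed ideal of codimension one, and the sum of two nonabelian
planes -/

section Types

variable {L : Type*} [LieRing L] [LieAlgebra ℂ L]

variable (L) in
/-- `L` is abelian or isomorphic to a member of the list. -/
def IsListed : Prop :=
  IsoTo L 0 ∨
  (∃ a b c : ℂ, ![a, b, c] ≠ 0 ∧ IsoTo L (d3Family a b c)) ∨
  (∃ a b : ℂ, ![a, b] ≠ 0 ∧ IsoTo L (d1Family a b)) ∨
  (∃ a b : ℂ, ![a, b] ≠ 0 ∧ IsoTo L (d3SmallFamily a b)) ∨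
  ∃ s : SinglePoint, IsoTo L s.structureAt

theorem IsListed.of_single (s : SinglePoint) (h : IsoTo L s.structureAt) : IsListed L :=
  .inr (.inr (.inr (.inr ⟨s, h⟩)))

variable (hL : Module.finrank ℂ L = 4)
include hL

/-- A Lie algebra with an abelian ideal of codimension one is listed. -/
theorem isListed_of_abelian_ideal (I : Submodule ℂ L) (hI : Module.finrank ℂ I = 3) {w : L}
    (hw : w ∉ I) (hab : ∀ x ∈ I, ∀ y ∈ I, ⁅x, y⁆ = 0) (hid : ∀ x ∈ I, ⁅x, w⁆ ∈ I) :
    IsListed L := by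
  -- The sign is there because the tables list `[eᵢ, e₄]`, not `[e₄, eᵢ]`.
  let T : I →ₗ[ℂ] I := LinearMap.restrict (-(LieAlgebra.ad ℂ L w : L →ₗ[ℂ] L)) (p := I) (q := I)
    (fun x hx => by simpa using hid x hx)
  have hT : ∀ x : I, ((T x : I) : L) = ⁅(x : L), w⁆ := fun x => by
    simp [T]
  have li : ∀ {e₁ e₂ e₃ : I}, LinearIndependent ℂ ![e₁, e₂, e₃] → ∀ a b c d : ℂ,
      a • (e₁ : L) + b • (e₂ : L) + c • (e₃ : L) + d • w = 0 →
        a = 0 ∧ b = 0 ∧ c = 0 ∧ d = 0 := by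
    intro e₁ e₂ e₃ hli a b c d h
    have hd : d = 0 := by
      by_contra hd
      refine hw ?_
      have : d • w ∈ I := by
        rw [eq_neg_of_add_eq_zero_right h]
        exact (-(a • e₁ + b • e₂ + c • e₃)).2
      exact (Submodule.smul_mem_iff _ hd).1 this
    subst hd
    obtain ⟨h₁, h₂, h₃⟩ := linearIndependent_three.1 hli a b c
      (Subtype.ext (by rw [zero_smul, add_zero] at h; exact h))
    exact ⟨h₁, h₂, h₃, rfl⟩
  have hab' : ∀ x y : I, ⁅(x : L), (y : L)⁆ = 0 := fun x y => hab x x.2 y y.2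
  rcases normalForm_three hI T with ⟨c, hc⟩ | ⟨e₁, e₂, e₃, a, b, hli, h₁, h₂, h₃⟩ |
    ⟨e₁, e₂, e₃, a, b, c, hli, h₁, h₂, h₃⟩
  · have : Module.Finite ℂ I := Module.finite_of_finrank_pos (by omega)
    let B := Module.finBasisOfFinrankEq ℂ I hI
    have hB : LinearIndependent ℂ ![B 0, B 1, B 2] := by
      convert B.linearIndependent
      ext i; fin_cases i <;> rfl
    have hBc : ∀ x : I, ⁅(x : L), w⁆ = c • (x : L) := fun x => by rw [← hT, hc]; rfl
    by_cases hc0 : c = 0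
    · subst hc0
      exact .inl (isoTo_zero hL (li hB) (hab' _ _) (hab' _ _) (hab' _ _)
        ((hBc _).trans (zero_smul _ _)) ((hBc _).trans (zero_smul _ _))
        ((hBc _).trans (zero_smul _ _)))
    · refine .of_single .d3Star (isoTo_d3Star hL (e₁ := (B 0 : L)) (e₂ := B 1) (e₃ := B 2)
        (e₄ := c⁻¹ • w) ?_ (hab' _ _) (hab' _ _) (hab' _ _) ?_ ?_ ?_)
      · intro x y z t h
        have := li hB x y z (t * c⁻¹) (by rw [← h]; module)
        simpa [hc0] using this
      all_goals rw [lie_smul, hBc, smul_smul, inv_mul_cancel₀ hc0, one_smul]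
  · have h₁' := (hT e₁).symm.trans (congrArg Subtype.val h₁)
    have h₂' := (hT e₂).symm.trans (congrArg Subtype.val h₂)
    have h₃' := (hT e₃).symm.trans (congrArg Subtype.val h₃)
    simp only [Submodule.coe_add, Submodule.coe_smul] at h₁' h₂' h₃'
    -- The parameter `(0, 0)` is excluded from the family; the algebra is then the nilpotent `d1`,
    -- after a relabelling of the basis.
    by_cases hab0 : ![a, b] = 0
    · have ha : a = 0 := congrFun hab0 0
      have hb : b = 0 := congrFun hab0 1
      subst ha hb
      refine .of_single .d1 (isoTo_d1 hL (e₁ := (e₂ : L)) (e₂ := e₃) (e₃ := e₁) (e₄ := w)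
        ?_ (hab' _ _) (hab' _ _) (hab' _ _) (by simpa using h₂') (by simpa using h₃')
        (by simpa using h₁'))
      intro x y z t h
      have := li hli z x y t (by rw [← h]; module)
      tauto
    · exact .inr (.inr (.inr (.inl ⟨a, b, hab0, isoTo_d3SmallFamily hL (li hli) a b
        (hab' _ _) (hab' _ _) (hab' _ _) h₁' h₂' h₃'⟩)))
  · have h₁' := (hT e₁).symm.trans (congrArg Subtype.val h₁)
    have h₂' := (hT e₂).symm.trans (congrArg Subtype.val h₂)
    have h₃' := (hT e₃).symm.trans (congrArg Subtype.val h₃)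
    simp only [Submodule.coe_add, Submodule.coe_smul] at h₁' h₂' h₃'
    by_cases h0 : ![a, b, c] = 0
    · have ha : a = 0 := congrFun h0 0
      have hb : b = 0 := congrFun h0 1
      have hc : c = 0 := congrFun h0 2
      subst ha hb hc
      exact .of_single .d2Star (isoTo_d2Star hL (li hli)
        (hab' _ _) (hab' _ _) (hab' _ _) (by simpa using h₁') (by simpa using h₂')
        (by simpa using h₃'))
    · exact .inr (.inl ⟨a, b, c, h0, isoTo_d3Family hL (li hli) a b c
        (hab' _ _) (hab' _ _) (hab' _ _) h₁' h₂' h₃'⟩)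

theorem isListed_of_abelian_ideal' {e₁ e₂ e₃ w : L}
    (hli : ∀ a b c d : ℂ,
      a • e₁ + b • e₂ + c • e₃ + d • w = 0 → a = 0 ∧ b = 0 ∧ c = 0 ∧ d = 0)
    (h₁₂ : ⁅e₁, e₂⁆ = 0) (h₁₃ : ⁅e₁, e₃⁆ = 0) (h₂₃ : ⁅e₂, e₃⁆ = 0)
    (h₁ : ∃ a b c : ℂ, ⁅e₁, w⁆ = a • e₁ + b • e₂ + c • e₃)
    (h₂ : ∃ a b c : ℂ, ⁅e₂, w⁆ = a • e₁ + b • e₂ + c • e₃)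
    (h₃ : ∃ a b c : ℂ, ⁅e₃, w⁆ = a • e₁ + b • e₂ + c • e₃) : IsListed L := by
  have hli3 : LinearIndependent ℂ ![e₁, e₂, e₃] := linearIndependent_three.2 fun a b c h => by
    have := hli a b c 0 (by rw [h]; simp)
    tauto
  have mem : ∀ x, x ∈ Submodule.span ℂ (Set.range ![e₁, e₂, e₃]) ↔
      ∃ a b c : ℂ, x = a • e₁ + b • e₂ + c • e₃ := fun x => by
    rw [Submodule.mem_span_range_iff_exists_fun]
    simp only [Fin.sum_univ_three]
    exact ⟨fun ⟨c, hc⟩ => ⟨c 0, c 1, c 2, hc.symm⟩, fun ⟨a, b, c, h⟩ => ⟨![a, b, c], h.symm⟩⟩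
  have h₂₁ : ⁅e₂, e₁⁆ = 0 := by rw [← lie_skew, h₁₂, neg_zero]
  have h₃₁ : ⁅e₃, e₁⁆ = 0 := by rw [← lie_skew, h₁₃, neg_zero]
  have h₃₂ : ⁅e₃, e₂⁆ = 0 := by rw [← lie_skew, h₂₃, neg_zero]
  refine isListed_of_abelian_ideal hL (Submodule.span ℂ (Set.range ![e₁, e₂, e₃])) (w := w)
    (by rw [finrank_span_eq_card hli3]; simp) ?_ ?_ ?_
  · rw [mem]
    rintro ⟨a, b, c, h⟩
    have := hli a b c (-1) (by rw [h]; module)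
    simp at this
  · intro x hx y hy
    rw [mem] at hx hy
    obtain ⟨a, b, c, rfl⟩ := hx
    obtain ⟨a', b', c', rfl⟩ := hy
    simp [h₁₂, h₁₃, h₂₃, h₂₁, h₃₁, h₃₂]
  · intro x hx
    rw [mem] at hx
    obtain ⟨a, b, c, rfl⟩ := hx
    rw [← mem] at h₁ h₂ h₃
    simp only [add_lie, smul_lie]
    exact add_mem (add_mem (Submodule.smul_mem _ _ h₁) (Submodule.smul_mem _ _ h₂))
      (Submodule.smul_mem _ _ h₃)

/-- A Lie algebra with a Heisenberg ideal of codimension one is listed. -/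
theorem isListed_of_heisenberg_ideal {z x y w : L}
    (hli : ∀ a b c d : ℂ,
      a • z + b • x + c • y + d • w = 0 → a = 0 ∧ b = 0 ∧ c = 0 ∧ d = 0)
    (hxy : ⁅x, y⁆ = z) (hzx : ⁅z, x⁆ = 0) (hzy : ⁅z, y⁆ = 0)
    (hx : ∃ a b c : ℂ, ⁅x, w⁆ = a • z + b • x + c • y)
    (hy : ∃ a b c : ℂ, ⁅y, w⁆ = a • z + b • x + c • y) : IsListed L := by
  obtain ⟨r₁, s₁, s₂, hx⟩ := hx
  obtain ⟨r₂, s₃, s₄, hy⟩ := hy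
  have hyx : ⁅y, x⁆ = -z := by rw [← lie_skew, hxy]
  -- Correcting `w` by an element of the Heisenberg ideal removes the central components of `[x, w]`
  -- and `[y, w]`, so the plane spanned by `x` and `y` becomes stable.
  obtain ⟨v, hv⟩ : ∃ v, v = w + r₂ • x - r₁ • y := ⟨_, rfl⟩
  have hxv : ⁅x, v⁆ = s₁ • x + s₂ • y := by
    rw [hv]; simp only [lie_add, lie_sub, lie_smul, lie_self, hx, hxy]; module
  have hyv : ⁅y, v⁆ = s₃ • x + s₄ • y := by
    rw [hv]; simp only [lie_add, lie_sub, lie_smul, lie_self, hy, hyx]; module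
  have hli : ∀ a b c d : ℂ,
      a • z + b • x + c • y + d • v = 0 → a = 0 ∧ b = 0 ∧ c = 0 ∧ d = 0 := by
    intro a b c d h
    obtain ⟨h₁, h₂, h₃, rfl⟩ := hli a (b + d * r₂) (c - d * r₁) d (by rw [← h, hv]; module)
    simpa using And.intro h₁ (And.intro h₂ h₃)
  -- By Jacobi, `z = [x, y]` is scaled by the trace of the action on the plane. This is the origin
  -- of the coefficient `λ + μ` in `d1Family`.
  have hzv : ⁅z, v⁆ = (s₁ + s₄) • z := by
    rw [← hxy, lie_lie, hyv, hxv]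
    simp only [lie_add, lie_smul, lie_self, hxy, hyx]
    module
  have hli2 : LinearIndependent ℂ ![x, y] := LinearIndependent.pair_iff.2 fun b c h => by
    have := hli 0 b c 0 (by rw [← h]; module)
    tauto
  let J := Submodule.span ℂ (Set.range ![x, y])
  have mem : ∀ u, u ∈ J ↔ ∃ a b : ℂ, u = a • x + b • y := fun u => by
    rw [Submodule.mem_span_range_iff_exists_fun]
    simp only [Fin.sum_univ_two]
    exact ⟨fun ⟨c, hc⟩ => ⟨c 0, c 1, hc.symm⟩, fun ⟨a, b, h⟩ => ⟨![a, b], h.symm⟩⟩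
  have hJ : Module.finrank ℂ J = 2 := by rw [finrank_span_eq_card hli2]; simp
  let T : J →ₗ[ℂ] J := LinearMap.restrict (-(LieAlgebra.ad ℂ L v : L →ₗ[ℂ] L)) (p := J) (q := J)
    (fun u hu => by
      obtain ⟨a, b, rfl⟩ := (mem u).1 hu
      refine (mem _).2 ⟨a * s₁ + b * s₃, a * s₂ + b * s₄, ?_⟩
      simp only [LinearMap.neg_apply, LieAlgebra.ad_apply, lie_skew, add_lie, smul_lie, hxv, hyv]
      module)
  have hT : ∀ u : J, ((T u : J) : L) = ⁅(u : L), v⁆ := fun u => by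
    simp [T]
  rcases normalForm_two hJ T with ⟨c, hc⟩ | ⟨e₂, e₃, b, c, hli', h₂, h₃⟩
  · have hTc : ∀ u : L, u ∈ J → ⁅u, v⁆ = c • u := fun u hu => by rw [← hT ⟨u, hu⟩, hc]; rfl
    have hxc := hTc x ((mem _).2 ⟨1, 0, by module⟩)
    have hyc := hTc y ((mem _).2 ⟨0, 1, by module⟩)
    have hzc : ⁅z, v⁆ = (c + c) • z := by
      rw [← hxy, lie_lie, hyc, hxc]
      simp only [lie_smul, hxy, hyx]
      module
    -- For `c = 0` the algebra is Heisenberg plus a central line spanned by `v`, which is `d1` with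
    -- `v` as third basis vector.
    by_cases hc0 : c = 0
    · subst hc0
      refine .of_single .d1 (isoTo_d1 hL (e₁ := z) (e₂ := x) (e₃ := v) (e₄ := y)
        ?_ hzx (by simpa using hzc) (by simpa using hxc) hzy hxy
        (by rw [← lie_skew, hyc]; simp))
      intro p q r s h
      have := hli p q s r (by rw [← h]; module)
      tauto
    · refine .of_single .d1Sharp (isoTo_d1Sharp hL (e₁ := z) (e₂ := x) (e₃ := y) (e₄ := c⁻¹ • v)
        ?_ hzx hzy hxy ?_ ?_ ?_)
      · intro p q r s h
        have := hli p q r (s * c⁻¹) (by rw [← h]; module)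
        simpa [hc0] using this
      · rw [lie_smul, hzc, smul_smul, mul_add, inv_mul_cancel₀ hc0]; norm_num
      · rw [lie_smul, hxc, smul_smul, inv_mul_cancel₀ hc0, one_smul]
      · rw [lie_smul, hyc, smul_smul, inv_mul_cancel₀ hc0, one_smul]
  · have h₂' := (hT e₂).symm.trans (congrArg Subtype.val h₂)
    have h₃' := (hT e₃).symm.trans (congrArg Subtype.val h₃)
    simp only [Submodule.coe_add, Submodule.coe_smul] at h₂' h₃'
    obtain ⟨e₂, he₂⟩ := e₂
    obtain ⟨e₃, he₃⟩ := e₃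
    simp only at h₂' h₃'
    rw [LinearIndependent.pair_iff] at hli'
    replace hli' : ∀ s t : ℂ, s • e₂ + t • e₃ = 0 → s = 0 ∧ t = 0 :=
      fun s t h => hli' s t (Subtype.ext h)
    obtain ⟨p, q, he₂⟩ := (mem _).1 he₂
    obtain ⟨r, s, he₃⟩ := (mem _).1 he₃
    -- This is the determinant of the change of basis from `x, y` to `e₂, e₃`, so `[e₂, e₃]` is this
    -- multiple of `z`, and `z` has to be rescaled by it.
    have hκ : p * s - q * r ≠ 0 := by
      intro h0
      have h1 := hli' s (-q) (by
        rw [he₂, he₃, show (0 : L) = (p * s - q * r) • x by rw [h0, zero_smul]]; module)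
      have h2 := hli' r (-p) (by
        rw [he₂, he₃, show (0 : L) = -(p * s - q * r) • y by rw [h0, neg_zero, zero_smul]]
        module)
      have h3 := hli' 1 0 (by
        rw [he₂, neg_eq_zero.1 h1.2, neg_eq_zero.1 h2.2]; simp)
      exact one_ne_zero h3.1
    have h₂₃ : ⁅e₂, e₃⁆ = (p * s - q * r) • z := by
      rw [he₂, he₃]
      simp only [add_lie, lie_add, smul_lie, lie_smul, lie_self, hxy, hyx]
      module
    generalize hκ' : p * s - q * r = κ at *
    have h₁₂ : ⁅κ • z, e₂⁆ = 0 := by rw [he₂]; simp [hzx, hzy]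
    have h₁₃ : ⁅κ • z, e₃⁆ = 0 := by rw [he₃]; simp [hzx, hzy]
    have h₁ : ⁅κ • z, v⁆ = (b + c) • κ • z := by
      rw [← h₂₃, lie_lie, h₂', h₃']
      have : ⁅e₃, e₂⁆ = -(κ • z) := by rw [← lie_skew, h₂₃]
      simp only [lie_add, lie_smul, lie_self, h₂₃, this]
      module
    have hli4 : ∀ a b c d : ℂ,
        a • κ • z + b • e₂ + c • e₃ + d • v = 0 → a = 0 ∧ b = 0 ∧ c = 0 ∧ d = 0 := by
      intro a b c d h
      have h' := hli (a * κ) (b * p + c * r) (b * q + c * s) d (by rw [← h, he₂, he₃]; module)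
      have h'' := hli' b c (by
        rw [he₂, he₃]
        linear_combination (norm := module) h'.2.1 • x + h'.2.2.1 • y)
      exact ⟨by simpa [hκ] using h'.1, h''.1, h''.2, h'.2.2.2⟩
    -- In the nilpotent case `z, e₂, v` span an abelian ideal on which `e₃` acts by a single Jordan
    -- block, so the algebra is `d2Star`.
    by_cases hbc : ![b, c] = 0
    · have hb : b = 0 := congrFun hbc 0
      have hc : c = 0 := congrFun hbc 1
      subst hb hc
      refine .of_single .d2Star (isoTo_d2Star hL (e₁ := κ • z) (e₂ := e₂) (e₃ := -v) (e₄ := e₃)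
        ?_ h₁₂ ?_ ?_ h₁₃ h₂₃ ?_)
      · intro p q r s h
        have := hli4 p q s (-r) (by rw [← h]; module)
        simp only [neg_eq_zero] at this
        tauto
      · rw [lie_neg, h₁]; simp
      · rw [lie_neg, h₂']; simp
      · rw [neg_lie, lie_skew, h₃']; simp
    · exact .inr (.inr (.inl ⟨b, c, hbc, isoTo_d1Family hL hli4 b c h₁₂ h₁₃ h₂₃ h₁ h₂' h₃'⟩))

/-- The elements `y` and `x` act on the abelian plane of `n` and `m` by complementary projections.
Adding elements of the plane to them makes them commute, and `L` splits as the sum of two nonabelian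
planes. The signs below adapt this to the table of `d2Sharp`. -/
theorem isListed_d2Sharp {n m x y : L}
    (hli : ∀ a b c d : ℂ,
      a • n + b • m + c • x + d • y = 0 → a = 0 ∧ b = 0 ∧ c = 0 ∧ d = 0)
    (hnm : ⁅n, m⁆ = 0) (hxn : ⁅x, n⁆ = 0) (hxm : ⁅x, m⁆ = m) (hyn : ⁅y, n⁆ = n) (hym : ⁅y, m⁆ = 0)
    (hyx : ∃ p q : ℂ, ⁅y, x⁆ = p • n + q • m) : IsListed L := by
  obtain ⟨p, q, hyx⟩ := hyx
  have hny : ⁅n, y⁆ = -n := by rw [← lie_skew, hyn]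
  have hnx : ⁅n, x⁆ = 0 := by rw [← lie_skew, hxn, neg_zero]
  have hmx : ⁅m, x⁆ = -m := by rw [← lie_skew, hxm]
  have hmn : ⁅m, n⁆ = 0 := by rw [← lie_skew, hnm, neg_zero]
  refine .of_single .d2Sharp (isoTo_d2Sharp hL (e₁ := n) (e₂ := -(y + q • m)) (e₃ := m)
    (e₄ := -(x - p • n)) ?_ ?_ hnm ?_ ?_ ?_ ?_)
  · intro a b c d h
    have := hli (a + d * p) (c - b * q) (-d) (-b) (by rw [← h]; module)
    simp only [neg_eq_zero] at this
    obtain ⟨h1, h2, h3, h4⟩ := this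
    subst h3 h4
    simpa using And.intro h1 h2
  · simp [hny, hnm]
  · simp [hym]
  · simp [hnx]
  · simp only [lie_neg, neg_lie, lie_sub, add_lie, lie_smul, smul_lie, hyx, hyn, hmx, hmn]; module
  · simp [hmx, hmn]

/-- A Lie algebra with an `𝔰𝔩₂`-triple `h, x, y` spanning an ideal of codimension one is
isomorphic to `𝔰𝔩₂ ⊕ ℂ`. -/
theorem isListed_d3 {h x y u : L}
    (hli : ∀ a b c d : ℂ,
      a • h + b • x + c • y + d • u = 0 → a = 0 ∧ b = 0 ∧ c = 0 ∧ d = 0)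
    (hhx : ⁅h, x⁆ = x) (hhy : ⁅h, y⁆ = -y) (hxy : ⁅x, y⁆ = h)
    (huh : ∃ a b c : ℂ, ⁅u, h⁆ = a • h + b • x + c • y)
    (hux : ∃ a b c : ℂ, ⁅u, x⁆ = a • h + b • x + c • y)
    (huy : ∃ a b c : ℂ, ⁅u, y⁆ = a • h + b • x + c • y) : IsListed L := by
  obtain ⟨a₁, a₂, a₃, huh⟩ := huh
  obtain ⟨b₁, b₂, b₃, hux⟩ := hux
  obtain ⟨c₁, c₂, c₃, huy⟩ := huy
  have hxh : ⁅x, h⁆ = -x := by rw [← lie_skew, hhx]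
  have hyh : ⁅y, h⁆ = y := by rw [← lie_skew, hhy, neg_neg]
  have hyx : ⁅y, x⁆ = -h := by rw [← lie_skew, hxy]
  -- Jacobi says that `ad u` is a derivation of `𝔰𝔩₂`. Solving for its nine coefficients shows that
  -- it is inner, equal to the adjoint of `b₂ h - a₂ x + a₃ y`; subtracting this from `u` leaves an
  -- element `v` commuting with `h`, `x` and `y`.
  have j₁ := leibniz_lie u h x
  have j₂ := leibniz_lie u h y
  have j₃ := leibniz_lie u x y
  simp only [huh, hux, huy, hhx, hhy, hxy, hxh, hyx, lie_add, add_lie, lie_smul, smul_lie,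
    lie_self, lie_neg] at j₁ j₂ j₃
  obtain ⟨k₁, k₂, k₃, -⟩ := hli (b₁ + a₃) (-a₁) (2 * b₃) 0
    (by linear_combination (norm := module) j₁)
  obtain ⟨l₁, l₂, -, -⟩ := hli (-c₁ - a₂) (-2 * c₂) a₁ 0
    (by linear_combination (norm := module) j₂)
  obtain ⟨m₁, -, -, -⟩ := hli (a₁ - b₂ - c₃) (a₂ + c₁) (a₃ + b₁) 0
    (by linear_combination (norm := module) j₃)
  obtain rfl : a₁ = 0 := by simpa using k₂
  obtain rfl : b₃ = 0 := by simpa using k₃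
  obtain rfl : c₂ = 0 := by simpa using l₂
  obtain rfl : b₁ = -a₃ := by linear_combination k₁
  obtain rfl : c₁ = -a₂ := by linear_combination -l₁
  obtain rfl : c₃ = -b₂ := by linear_combination -m₁
  obtain ⟨v, hv⟩ : ∃ v, v = u - b₂ • h + a₂ • x - a₃ • y := ⟨_, rfl⟩
  have hhv : ⁅h, v⁆ = 0 := by
    rw [← lie_skew, hv]
    simp only [sub_lie, add_lie, smul_lie, lie_self, huh, hxh, hyh]
    module
  have hxv : ⁅x, v⁆ = 0 := by
    rw [← lie_skew, hv]
    simp only [sub_lie, add_lie, smul_lie, lie_self, hux, hhx, hyx]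
    module
  have hyv : ⁅y, v⁆ = 0 := by
    rw [← lie_skew, hv]
    simp only [sub_lie, add_lie, smul_lie, lie_self, huy, hhy, hxy]
    module
  refine .of_single .d3 (isoTo_d3 hL (e₁ := h) (e₂ := x - (1 / 2 : ℂ) • y)
    (e₃ := x + (1 / 2 : ℂ) • y) (e₄ := v) ?_ ?_ ?_ ?_ hhv ?_ ?_)
  · intro a b c d hs
    have := hli (a - d * b₂) (b + c + d * a₂) ((c - b) / 2 - d * a₃) d (by rw [← hs, hv]; module)
    obtain ⟨h1, h2, h3, rfl⟩ := this
    refine ⟨by linear_combination h1, by linear_combination h2 / 2 - h3,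
      by linear_combination h2 / 2 + h3, rfl⟩
  · simp only [lie_sub, lie_smul, hhx, hhy]; module
  · simp only [lie_add, lie_smul, hhx, hhy]; module
  · simp only [sub_lie, lie_add, smul_lie, lie_smul, lie_self, hxy, hyx]; module
  · simp [hxv, hyv]
  · simp [hxv, hyv]

end Types

/-! ### No four-dimensional Lie algebra is perfect -/

section Perfect

/-- For the structure constants `c` of a unimodular four-dimensional Lie algebra and a linear form
`f`, the Pfaffian of the two-form `(x, y) ↦ f ⁅x, y⁆` vanishes. -/
theorem pfaffian_eq_zero (c : Fin 4 → Fin 4 → Fin 4 → ℂ) (f : Fin 4 → ℂ)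
    (F : Fin 4 → Fin 4 → ℂ) (hF : ∀ i j, F i j = ∑ m, c i j m * f m)
    (hc : ∀ i j m, c j i m = -c i j m)
    (hJ : ∀ i j k, ∑ m, c i j m * F m k + ∑ m, c j k m * F m i + ∑ m, c k i m * F m j = 0)
    (ht : ∀ i, ∑ k, c i k k = 0) :
    F 0 1 * F 2 3 - F 0 2 * F 1 3 + F 0 3 * F 1 2 = 0 := by
  have hd : ∀ i m, c i i m = 0 := fun i m => by linear_combination hc i i m / 2
  have j₀ := hJ 1 2 3
  have j₁ := hJ 0 2 3
  have j₂ := hJ 0 1 3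
  have j₃ := hJ 0 1 2
  have t₀ := ht 0
  have t₁ := ht 1
  have t₂ := ht 2
  have t₃ := ht 3
  simp only [Fin.sum_univ_four, hF, hd, hc 0 1, hc 0 2, hc 0 3, hc 1 2, hc 1 3, hc 2 3]
    at j₀ j₁ j₂ j₃ t₀ t₁ t₂ t₃
  simp only [Fin.sum_univ_four, hF]
  let G : Fin 4 → Fin 4 → ℂ := fun i j =>
    c i j 0 * f 0 + c i j 1 * f 1 + c i j 2 * f 2 + c i j 3 * f 3
  -- This is `d(f ∧ df) = df ∧ df - f ∧ d(df)` up to signs. The Jacobi identities `j` are the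
  -- components of `d(df)`, and `d` on three-forms is the wedge product with the trace form, whose
  -- components are the `t`. The factor `1 / 2` appears because `df ∧ df` is twice the Pfaffian.
  linear_combination (1 / 2) * (f 0 * j₀ - f 1 * j₁ + f 2 * j₂ - f 3 * j₃
    + t₀ * (f 1 * G 2 3 - f 2 * G 1 3 + f 3 * G 1 2)
    - t₁ * (f 0 * G 2 3 - f 2 * G 0 3 + f 3 * G 0 2)
    + t₂ * (f 0 * G 1 3 - f 1 * G 0 3 + f 3 * G 0 1)
    - t₃ * (f 0 * G 1 2 - f 1 * G 0 2 + f 2 * G 0 1))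

/-- The split symmetric bilinear form on `ℂ⁶`. -/
noncomputable def splitForm : LinearMap.BilinForm ℂ (Fin 6 → ℂ) :=
  LinearMap.mk₂ ℂ
    (fun u v => u 0 * v 3 + u 3 * v 0 + u 1 * v 4 + u 4 * v 1 + u 2 * v 5 + u 5 * v 2)
    (fun _ _ _ => by simp only [Pi.add_apply]; ring)
    (fun _ _ _ => by simp only [Pi.smul_apply, smul_eq_mul]; ring)
    (fun _ _ _ => by simp only [Pi.add_apply]; ring)
    (fun _ _ _ => by simp only [Pi.smul_apply, smul_eq_mul]; ring)

theorem splitForm_apply (u v : Fin 6 → ℂ) : splitForm u v =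
    u 0 * v 3 + u 3 * v 0 + u 1 * v 4 + u 4 * v 1 + u 2 * v 5 + u 5 * v 2 := rfl

theorem splitForm_comm (u v : Fin 6 → ℂ) : splitForm u v = splitForm v u := by
  simp only [splitForm_apply]; ring

theorem splitForm_nondegenerate : splitForm.Nondegenerate := by
  have key : ∀ u, (∀ v, splitForm u v = 0) → u = 0 := fun u h => by
    ext i
    have := fun j => h (Pi.single j 1)
    have h0 := this 0
    have h1 := this 1
    have h2 := this 2
    have h3 := this 3
    have h4 := this 4
    have h5 := this 5
    simp [splitForm_apply] at h0 h1 h2 h3 h4 h5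
    fin_cases i <;> assumption
  exact ⟨key, fun u h => key u fun v => (splitForm_comm u v).trans (h v)⟩

/-- By polarization `W` lies in its own orthogonal, whose dimension is `6 - dim W`. -/
theorem finrank_le_three_of_isotropic (W : Submodule ℂ (Fin 6 → ℂ))
    (hW : ∀ u ∈ W, splitForm u u = 0) : Module.finrank ℂ W ≤ 3 := by
  have hle : W ≤ splitForm.orthogonal W := fun v hv => by
    rw [LinearMap.BilinForm.mem_orthogonal_iff]
    intro u hu
    have h := hW (u + v) (add_mem hu hv)
    simp only [map_add, LinearMap.add_apply, hW u hu, hW v hv, splitForm_comm v u] at h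
    change splitForm u v = 0
    linear_combination h / 2
  have h1 := Submodule.finrank_mono hle
  rw [LinearMap.BilinForm.finrank_orthogonal splitForm_nondegenerate] at h1
  simp at h1
  omega

variable {L : Type*} [LieRing L] [LieAlgebra ℂ L]

/-- A four-dimensional Lie algebra is not perfect. -/
theorem exists_linearForm_lie_eq_zero (hL : Module.finrank ℂ L = 4) :
    ∃ f : L →ₗ[ℂ] ℂ, f ≠ 0 ∧ ∀ x y : L, f ⁅x, y⁆ = 0 := by
  by_contra! hcon
  replace hcon : ∀ f : L →ₗ[ℂ] ℂ, (∀ x y : L, f ⁅x, y⁆ = 0) → f = 0 := fun f hf => by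
    by_contra h
    obtain ⟨x, y, hxy⟩ := hcon f h
    exact hxy (hf x y)
  have : Module.Finite ℂ L := Module.finite_of_finrank_pos (by omega)
  let b := Module.finBasisOfFinrankEq ℂ L hL
  -- The form `x ↦ tr (ad x)` kills brackets, so perfectness makes it zero.
  have htr : ∀ x : L, LinearMap.trace ℂ L (LieAlgebra.ad ℂ L x) = 0 := fun x => by
    have := hcon (LinearMap.trace ℂ L ∘ₗ (LieAlgebra.ad ℂ L : L →ₗ[ℂ] Module.End ℂ L)) (by
      intro x y
      simp [Ring.lie_def, LinearMap.trace_mul_comm])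
    exact LinearMap.congr_fun this x
  let c : Fin 4 → Fin 4 → Fin 4 → ℂ := fun i j k => b.coord k ⁅b i, b j⁆
  have hexp : ∀ x : L, ∑ m, b.coord m x • b m = x := b.sum_repr
  -- The coordinates of the two-form `f [·, ·]`, ordered and signed so that `splitForm` takes twice
  -- the Pfaffian as its value on the diagonal. Perfectness makes the map injective, and its image
  -- is isotropic of dimension four.
  let Φ : (L →ₗ[ℂ] ℂ) →ₗ[ℂ] (Fin 6 → ℂ) :=
    { toFun := fun f => ![f ⁅b 0, b 1⁆, f ⁅b 0, b 2⁆, f ⁅b 0, b 3⁆,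
        f ⁅b 2, b 3⁆, - f ⁅b 1, b 3⁆, f ⁅b 1, b 2⁆]
      map_add' := fun f g => by ext i; fin_cases i <;> simp [add_comm]
      map_smul' := fun r f => by ext i; fin_cases i <;> simp }
  have hinj : Function.Injective Φ := by
    rw [← LinearMap.ker_eq_bot, LinearMap.ker_eq_bot']
    intro f hf
    have h01 : f ⁅b 0, b 1⁆ = 0 := congrFun hf 0
    have h02 : f ⁅b 0, b 2⁆ = 0 := congrFun hf 1
    have h03 : f ⁅b 0, b 3⁆ = 0 := congrFun hf 2
    have h23 : f ⁅b 2, b 3⁆ = 0 := congrFun hf 3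
    have h13 : f ⁅b 1, b 3⁆ = 0 := neg_eq_zero.1 (congrFun hf 4)
    have h12 : f ⁅b 1, b 2⁆ = 0 := congrFun hf 5
    have hall : ∀ i j, f ⁅b i, b j⁆ = 0 := by
      have := forall_fin_four_lt (p := fun i j => f ⁅b i, b j⁆ = 0) h01 h02 h03 h12 h13 h23
      intro i j
      rcases lt_trichotomy i j with h | rfl | h
      · exact this i j h
      · simp
      · rw [← lie_skew, map_neg, this j i h, neg_zero]
    apply hcon
    have : (LieModule.toEnd ℂ L L : L →ₗ[ℂ] L →ₗ[ℂ] L).compr₂ f = 0 :=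
      b.ext fun i => b.ext fun j => hall i j
    exact fun x y => LinearMap.congr_fun₂ this x y
  have hiso : ∀ u ∈ LinearMap.range Φ, splitForm u u = 0 := by
    rintro _ ⟨f, rfl⟩
    have hcexp : ∀ i j, ⁅b i, b j⁆ = ∑ m, c i j m • b m := fun i j => (hexp _).symm
    have := pfaffian_eq_zero c (fun m => f (b m)) (fun i j => f ⁅b i, b j⁆)
      (fun i j => by
        rw [hcexp i j]; simp)
      (fun i j m => by
        change b.coord m _ = -b.coord m _
        rw [← lie_skew, map_neg])
      (fun i j k => by
        have h : ∀ i j k, f ⁅⁅b i, b j⁆, b k⁆ = ∑ m, c i j m * f ⁅b m, b k⁆ := fun i j k => by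
          conv_lhs => rw [hcexp i j]
          simp [sum_lie]
        change ∑ m, c i j m * f ⁅b m, b k⁆ + ∑ m, c j k m * f ⁅b m, b i⁆
          + ∑ m, c k i m * f ⁅b m, b j⁆ = 0
        have := congrArg f (lie_jacobi (b i) (b j) (b k))
        rw [← lie_skew (b i) ⁅b j, b k⁆, ← lie_skew (b j) ⁅b k, b i⁆,
          ← lie_skew (b k) ⁅b i, b j⁆] at this
        simp only [map_add, map_neg, map_zero, h] at this
        linear_combination -this)
      (fun i => by
        have := htr (b i)
        rw [LinearMap.trace_eq_matrix_trace ℂ b] at this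
        simpa [Matrix.trace, LinearMap.toMatrix_apply, c] using this)
    rw [splitForm_apply]
    simp only [Φ, LinearMap.coe_mk, AddHom.coe_mk]
    change f ⁅b 0, b 1⁆ * f ⁅b 2, b 3⁆ + f ⁅b 2, b 3⁆ * f ⁅b 0, b 1⁆ +
      f ⁅b 0, b 2⁆ * -f ⁅b 1, b 3⁆ + -f ⁅b 1, b 3⁆ * f ⁅b 0, b 2⁆ +
      f ⁅b 0, b 3⁆ * f ⁅b 1, b 2⁆ + f ⁅b 1, b 2⁆ * f ⁅b 0, b 3⁆ = 0
    linear_combination 2 * this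
  have := finrank_le_three_of_isotropic _ hiso
  rw [LinearMap.finrank_range_of_inj hinj, Subspace.dual_finrank_eq (K := ℂ) (V := L)] at this
  omega

end Perfect

/-! ### Classification when the derived algebra of the ideal has dimension at most one -/

section Classification

variable {L : Type*} [LieRing L] [LieAlgebra ℂ L]

/-- The span of the brackets of elements of the kernel of a linear form. -/
def kerBrackets (f : L →ₗ[ℂ] ℂ) : Submodule ℂ L :=
  Submodule.span ℂ {v | ∃ x y, f x = 0 ∧ f y = 0 ∧ ⁅x, y⁆ = v}

theorem lie_mem_kerBrackets {f : L →ₗ[ℂ] ℂ} {x y : L} (hx : f x = 0) (hy : f y = 0) :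
    ⁅x, y⁆ ∈ kerBrackets f :=
  Submodule.subset_span ⟨x, y, hx, hy, rfl⟩

theorem kerBrackets_le {f : L →ₗ[ℂ] ℂ} {K : Submodule ℂ L}
    (h : ∀ x y, f x = 0 → f y = 0 → ⁅x, y⁆ ∈ K) : kerBrackets f ≤ K :=
  Submodule.span_le.2 fun _ ⟨x, y, hx, hy, hv⟩ => hv ▸ h x y hx hy

theorem linearIndependent_four_of_form {f : L →ₗ[ℂ] ℂ} {e₁ e₂ e₃ w : L} (h₁ : f e₁ = 0)
    (h₂ : f e₂ = 0) (h₃ : f e₃ = 0) (hw : f w ≠ 0)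
    (hli : ∀ a b c : ℂ, a • e₁ + b • e₂ + c • e₃ = 0 → a = 0 ∧ b = 0 ∧ c = 0) :
    ∀ a b c d : ℂ, a • e₁ + b • e₂ + c • e₃ + d • w = 0 → a = 0 ∧ b = 0 ∧ c = 0 ∧ d = 0 := by
  intro a b c d h
  have hd : d = 0 := by simpa [h₁, h₂, h₃, hw] using congrArg f h
  subst hd
  obtain ⟨ha, hb, hc⟩ := hli a b c (by rw [← h]; module)
  exact ⟨ha, hb, hc, rfl⟩

theorem exists_coords {f : L →ₗ[ℂ] ℂ} (hI : Module.finrank ℂ (LinearMap.ker f) = 3) {e₁ e₂ e₃ : L}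
    (h₁ : f e₁ = 0) (h₂ : f e₂ = 0) (h₃ : f e₃ = 0)
    (hli : ∀ a b c : ℂ, a • e₁ + b • e₂ + c • e₃ = 0 → a = 0 ∧ b = 0 ∧ c = 0) (x : L)
    (hx : f x = 0) : ∃ a b c : ℂ, x = a • e₁ + b • e₂ + c • e₃ := by
  have hli' : LinearIndependent ℂ ![(⟨e₁, h₁⟩ : LinearMap.ker f), ⟨e₂, h₂⟩, ⟨e₃, h₃⟩] :=
    linearIndependent_three.2 fun a b c h => hli a b c (congrArg Subtype.val h)
  have hmem : (⟨x, hx⟩ : LinearMap.ker f) ∈ Submodule.span ℂ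
      (Set.range ![(⟨e₁, h₁⟩ : LinearMap.ker f), ⟨e₂, h₂⟩, ⟨e₃, h₃⟩]) := by
    rw [hli'.span_eq_top_of_card_eq_finrank (by simp [hI])]
    exact Submodule.mem_top
  obtain ⟨c, hc⟩ := (Submodule.mem_span_range_iff_exists_fun ℂ).1 hmem
  rw [Fin.sum_univ_three] at hc
  exact ⟨c 0, c 1, c 2, (congrArg Subtype.val hc).symm⟩

theorem eq_zero_of_smul_eq_zero {E : Type*} [AddCommGroup E] [Module ℂ E] {z : E} (hz : z ≠ 0)
    {c : ℂ} (h : c • z = 0) : c = 0 :=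
  (smul_eq_zero.1 h).resolve_right hz

variable (hL : Module.finrank ℂ L = 4) {f : L →ₗ[ℂ] ℂ}
  (hI : Module.finrank ℂ (LinearMap.ker f) = 3) (hf : ∀ x y : L, f ⁅x, y⁆ = 0)

include hf in
theorem kerBrackets_le_ker : kerBrackets f ≤ LinearMap.ker f :=
  kerBrackets_le fun x y _ _ => hf x y

include hf in
-- `ad x` is a derivation with values in `ker f`, so the derived algebra of `ker f` is an ideal of
-- the whole of `L`.
theorem lie_mem_kerBrackets_of_mem (x : L) {v : L} (hv : v ∈ kerBrackets f) :
    ⁅x, v⁆ ∈ kerBrackets f := by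
  induction hv using Submodule.span_induction with
  | mem v hv =>
    obtain ⟨a, b, ha, hb, rfl⟩ := hv
    rw [leibniz_lie]
    exact add_mem (lie_mem_kerBrackets (hf _ _) hb) (lie_mem_kerBrackets ha (hf _ _))
  | zero => simp
  | add v w _ _ hv hw => rw [lie_add]; exact add_mem hv hw
  | smul c v _ hv => rw [lie_smul]; exact Submodule.smul_mem _ _ hv

variable {u₀ : L} (hu₀ : f u₀ ≠ 0)

include hL hI hf hu₀

theorem isListed_of_finrank_zero (hJ : Module.finrank ℂ (kerBrackets f) = 0) : IsListed L := by
  have : Module.Finite ℂ L := Module.finite_of_finrank_pos (by omega)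
  rw [Submodule.finrank_eq_zero] at hJ
  refine isListed_of_abelian_ideal hL (LinearMap.ker f) hI (w := u₀) hu₀ ?_ fun x _ => hf x u₀
  intro x hx y hy
  have := lie_mem_kerBrackets hx hy
  rwa [hJ, Submodule.mem_bot] at this

/-- The ideal `ker f` is Heisenberg: two noncommuting elements and their bracket are independent, as
bracketing a relation with each of the two elements shows. -/
theorem isListed_of_finrank_one_central (hJ : Module.finrank ℂ (kerBrackets f) = 1)
    (hc : ∀ x v, f x = 0 → v ∈ kerBrackets f → ⁅x, v⁆ = 0) : IsListed L := by
  obtain ⟨⟨z₀, hz₀⟩, hz₀0, hz₀J⟩ := finrank_eq_one_iff'.1 hJ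
  obtain ⟨x, y, hx, hy, hxy⟩ : ∃ x y, f x = 0 ∧ f y = 0 ∧ ⁅x, y⁆ ≠ 0 := by
    by_contra! h
    have : kerBrackets f ≤ ⊥ := kerBrackets_le fun x y hx hy => (Submodule.mem_bot ℂ).2 (h x y hx hy)
    exact hz₀0 (Subtype.ext ((Submodule.mem_bot ℂ).1 (this hz₀)))
  have hzx := hc x _ hx (lie_mem_kerBrackets hx hy)
  have hzy := hc y _ hy (lie_mem_kerBrackets hx hy)
  have hli : ∀ a b c : ℂ, a • ⁅x, y⁆ + b • x + c • y = 0 → a = 0 ∧ b = 0 ∧ c = 0 := by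
    intro a b c h
    have h1 := congrArg (fun v => ⁅x, v⁆) h
    have h2 := congrArg (fun v => ⁅v, y⁆) h
    have hzy' : ⁅⁅x, y⁆, y⁆ = 0 := by rw [← lie_skew, hzy, neg_zero]
    simp only [lie_add, lie_smul, lie_self, hzx, smul_zero, lie_zero, zero_add] at h1
    simp only [add_lie, smul_lie, lie_self, hzy', smul_zero, zero_lie, zero_add, add_zero] at h2
    have hc := eq_zero_of_smul_eq_zero hxy h1
    have hb := eq_zero_of_smul_eq_zero hxy h2
    subst hb hc
    exact ⟨eq_zero_of_smul_eq_zero hxy (by rw [← h]; module), rfl, rfl⟩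
  exact isListed_of_heisenberg_ideal hL (w := u₀)
    (linearIndependent_four_of_form (hf x y) hx hy hu₀ hli) rfl (by rw [← lie_skew, hzx, neg_zero])
    (by rw [← lie_skew, hzy, neg_zero])
    (exists_coords hI (hf x y) hx hy hli _ (hf _ _))
    (exists_coords hI (hf x y) hx hy hli _ (hf _ _))

/-- Let `z` span `[I, I]`, and let `χ` be the character by which `L` acts on it. Since `χ` is
nonzero on `I`, there are `y` in `I` with `χ y = 1`, and `w` in `I` and `u` outside `I` both in `ker
χ`. Write `[u, w] = b z + a w`. If `a = b = 0`, then `z, w, u` span an abelian ideal. If only `a =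
0`, they span a Heisenberg ideal. If `a ≠ 0`, then `u` and `y` can be normalized to the situation of
`isListed_d2Sharp`. -/
theorem isListed_of_finrank_one_noncentral (hJ : Module.finrank ℂ (kerBrackets f) = 1)
    (hc : ∃ x v, f x = 0 ∧ v ∈ kerBrackets f ∧ ⁅x, v⁆ ≠ 0) : IsListed L := by
  have : Module.Finite ℂ L := Module.finite_of_finrank_pos (by omega)
  obtain ⟨⟨z, hz⟩, hz0, hzJ⟩ := finrank_eq_one_iff'.1 hJ
  replace hz0 : z ≠ 0 := fun h => hz0 (Subtype.ext h)
  replace hzJ : ∀ v ∈ kerBrackets f, ∃ c : ℂ, v = c • z := fun v hv => by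
    obtain ⟨c, hc⟩ := hzJ ⟨v, hv⟩
    exact ⟨c, (congrArg Subtype.val hc).symm⟩
  have hfz : f z = 0 := kerBrackets_le_ker hf hz
  obtain ⟨g, hg⟩ := Module.Projective.exists_dual_eq_one ℂ hz0
  let χ : L →ₗ[ℂ] ℂ := g ∘ₗ (LieModule.toEnd ℂ L L : L →ₗ[ℂ] L →ₗ[ℂ] L).flip z
  have hχ : ∀ x, ⁅x, z⁆ = χ x • z := fun x => by
    obtain ⟨c, hc⟩ := hzJ _ (lie_mem_kerBrackets_of_mem hf x hz)
    have : χ x = c := by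
      change g ⁅x, z⁆ = c
      rw [hc, map_smul, hg, smul_eq_mul, mul_one]
    rw [this, hc]
  have hχb : ∀ x y, χ ⁅x, y⁆ = 0 := fun x y => by
    refine eq_zero_of_smul_eq_zero hz0 ?_
    rw [← hχ, lie_lie, hχ, hχ, lie_smul, lie_smul, hχ, hχ]
    module
  obtain ⟨y, hy, hχy⟩ : ∃ y, f y = 0 ∧ χ y = 1 := by
    obtain ⟨x, v, hx, hv, hxv⟩ := hc
    obtain ⟨c, rfl⟩ := hzJ v hv
    have : χ x ≠ 0 := fun h => hxv (by rw [lie_smul, hχ, h]; simp)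
    exact ⟨(χ x)⁻¹ • x, by simp [hx], by simp [this]⟩
  have hχz : χ z = 0 := eq_zero_of_smul_eq_zero hz0 (by rw [← hχ, lie_self])
  obtain ⟨w, hw, hχw, hzw⟩ : ∃ w, f w = 0 ∧ χ w = 0 ∧
      ∀ a b : ℂ, a • z + b • w = 0 → a = 0 ∧ b = 0 := by
    let χ' : LinearMap.ker f →ₗ[ℂ] ℂ := χ.domRestrict _
    have hχ' : χ' ≠ 0 := fun h => by
      have h1 : χ y = 0 := LinearMap.congr_fun h ⟨y, hy⟩
      rw [hχy] at h1
      exact one_ne_zero h1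
    have hker := Module.Dual.finrank_ker_add_one_of_ne_zero (f := χ') hχ'
    rw [hI] at hker
    obtain ⟨⟨⟨w, hw⟩, hw'⟩, hli⟩ := exists_linearIndependent_pair_of_one_lt_finrank (R := ℂ)
      (by omega) (x := (⟨⟨z, hfz⟩, hχz⟩ : LinearMap.ker χ'))
      (fun h => hz0 (congrArg Subtype.val (congrArg Subtype.val h)))
    rw [LinearIndependent.pair_iff] at hli
    exact ⟨w, hw, hw', fun a b h => hli a b (Subtype.ext (Subtype.ext h))⟩
  obtain ⟨u, hu, hχu⟩ : ∃ u, f u ≠ 0 ∧ χ u = 0 :=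
    ⟨u₀ - χ u₀ • y, by simpa [hy] using hu₀, by simp [hχy]⟩
  have hli : ∀ a b c : ℂ, a • z + b • w + c • y = 0 → a = 0 ∧ b = 0 ∧ c = 0 := by
    intro a b c h
    have hc : c = 0 := by simpa [hχz, hχw, hχy] using congrArg χ h
    subst hc
    obtain ⟨ha, hb⟩ := hzw a b (by rw [← h]; module)
    exact ⟨ha, hb, rfl⟩
  have hli4 := linearIndependent_four_of_form hfz hw hy hu hli
  have hwz : ⁅w, z⁆ = 0 := by rw [hχ, hχw, zero_smul]
  have huz : ⁅u, z⁆ = 0 := by rw [hχ, hχu, zero_smul]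
  have hyz : ⁅y, z⁆ = z := by rw [hχ, hχy, one_smul]
  have hzw' : ⁅z, w⁆ = 0 := by rw [← lie_skew, hwz, neg_zero]
  have hzu : ⁅z, u⁆ = 0 := by rw [← lie_skew, huz, neg_zero]
  have hzy : ⁅z, y⁆ = -z := by rw [← lie_skew, hyz]
  have coords : ∀ v, f v = 0 → χ v = 0 → ∃ a b : ℂ, v = a • z + b • w := by
    intro v hv hv'
    obtain ⟨a, b, c, rfl⟩ := exists_coords hI hfz hw hy hli v hv
    have hc : c = 0 := by simpa [hχz, hχw, hχy] using hv'
    exact ⟨a, b, by rw [hc]; module⟩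
  obtain ⟨b, a, huw⟩ := coords ⁅u, w⁆ (hf _ _) (hχb _ _)
  obtain ⟨p, q, hyu⟩ := coords ⁅y, u⁆ (hf _ _) (hχb _ _)
  obtain ⟨s, hyw⟩ := hzJ _ (lie_mem_kerBrackets hy hw)
  have hwu : ⁅w, u⁆ = -(b • z + a • w) := by rw [← lie_skew, huw]
  have huy : ⁅u, y⁆ = -(p • z + q • w) := by rw [← lie_skew, hyu]
  have hwy : ⁅w, y⁆ = -(s • z) := by rw [← lie_skew, hyw]
  by_cases ha : a = 0
  · subst ha
    by_cases hb : b = 0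
    · subst hb
      refine isListed_of_abelian_ideal' hL (e₁ := z) (e₂ := w) (e₃ := u) (w := y) ?_
        hzw' hzu (by rw [hwu]; simp) ⟨-1, 0, 0, by rw [hzy]; module⟩
        ⟨-s, 0, 0, by rw [hwy]; module⟩ ⟨-p, -q, 0, by rw [huy]; module⟩
      intro a b c d h
      have := hli4 a b d c (by rw [← h]; module)
      tauto
    · refine isListed_of_heisenberg_ideal hL (z := b • z) (x := u) (y := w) (w := y) ?_
        (by rw [huw]; module) (by simp [hzu]) (by simp [hzw'])
        ⟨-p * b⁻¹, 0, -q, by rw [huy, smul_smul, mul_assoc, inv_mul_cancel₀ hb]; module⟩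
        ⟨-s * b⁻¹, 0, 0, by rw [hwy, smul_smul, mul_assoc, inv_mul_cancel₀ hb]; module⟩
      intro a' b' c d h
      have := hli4 (a' * b) c d b' (by rw [← h]; module)
      simp only [mul_eq_zero, hb, or_false] at this
      tauto
  -- `m` is the eigenvector of `ad u` for the eigenvalue `a`, which `x = a⁻¹ u` normalizes to `1`.
  · obtain ⟨m, hm⟩ : ∃ m, m = w + (b / a) • z := ⟨_, rfl⟩
    obtain ⟨x, hx⟩ : ∃ x, x = a⁻¹ • u := ⟨_, rfl⟩
    have hxm : ⁅x, m⁆ = m := by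
      rw [hx, hm]
      simp only [smul_lie, lie_add, lie_smul, huw, huz, smul_zero, add_zero, smul_add, smul_smul,
        inv_mul_cancel₀ ha, one_smul]
      rw [div_eq_inv_mul, add_comm]
    have hxz : ⁅x, z⁆ = 0 := by rw [hx, smul_lie, huz, smul_zero]
    have hzm : ⁅z, m⁆ = 0 := by rw [hm]; simp [hzw']
    have hwm : ⁅w, m⁆ = 0 := by rw [hm]; simp [hwz]
    have hyx : ⁅y, x⁆ = a⁻¹ • (p • z + q • w) := by rw [hx, lie_smul, hyu]
    have hym : ⁅y, m⁆ = (s + b / a) • z := by rw [hm, lie_add, lie_smul, hyw, hyz]; module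
    -- Jacobi gives `[y, m] = 0`: the bracket `[y, x]` commutes with `m`, and `x` kills `[y, m]`, a
    -- multiple of `z`.
    have hs := leibniz_lie y x m
    rw [hxm, hym, hyx, lie_smul, hxz] at hs
    simp only [smul_lie, add_lie, hzm, hwm, smul_zero, add_zero] at hs
    refine isListed_d2Sharp hL (n := z) (m := m) (x := x) (y := y) ?_ hzm hxz hxm hyz
      (by rw [hym, hs]) ⟨a⁻¹ * (p - q * (b / a)), a⁻¹ * q, by rw [hyx, hm]; module⟩
    intro a' b' c d h
    have := hli4 (a' + b' * (b / a)) b' d (c * a⁻¹) (by rw [← h, hm, hx]; module)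
    obtain ⟨h1, h2, h3, h4⟩ := this
    subst h2 h3
    refine ⟨by simpa using h1, rfl, by simpa [ha] using h4, rfl⟩

end Classification

/-! ### Classification when the derived algebra of the ideal is a plane -/

section Classification

variable {L : Type*} [LieRing L] [LieAlgebra ℂ L]

variable (hL : Module.finrank ℂ L = 4) {f : L →ₗ[ℂ] ℂ}
  (hI : Module.finrank ℂ (LinearMap.ker f) = 3) (hf : ∀ x y : L, f ⁅x, y⁆ = 0)

theorem exists_coords_of_finrank_two {E : Type*} [AddCommGroup E] [Module ℂ E] {J : Submodule ℂ E}
    (hJ : Module.finrank ℂ J = 2) {p q : E} (hp : p ∈ J) (hq : q ∈ J)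
    (hli : ∀ a b : ℂ, a • p + b • q = 0 → a = 0 ∧ b = 0) (x : E) (hx : x ∈ J) :
    ∃ a b : ℂ, x = a • p + b • q := by
  have hli' : LinearIndependent ℂ ![(⟨p, hp⟩ : J), ⟨q, hq⟩] :=
    LinearIndependent.pair_iff.2 fun a b h => hli a b (congrArg Subtype.val h)
  have hmem : (⟨x, hx⟩ : J) ∈ Submodule.span ℂ (Set.range ![(⟨p, hp⟩ : J), ⟨q, hq⟩]) := by
    rw [hli'.span_eq_top_of_card_eq_finrank (by simp [hJ])]
    exact Submodule.mem_top
  obtain ⟨c, hc⟩ := (Submodule.mem_span_range_iff_exists_fun ℂ).1 hmem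
  rw [Fin.sum_univ_two] at hc
  exact ⟨c 0, c 1, (congrArg Subtype.val hc).symm⟩

theorem linearIndependent_three_of_notMem {E : Type*} [AddCommGroup E] [Module ℂ E]
    {J : Submodule ℂ E} {p q y : E} (hp : p ∈ J) (hq : q ∈ J) (hy : y ∉ J)
    (hli : ∀ a b : ℂ, a • p + b • q = 0 → a = 0 ∧ b = 0) :
    ∀ a b c : ℂ, a • p + b • q + c • y = 0 → a = 0 ∧ b = 0 ∧ c = 0 := by
  intro a b c h
  have hc : c = 0 := by
    by_contra hc
    refine hy ((Submodule.smul_mem_iff _ hc).1 ?_)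
    rw [eq_neg_of_add_eq_zero_right h]
    exact neg_mem (add_mem (Submodule.smul_mem _ _ hp) (Submodule.smul_mem _ _ hq))
  subst hc
  obtain ⟨ha, hb⟩ := hli a b (by rw [← h]; module)
  exact ⟨ha, hb, rfl⟩

include hI hf in
-- Otherwise `J` would be the nonabelian plane, all of whose derivations take values in the line of
-- `[p, q]`. Then `[y, p]` and `[y, q]` lie in that line, hence so do all brackets of `ker f`,
-- contradicting `dim J = 2`.
theorem lie_eq_zero_of_mem_kerBrackets (hJ : Module.finrank ℂ (kerBrackets f) = 2) {p q y : L}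
    (hp : p ∈ kerBrackets f) (hq : q ∈ kerBrackets f) (hy : y ∉ kerBrackets f) (hfy : f y = 0)
    (hli : ∀ a b : ℂ, a • p + b • q = 0 → a = 0 ∧ b = 0) : ⁅p, q⁆ = 0 := by
  have coords := exists_coords_of_finrank_two hJ hp hq hli
  have hfp : f p = 0 := kerBrackets_le_ker hf hp
  have hfq : f q = 0 := kerBrackets_le_ker hf hq
  have hli3 := linearIndependent_three_of_notMem hp hq hy hli
  obtain ⟨α, β, hpq⟩ := coords _ (lie_mem_kerBrackets hfp hfq)
  obtain ⟨a, b, hyp⟩ := coords _ (lie_mem_kerBrackets hfy hfp)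
  obtain ⟨c, d, hyq⟩ := coords _ (lie_mem_kerBrackets hfy hfq)
  have hqp : ⁅q, p⁆ = -(α • p + β • q) := by rw [← lie_skew, hpq]
  have hpy : ⁅p, y⁆ = -(a • p + b • q) := by rw [← lie_skew, hyp]
  have hqy : ⁅q, y⁆ = -(c • p + d • q) := by rw [← lie_skew, hyq]
  have j := leibniz_lie y p q
  rw [hpq, hyp, hyq] at j
  simp only [lie_add, lie_smul, add_lie, smul_lie, lie_self, hyp, hyq, hpq] at j
  obtain ⟨h₁, h₂⟩ := hli (β * c - d * α) (α * b - a * β)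
    (by linear_combination (norm := module) j)
  by_contra hr
  obtain ⟨s, t, hs, ht⟩ : ∃ s t : ℂ, ⁅y, p⁆ = s • ⁅p, q⁆ ∧ ⁅y, q⁆ = t • ⁅p, q⁆ := by
    by_cases hα : α = 0
    · subst hα
      have hβ : β ≠ 0 := fun h => hr (by rw [hpq, h]; simp)
      obtain rfl : c = 0 := by simpa [hβ] using h₁
      obtain rfl : a = 0 := by simpa [hβ] using h₂
      refine ⟨b / β, d / β, ?_, ?_⟩
      · rw [hyp, hpq, smul_add, smul_smul, smul_smul, div_mul_cancel₀ _ hβ]; simp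
      · rw [hyq, hpq, smul_add, smul_smul, smul_smul, div_mul_cancel₀ _ hβ]; simp
    · refine ⟨a / α, c / α, ?_, ?_⟩
      · rw [hyp, hpq, smul_add, smul_smul, smul_smul, div_mul_cancel₀ _ hα,
          show a / α * β = b by field_simp; linear_combination -h₂]
      · rw [hyq, hpq, smul_add, smul_smul, smul_smul, div_mul_cancel₀ _ hα,
          show c / α * β = d by field_simp; linear_combination h₁]
  have hle : kerBrackets f ≤ Submodule.span ℂ {⁅p, q⁆} := kerBrackets_le fun x x' hx hx' => by
    obtain ⟨a₁, b₁, c₁, rfl⟩ := exists_coords hI hfp hfq hfy hli3 x hx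
    obtain ⟨a₂, b₂, c₂, rfl⟩ := exists_coords hI hfp hfq hfy hli3 x' hx'
    refine Submodule.mem_span_singleton.2 ⟨a₁ * b₂ - b₁ * a₂ + s * (c₁ * a₂ - a₁ * c₂)
      + t * (c₁ * b₂ - b₁ * c₂), ?_⟩
    simp only [lie_add, lie_smul, add_lie, smul_lie, lie_self]
    rw [← lie_skew p y, ← lie_skew q y, ← lie_skew q p, hs, ht]
    module
  have := Submodule.finrank_mono hle
  rw [hJ, finrank_span_singleton hr] at this
  omega

variable {u₀ : L} (hu₀ : f u₀ ≠ 0)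

include hL hI hf hu₀

/-- Here `J` is abelian and `y` in `I` acts on it invertibly. The action of `u₀` on `J` commutes
with that of `y`, and subtracting a multiple of `y` from `u₀` gives an `x` with a nonzero kernel
vector `n` in `J`. If `x` kills `J`, then `J` and `x` span an abelian ideal. If `x` is nilpotent and
nonzero on `J`, they span a Heisenberg ideal. Otherwise `x` and `y` are simultaneously
diagonalizable on `J`, and `isListed_d2Sharp` applies. -/
theorem isListed_of_finrank_two (hJ : Module.finrank ℂ (kerBrackets f) = 2) : IsListed L := by
  have : Module.Finite ℂ L := Module.finite_of_finrank_pos (by omega)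
  obtain ⟨y, hfy, hy⟩ : ∃ y, f y = 0 ∧ y ∉ kerBrackets f := by
    by_contra! h
    have : Module.finrank ℂ (LinearMap.ker f) ≤ _ := Submodule.finrank_mono h
    omega
  have hmem : ∀ x v, v ∈ kerBrackets f → ⁅x, v⁆ ∈ kerBrackets f :=
    fun x v => lie_mem_kerBrackets_of_mem hf x
  have hfJ : ∀ v ∈ kerBrackets f, f v = 0 := fun v hv => kerBrackets_le_ker hf hv
  -- every nonzero element of the plane extends to a basis
  have ext : ∀ n ∈ kerBrackets f, n ≠ 0 → ∃ m ∈ kerBrackets f,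
      ∀ a b : ℂ, a • n + b • m = 0 → a = 0 ∧ b = 0 := by
    intro n hn hn0
    obtain ⟨⟨m, hm⟩, hli⟩ := exists_linearIndependent_pair_of_one_lt_finrank (R := ℂ)
      (by omega) (x := (⟨n, hn⟩ : kerBrackets f)) (fun h => hn0 (congrArg Subtype.val h))
    rw [LinearIndependent.pair_iff] at hli
    exact ⟨m, hm, fun a b h => hli a b (Subtype.ext h)⟩
  have : Nontrivial (kerBrackets f) := Module.nontrivial_of_finrank_pos (R := ℂ) (by omega)
  have hcomm : ∀ n ∈ kerBrackets f, ∀ m ∈ kerBrackets f, ⁅n, m⁆ = 0 := by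
    obtain ⟨⟨p, hp⟩, hp0⟩ := exists_ne (0 : kerBrackets f)
    obtain ⟨q, hq, hli⟩ := ext p hp (fun h => hp0 (Subtype.ext h))
    have hpq := lie_eq_zero_of_mem_kerBrackets hI hf hJ hp hq hy hfy hli
    have hqp : ⁅q, p⁆ = 0 := by rw [← lie_skew, hpq, neg_zero]
    intro n hn m hm
    obtain ⟨a, b, rfl⟩ := exists_coords_of_finrank_two hJ hp hq hli n hn
    obtain ⟨c, d, rfl⟩ := exists_coords_of_finrank_two hJ hp hq hli m hm
    simp [hpq, hqp]
  have decomp : ∀ v, f v = 0 → ∃ j ∈ kerBrackets f, ∃ c : ℂ, v = j + c • y := by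
    obtain ⟨⟨p, hp⟩, hp0⟩ := exists_ne (0 : kerBrackets f)
    obtain ⟨q, hq, hli⟩ := ext p hp (fun h => hp0 (Subtype.ext h))
    intro v hv
    obtain ⟨a, b, c, h⟩ := exists_coords hI (hfJ p hp) (hfJ q hq) hfy
      (linearIndependent_three_of_notMem hp hq hy hli) v hv
    exact ⟨a • p + b • q, add_mem (Submodule.smul_mem _ _ hp) (Submodule.smul_mem _ _ hq), c, h⟩
  let Y : Module.End ℂ (kerBrackets f) :=
    (LieAlgebra.ad ℂ L y : L →ₗ[ℂ] L).restrict (hmem y)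
  let X : Module.End ℂ (kerBrackets f) :=
    (LieAlgebra.ad ℂ L u₀ : L →ₗ[ℂ] L).restrict (hmem u₀)
  -- As `J` is abelian and `I = J + ℂ y`, the space `J = [I, I]` equals `[y, J]`.
  have hsurj : Function.Surjective Y := by
    have hle : kerBrackets f ≤ (kerBrackets f).map (LieAlgebra.ad ℂ L y : L →ₗ[ℂ] L) :=
      kerBrackets_le fun v v' hv hv' => by
        obtain ⟨j, hj, c, rfl⟩ := decomp v hv
        obtain ⟨j', hj', c', rfl⟩ := decomp v' hv'
        refine ⟨c • j' - c' • j,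
          sub_mem (Submodule.smul_mem _ _ hj') (Submodule.smul_mem _ _ hj), ?_⟩
        simp only [LieAlgebra.ad_apply, lie_sub, lie_smul, add_lie, lie_add, smul_lie, lie_self,
          hcomm j hj j' hj']
        rw [← lie_skew j y]
        module
    rintro ⟨v, hv⟩
    obtain ⟨j, hj, rfl⟩ := hle hv
    exact ⟨⟨j, hj⟩, rfl⟩
  have hinj : Function.Injective Y := LinearMap.injective_iff_surjective.2 hsurj
  let Z : Module.End ℂ (kerBrackets f) := (LinearEquiv.ofBijective Y ⟨hinj, hsurj⟩).symm
  have hYZ : Y * Z = 1 := LinearMap.ext fun v =>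
    (LinearEquiv.ofBijective Y ⟨hinj, hsurj⟩).apply_symm_apply v
  have hZY : Z * Y = 1 := LinearMap.ext fun v =>
    (LinearEquiv.ofBijective Y ⟨hinj, hsurj⟩).symm_apply_apply v
  -- If `[u₀, y]` is `c y` modulo `J`, then `X Y - Y X = c Y` on `J`. Multiplying by `Y⁻¹` and
  -- taking traces gives `2 c = 0`.
  have hxy : ⁅u₀, y⁆ ∈ kerBrackets f := by
    obtain ⟨j, hj, c, hjc⟩ := decomp ⁅u₀, y⁆ (hf _ _)
    have hXY : X * Y = c • Y + Y * X := by
      refine LinearMap.ext fun v => Subtype.ext ?_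
      change ⁅u₀, ⁅y, (v : L)⁆⁆ = c • ⁅y, (v : L)⁆ + ⁅y, ⁅u₀, (v : L)⁆⁆
      rw [leibniz_lie, hjc, add_lie, hcomm j hj v v.2, zero_add, smul_lie]
    have htr : LinearMap.trace ℂ _ (X * Y * Z) = c * 2 + LinearMap.trace ℂ _ (Y * X * Z) := by
      rw [hXY, add_mul, map_add, smul_mul_assoc, hYZ, map_smul, LinearMap.trace_one, hJ]
      simp
    rw [mul_assoc, hYZ, mul_one, LinearMap.trace_mul_comm, ← mul_assoc, hZY, one_mul] at htr
    have hc : c = 0 := by linear_combination -htr / 2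
    rw [hjc, hc, zero_smul, add_zero]
    exact hj
  -- An eigenvector `n` of `Y⁻¹ X` for `t` is killed by `u₀ - t y`.
  obtain ⟨t, ht⟩ := Module.End.exists_eigenvalue (Z * X)
  obtain ⟨⟨n, hn⟩, hnt⟩ := ht.exists_hasEigenvector
  have hn0 : n ≠ 0 := fun h => hnt.2 (Subtype.ext h)
  obtain ⟨x, hx⟩ : ∃ x, x = u₀ - t • y := ⟨_, rfl⟩
  have hfx : f x ≠ 0 := by simpa [hx, hfy] using hu₀
  have hxn : ⁅x, n⁆ = 0 := by
    have h1 : X ⟨n, hn⟩ = t • Y ⟨n, hn⟩ := by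
      have := congrArg Y hnt.apply_eq_smul
      rw [map_smul] at this
      rw [← this]
      change _ = (Y * (Z * X)) _
      rw [← mul_assoc, hYZ, one_mul]
    have h2 : ⁅u₀, n⁆ = t • ⁅y, n⁆ := congrArg Subtype.val h1
    rw [hx, sub_lie, h2, smul_lie, sub_self]
  replace hxy : ⁅x, y⁆ ∈ kerBrackets f := by
    rw [hx, sub_lie, smul_lie, lie_self, smul_zero, sub_zero]
    exact hxy
  have hYinj : ∀ v ∈ kerBrackets f, ⁅y, v⁆ = 0 → v = 0 := fun v hv h =>
    congrArg Subtype.val ((map_eq_zero_iff Y hinj).1 (Subtype.ext h : Y ⟨v, hv⟩ = 0))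
  clear_value X Y Z
  clear hsurj hinj hYZ hZY hnt ht
  have hXY : ∀ v ∈ kerBrackets f, ⁅x, ⁅y, v⁆⁆ = ⁅y, ⁅x, v⁆⁆ := fun v hv => by
    rw [leibniz_lie, hcomm _ hxy v hv, zero_add]
  obtain ⟨m, hm, hli⟩ := ext n hn hn0
  have coords := exists_coords_of_finrank_two hJ hn hm hli
  obtain ⟨α, β, hxm⟩ := coords _ (hmem x m hm)
  obtain ⟨y₁, y₂, hyn⟩ := coords _ (hmem y n hn)
  obtain ⟨y₃, y₄, hym⟩ := coords _ (hmem y m hm)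
  obtain ⟨p, q, hxy'⟩ := coords _ hxy
  have hnm := hcomm n hn m hm
  have hny : ⁅n, y⁆ = -(y₁ • n + y₂ • m) := by rw [← lie_skew, hyn]
  have hmy : ⁅m, y⁆ = -(y₃ • n + y₄ • m) := by rw [← lie_skew, hym]
  have hnx : ⁅n, x⁆ = 0 := by rw [← lie_skew, hxn, neg_zero]
  have hmx : ⁅m, x⁆ = -(α • n + β • m) := by rw [← lie_skew, hxm]
  have hli4 := linearIndependent_four_of_form (hfJ n hn) (hfJ m hm) hfy hfx
    (linearIndependent_three_of_notMem hn hm hy hli)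
  by_cases hβ : β = 0
  · subst hβ
    by_cases hα : α = 0
    · subst hα
      refine isListed_of_abelian_ideal' hL (e₁ := n) (e₂ := m) (e₃ := x) (w := y) ?_
        hnm hnx (by rw [hmx]; simp) ⟨-y₁, -y₂, 0, by rw [hny]; module⟩
        ⟨-y₃, -y₄, 0, by rw [hmy]; module⟩ ⟨p, q, 0, by rw [hxy']; module⟩
      intro a b c d h
      have := hli4 a b d c (by rw [← h]; module)
      tauto
    · refine isListed_of_heisenberg_ideal hL (z := α • n) (x := x) (y := m) (w := y) ?_
        (by rw [hxm]; module) (by simp [hnx]) (by simp [hnm])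
        ⟨p * α⁻¹, 0, q, by rw [hxy', smul_smul, mul_assoc, inv_mul_cancel₀ hα]; module⟩
        ⟨-y₃ * α⁻¹, 0, -y₄, by rw [hmy, smul_smul, mul_assoc, inv_mul_cancel₀ hα]; module⟩
      intro a b c d h
      have := hli4 (a * α) c d b (by rw [← h]; module)
      simp only [mul_eq_zero, hα, or_false] at this
      tauto
  · have h₁ := hXY n hn
    rw [hxn, hyn, lie_zero, lie_add, lie_smul, lie_smul, hxn, hxm] at h₁
    obtain ⟨-, h₁⟩ := hli (y₂ * α) (y₂ * β) (by rw [← h₁]; module)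
    obtain rfl : y₂ = 0 := by simpa [hβ] using h₁
    have hy₁ : y₁ ≠ 0 := fun h => hn0 (hYinj n hn (by rw [hyn, h]; simp))
    have h₂ := hXY m hm
    rw [hxm, hym] at h₂
    simp only [lie_add, lie_smul, hxn, hxm, hyn, hym] at h₂
    obtain ⟨h₃, -⟩ := hli (y₄ * α - α * y₁ - β * y₃) 0
      (by linear_combination (norm := module) h₂)
    -- `m'` is the eigenvector of `ad x` for `β`, and also one of `ad y` for `y₄`, since the two
    -- actions commute. The elements `x'` and `y'` are scaled and combined to act on `n, m'` as
    -- complementary projections.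
    obtain ⟨m', hm'⟩ : ∃ m', m' = m + (α / β) • n := ⟨_, rfl⟩
    obtain ⟨x', hx'⟩ : ∃ x', x' = β⁻¹ • x := ⟨_, rfl⟩
    obtain ⟨y', hy'⟩ : ∃ y', y' = y₁⁻¹ • (y - y₄ • x') := ⟨_, rfl⟩
    have hxn' : ⁅x', n⁆ = 0 := by rw [hx', smul_lie, hxn, smul_zero]
    have hxm' : ⁅x', m'⁆ = m' := by
      rw [hx', hm', smul_lie, lie_add, lie_smul, hxn, hxm, smul_zero, add_zero, smul_add, smul_smul,
        smul_smul, inv_mul_cancel₀ hβ, div_eq_inv_mul]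
      module
    have hym' : ⁅y, m'⁆ = y₄ • m' := by
      rw [hm', lie_add, lie_smul, hyn, hym]
      have : y₃ + α / β * y₁ = y₄ * (α / β) := by field_simp; linear_combination -h₃
      linear_combination (norm := module) this • n
    refine isListed_d2Sharp hL (n := n) (m := m') (x := x') (y := y') ?_ ?_ hxn' hxm' ?_ ?_ ?_
    · intro a b c d h
      obtain ⟨h1, h2, h3, h4⟩ := hli4 (a + b * (α / β)) b (d * y₁⁻¹)
        (c * β⁻¹ - d * y₁⁻¹ * y₄ * β⁻¹) (by rw [← h, hm', hy', hx']; module)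
      obtain rfl : d = 0 := by simpa [hy₁] using h3
      subst h2
      exact ⟨by simpa using h1, rfl, by simpa [hβ] using h4, rfl⟩
    · rw [hm']; simp [hnm]
    · rw [hy', smul_lie, sub_lie, smul_lie, hxn', hyn, zero_smul, add_zero, smul_zero, sub_zero,
        smul_smul, inv_mul_cancel₀ hy₁, one_smul]
    · rw [hy', smul_lie, sub_lie, smul_lie, hxm', hym', sub_self, smul_zero]
    · refine ⟨-(y₁⁻¹ * β⁻¹ * (p - q * (α / β))), -(y₁⁻¹ * β⁻¹ * q), ?_⟩
      have hyx : ⁅y, x⁆ = -(p • n + q • m) := by rw [← lie_skew, hxy']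
      rw [hy', smul_lie, sub_lie, smul_lie, lie_self, hx', lie_smul, hyx, hm']
      module

end Classification

/-! ### Classification when the ideal is perfect -/

section Classification

variable {L : Type*} [LieRing L] [LieAlgebra ℂ L]

variable (hL : Module.finrank ℂ L = 4) {f : L →ₗ[ℂ] ℂ}
  (hI : Module.finrank ℂ (LinearMap.ker f) = 3) (hf : ∀ x y : L, f ⁅x, y⁆ = 0)
  (hJ : Module.finrank ℂ (kerBrackets f) = 3)

include hI hJ

/-- In a perfect three-dimensional ideal with basis `u₁, u₂, u₃` the brackets `⁅u₂, u₃⁆`, `⁅u₃, u₁⁆`,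
`⁅u₁, u₂⁆` are linearly independent. -/
theorem linearIndependent_brackets {u₁ u₂ u₃ : L} (h₁ : f u₁ = 0) (h₂ : f u₂ = 0) (h₃ : f u₃ = 0)
    (hli : ∀ a b c : ℂ, a • u₁ + b • u₂ + c • u₃ = 0 → a = 0 ∧ b = 0 ∧ c = 0) :
    ∀ a b c : ℂ, a • ⁅u₂, u₃⁆ + b • ⁅u₃, u₁⁆ + c • ⁅u₁, u₂⁆ = 0 → a = 0 ∧ b = 0 ∧ c = 0 := by
  have hle : kerBrackets f ≤ Submodule.span ℂ (Set.range ![⁅u₂, u₃⁆, ⁅u₃, u₁⁆, ⁅u₁, u₂⁆]) :=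
    kerBrackets_le fun x x' hx hx' => by
      obtain ⟨a, b, c, rfl⟩ := exists_coords hI h₁ h₂ h₃ hli x hx
      obtain ⟨a', b', c', rfl⟩ := exists_coords hI h₁ h₂ h₃ hli x' hx'
      refine (Submodule.mem_span_range_iff_exists_fun ℂ).2
        ⟨![b * c' - c * b', c * a' - a * c', a * b' - b * a'], ?_⟩
      simp only [Fin.sum_univ_three, Matrix.cons_val_zero, Matrix.cons_val_one, Matrix.cons_val,
        lie_add, lie_smul, add_lie, smul_lie, lie_self]
      rw [← lie_skew u₃ u₂, ← lie_skew u₁ u₃, ← lie_skew u₂ u₁]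
      module
  have : Module.Finite ℂ (Submodule.span ℂ (Set.range ![⁅u₂, u₃⁆, ⁅u₃, u₁⁆, ⁅u₁, u₂⁆])) :=
    Module.Finite.span_of_finite ℂ (Set.finite_range _)
  have h3 := Submodule.finrank_mono hle
  rw [hJ] at h3
  exact linearIndependent_three.1 (linearIndependent_iff_card_le_finrank_span.2 (by
    rw [Fintype.card_fin]; exact h3))

/-- The structure constants of a perfect three-dimensional ideal form a symmetric matrix. -/
theorem symm_of_perfect {u₁ u₂ u₃ : L} (h₁ : f u₁ = 0) (h₂ : f u₂ = 0) (h₃ : f u₃ = 0)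
    (hli : ∀ a b c : ℂ, a • u₁ + b • u₂ + c • u₃ = 0 → a = 0 ∧ b = 0 ∧ c = 0)
    {a₁ a₂ a₃ b₁ b₂ b₃ c₁ c₂ c₃ : ℂ}
    (ha : ⁅u₂, u₃⁆ = a₁ • u₁ + a₂ • u₂ + a₃ • u₃) (hb : ⁅u₃, u₁⁆ = b₁ • u₁ + b₂ • u₂ + b₃ • u₃)
    (hc : ⁅u₁, u₂⁆ = c₁ • u₁ + c₂ • u₂ + c₃ • u₃) : b₃ = c₂ ∧ c₁ = a₃ ∧ a₂ = b₁ := by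
  -- The Jacobi identity is a linear relation among the three brackets whose coefficients are the
  -- antisymmetric parts of the matrix; the independence of the brackets makes them vanish.
  have j := lie_jacobi u₁ u₂ u₃
  rw [ha, hb, hc] at j
  simp only [lie_add, lie_smul, lie_self] at j
  rw [← lie_skew u₁ u₃, ← lie_skew u₂ u₁, ← lie_skew u₃ u₂] at j
  have := linearIndependent_brackets hI hJ h₁ h₂ h₃ hli (b₃ - c₂) (c₁ - a₃) (a₂ - b₁)
    (by linear_combination (norm := module) j)
  exact ⟨sub_eq_zero.1 this.1, sub_eq_zero.1 this.2.1, sub_eq_zero.1 this.2.2⟩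

include hf in
-- It suffices that some `ad v` has a nonzero eigenvalue `s` on the ideal, since then `h = s⁻¹ v`
-- works. With `A` the symmetric matrix of structure constants, the eigenvalue equation of `ad v` is
-- `s (s² + q(v)) = 0`, where `q` is the quadratic form of the cofactors of `A`. The rows of `A` are
-- independent, so `q` is not zero.
theorem exists_lie_eq_self :
    ∃ h x : L, f h = 0 ∧ f x = 0 ∧ x ≠ 0 ∧ ⁅h, x⁆ = x := by
  have : Module.Finite ℂ (LinearMap.ker f) := Module.finite_of_finrank_pos (by omega)
  obtain ⟨u₁, u₂, u₃, h₁, h₂, h₃, hli⟩ : ∃ u₁ u₂ u₃ : L, f u₁ = 0 ∧ f u₂ = 0 ∧ f u₃ = 0 ∧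
      ∀ a b c : ℂ, a • u₁ + b • u₂ + c • u₃ = 0 → a = 0 ∧ b = 0 ∧ c = 0 := by
    let B := Module.finBasisOfFinrankEq ℂ (LinearMap.ker f) hI
    have hB : LinearIndependent ℂ ![B 0, B 1, B 2] := by
      convert B.linearIndependent
      ext i; fin_cases i <;> rfl
    exact ⟨B 0, B 1, B 2, (B 0).2, (B 1).2, (B 2).2, fun a b c h =>
      linearIndependent_three.1 hB a b c (Subtype.ext h)⟩
  obtain ⟨a₁, a₂, a₃, ha⟩ := exists_coords hI h₁ h₂ h₃ hli ⁅u₂, u₃⁆ (hf _ _)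
  obtain ⟨b₁, b₂, b₃, hb⟩ := exists_coords hI h₁ h₂ h₃ hli ⁅u₃, u₁⁆ (hf _ _)
  obtain ⟨c₁, c₂, c₃, hc⟩ := exists_coords hI h₁ h₂ h₃ hli ⁅u₁, u₂⁆ (hf _ _)
  obtain ⟨rfl, rfl, rfl⟩ := symm_of_perfect hI hJ h₁ h₂ h₃ hli ha hb hc
  have hli' := linearIndependent_brackets hI hJ h₁ h₂ h₃ hli
  have ha' : ⁅u₃, u₂⁆ = -(a₁ • u₁ + a₂ • u₂ + c₁ • u₃) := by rw [← lie_skew, ha]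
  have hb' : ⁅u₁, u₃⁆ = -(a₂ • u₁ + b₂ • u₂ + b₃ • u₃) := by rw [← lie_skew, hb]
  have hc' : ⁅u₂, u₁⁆ = -(c₁ • u₁ + b₃ • u₂ + c₃ • u₃) := by rw [← lie_skew, hc]
  -- the quadratic form of cofactors
  obtain ⟨v₁, v₂, v₃, hv⟩ : ∃ v₁ v₂ v₃ : ℂ,
      (b₂ * c₃ - b₃ ^ 2) * v₁ ^ 2 + (a₁ * c₃ - c₁ ^ 2) * v₂ ^ 2 + (a₁ * b₂ - a₂ ^ 2) * v₃ ^ 2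
        + 2 * (c₁ * b₃ - a₂ * c₃) * (v₁ * v₂) + 2 * (a₂ * b₃ - c₁ * b₂) * (v₁ * v₃)
        + 2 * (a₂ * c₁ - a₁ * b₃) * (v₂ * v₃) ≠ 0 := by
    by_contra! hq
    have q₁ := hq 1 0 0
    have q₂ := hq 0 1 0
    have q₃ := hq 0 0 1
    have q₁₃ := hq 1 0 1
    have q₂₃ := hq 0 1 1
    -- If `q` vanished, so would the minors of the first two rows, making `[u₂, u₃]` and `[u₃, u₁]`
    -- proportional.
    have m₃ : a₁ * b₂ - a₂ ^ 2 = 0 := by linear_combination q₃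
    have m₁ : a₂ * b₃ - c₁ * b₂ = 0 := by linear_combination (q₁₃ - q₁ - q₃) / 2
    have m₂ : a₂ * c₁ - a₁ * b₃ = 0 := by linear_combination (q₂₃ - q₂ - q₃) / 2
    obtain ⟨e₁, e₁', -⟩ := hli' a₂ (-a₁) 0 (by
      rw [ha, hb]; linear_combination (norm := module) (-m₃) • u₂ + m₂ • u₃)
    obtain ⟨e₂, e₂', -⟩ := hli' b₂ (-a₂) 0 (by
      rw [ha, hb]; linear_combination (norm := module) m₃ • u₁ - m₁ • u₃)
    obtain ⟨e₃, e₃', -⟩ := hli' b₃ (-c₁) 0 (by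
      rw [ha, hb]; linear_combination (norm := module) (-m₂) • u₁ + m₁ • u₂)
    exact one_ne_zero (hli' 1 0 0 (by
      rw [ha, neg_eq_zero.1 e₁', neg_eq_zero.1 e₂', neg_eq_zero.1 e₃']; simp)).1
  obtain ⟨s, hs⟩ := IsAlgClosed.exists_eq_mul_self (-((b₂ * c₃ - b₃ ^ 2) * v₁ ^ 2 +
    (a₁ * c₃ - c₁ ^ 2) * v₂ ^ 2 + (a₁ * b₂ - a₂ ^ 2) * v₃ ^ 2
    + 2 * (c₁ * b₃ - a₂ * c₃) * (v₁ * v₂) + 2 * (a₂ * b₃ - c₁ * b₂) * (v₁ * v₃)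
    + 2 * (a₂ * c₁ - a₁ * b₃) * (v₂ * v₃)))
  have hs0 : s ≠ 0 := by
    rintro rfl
    exact hv (by linear_combination -hs)
  -- The matrix of `ad (v₁ u₁ + v₂ u₂ + v₃ u₃)` in the basis `u₁, u₂, u₃`.
  let N : Matrix (Fin 3) (Fin 3) ℂ :=
    !![v₃ * a₂ - v₂ * c₁, v₁ * c₁ - v₃ * a₁, v₂ * a₁ - v₁ * a₂;
      v₃ * b₂ - v₂ * b₃, v₁ * b₃ - v₃ * a₂, v₂ * a₂ - v₁ * b₂;
      v₃ * b₃ - v₂ * c₃, v₁ * c₃ - v₃ * c₁, v₂ * c₁ - v₁ * b₃]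
  have hdet : (N - s • (1 : Matrix (Fin 3) (Fin 3) ℂ)).det = 0 := by
    rw [Matrix.det_fin_three]
    simp [N, Matrix.sub_apply, Matrix.smul_apply]
    linear_combination s * hs
  obtain ⟨w, hw0, hw⟩ := Matrix.exists_mulVec_eq_zero_iff.2 hdet
  have hw₁ := congrFun hw 0
  have hw₂ := congrFun hw 1
  have hw₃ := congrFun hw 2
  simp [N, Matrix.mulVec, dotProduct, Fin.sum_univ_three, Matrix.sub_apply, Matrix.smul_apply,
    Matrix.one_apply] at hw₁ hw₂ hw₃
  refine ⟨s⁻¹ • (v₁ • u₁ + v₂ • u₂ + v₃ • u₃), w 0 • u₁ + w 1 • u₂ + w 2 • u₃,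
    by simp [h₁, h₂, h₃], by simp [h₁, h₂, h₃], ?_, ?_⟩
  · intro h
    obtain ⟨e₁, e₂, e₃⟩ := hli _ _ _ h
    exact hw0 (by ext i; fin_cases i <;> assumption)
  · rw [smul_lie, inv_smul_eq_iff₀ hs0]
    simp only [lie_add, lie_smul, add_lie, smul_lie, lie_self, ha, hb, hc, ha', hb', hc']
    linear_combination (norm := module) hw₁ • u₁ + hw₂ • u₂ + hw₃ • u₃

include hL hf in
-- Completing `h, x` to a basis by `y`, the symmetry of the structure constants forces `ad h` to act
-- as `-1` on the quotient by the span of `h` and `x`. Hence `y` can be corrected to an eigenvector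
-- for `-1`, which gives an `𝔰𝔩₂`-triple.
theorem isListed_of_finrank_three {u₀ : L} (hu₀ : f u₀ ≠ 0) : IsListed L := by
  have : Module.Finite ℂ (LinearMap.ker f) := Module.finite_of_finrank_pos (by omega)
  obtain ⟨h, x, hh, hx, hx0, hhx⟩ := exists_lie_eq_self hI hf hJ
  have hli2 : LinearIndependent ℂ ![(⟨h, hh⟩ : LinearMap.ker f), ⟨x, hx⟩] := by
    refine LinearIndependent.pair_iff.2 fun a b hab => ?_
    replace hab : a • h + b • x = 0 := congrArg Subtype.val hab
    have h1 := congrArg (fun v => ⁅v, x⁆) hab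
    simp only [add_lie, smul_lie, hhx, lie_self, smul_zero, add_zero, zero_lie] at h1
    have ha := eq_zero_of_smul_eq_zero hx0 h1
    subst ha
    exact ⟨rfl, eq_zero_of_smul_eq_zero hx0 (by rw [← hab]; module)⟩
  obtain ⟨y, hy, hli⟩ : ∃ y, f y = 0 ∧
      ∀ a b c : ℂ, a • h + b • x + c • y = 0 → a = 0 ∧ b = 0 ∧ c = 0 := by
    have hlt : Submodule.span ℂ (Set.range ![(⟨h, hh⟩ : LinearMap.ker f), ⟨x, hx⟩]) < ⊤ := by
      refine Submodule.lt_top_of_finrank_lt_finrank ?_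
      rw [finrank_span_eq_card hli2, hI]
      simp
    obtain ⟨⟨y, hy⟩, -, hyn⟩ := SetLike.exists_of_lt hlt
    refine ⟨y, hy, fun a b c h0 => ?_⟩
    exact linearIndependent_three_of_notMem (p := (⟨h, hh⟩ : LinearMap.ker f)) (q := ⟨x, hx⟩)
      (J := Submodule.span ℂ (Set.range ![(⟨h, hh⟩ : LinearMap.ker f), ⟨x, hx⟩]))
      (Submodule.subset_span ⟨0, rfl⟩) (Submodule.subset_span ⟨1, rfl⟩) hyn
      (LinearIndependent.pair_iff.1 hli2) a b c (Subtype.ext h0)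
  obtain ⟨a₁, a₂, a₃, ha⟩ := exists_coords hI hh hx hy hli ⁅x, y⁆ (hf _ _)
  obtain ⟨b₁, b₂, b₃, hb⟩ := exists_coords hI hh hx hy hli ⁅y, h⁆ (hf _ _)
  have hc : ⁅h, x⁆ = (0 : ℂ) • h + (1 : ℂ) • x + (0 : ℂ) • y := by rw [hhx]; module
  obtain ⟨rfl, rfl, rfl⟩ := symm_of_perfect hI hJ hh hx hy hli ha hb hc
  -- For `a₁ = 0` the bracket `[x, y]` would be a multiple of `x = [h, x]`, contrary to the
  -- independence of the brackets.
  have ha₁ : a₁ ≠ 0 := by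
    rintro rfl
    have := linearIndependent_brackets hI hJ hh hx hy hli 1 0 (-a₂) (by
      rw [ha, hhx]; module)
    exact one_ne_zero this.1
  have hhy : ⁅h, y⁆ = -(a₂ • h + b₂ • x + (1 : ℂ) • y) := by rw [← lie_skew, hb]
  have hxh : ⁅x, h⁆ = -x := by rw [← lie_skew, hhx]
  -- The `-1`-eigenvector of `ad h` congruent to `y`, scaled so that `[x, y'] = h`.
  obtain ⟨y', hy'⟩ : ∃ y', y' = a₁⁻¹ • (y + a₂ • h + (b₂ / 2) • x) := ⟨_, rfl⟩
  have hfy' : f y' = 0 := by simp [hy', hh, hx, hy]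
  have hli' : ∀ a b c : ℂ, a • h + b • x + c • y' = 0 → a = 0 ∧ b = 0 ∧ c = 0 := by
    intro a b c h0
    obtain ⟨h1, h2, h3⟩ := hli (a + c * a₁⁻¹ * a₂) (b + c * a₁⁻¹ * (b₂ / 2)) (c * a₁⁻¹)
      (by rw [← h0, hy']; module)
    obtain rfl : c = 0 := by simpa [ha₁] using h3
    exact ⟨by simpa using h1, by simpa using h2, rfl⟩
  refine isListed_d3 hL (linearIndependent_four_of_form hh hx hfy' hu₀ hli') hhx ?_ ?_
    (exists_coords hI hh hx hfy' hli' _ (hf _ _)) (exists_coords hI hh hx hfy' hli' _ (hf _ _))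
    (exists_coords hI hh hx hfy' hli' _ (hf _ _))
  · rw [hy']
    simp only [lie_smul, lie_add, lie_self, hhy, hhx]
    module
  · rw [hy']
    simp only [lie_smul, lie_add, lie_self, ha, hxh]
    rw [inv_smul_eq_iff₀ ha₁]
    module

omit hI hJ in
include hL in
/-- Every four-dimensional complex Lie algebra is abelian or in the list. -/
theorem isListed : IsListed L := by
  have : Module.Finite ℂ L := Module.finite_of_finrank_pos (by omega)
  obtain ⟨f, hf0, hf⟩ := exists_linearForm_lie_eq_zero hL
  have hI : Module.finrank ℂ (LinearMap.ker f) = 3 := by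
    have := Module.Dual.finrank_ker_add_one_of_ne_zero (f := f) hf0
    omega
  obtain ⟨u₀, hu₀⟩ : ∃ u, f u ≠ 0 := by
    by_contra! h
    exact hf0 (LinearMap.ext h)
  have hle := Submodule.finrank_mono (kerBrackets_le_ker hf)
  rw [hI] at hle
  obtain h | h | h | h : Module.finrank ℂ (kerBrackets f) = 0 ∨
      Module.finrank ℂ (kerBrackets f) = 1 ∨ Module.finrank ℂ (kerBrackets f) = 2 ∨
      Module.finrank ℂ (kerBrackets f) = 3 := by omega
  · exact isListed_of_finrank_zero hL hI hf hu₀ h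
  · by_cases hc : ∀ x v, f x = 0 → v ∈ kerBrackets f → ⁅x, v⁆ = 0
    · exact isListed_of_finrank_one_central hL hI hf hu₀ h hc
    · push Not at hc
      exact isListed_of_finrank_one_noncentral hL hI hf hu₀ h hc
  · exact isListed_of_finrank_two hL hI hf hu₀ h
  · exact isListed_of_finrank_three hL hI hf h hu₀

end Classification

/-! ### Independence of the choice of homogeneous coordinates -/

section WellDefined

theorem isoClass_eq_iff {d d' : LieStructure} : isoClass d = isoClass d' ↔ IsoTo d.Carrier d' :=
  Quotient.eq

theorem IsoTo.refl (d : LieStructure) : IsoTo d.Carrier d := ⟨LieEquiv.refl⟩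

variable {L : Type*} [LieRing L] [LieAlgebra ℂ L]

theorem IsoTo.exists_linearEquiv {d : LieStructure} (h : IsoTo L d) :
    ∃ ψ : V ≃ₗ[ℂ] L, ∀ x y, ψ (d.bracket x y) = ⁅ψ x, ψ y⁆ := by
  obtain ⟨φ⟩ := h
  exact ⟨φ.symm.toLinearEquiv, fun x y => φ.symm.map_lie x y⟩

theorem IsoTo.finrank_eq {d : LieStructure} (h : IsoTo L d) : Module.finrank ℂ L = 4 := by
  obtain ⟨ψ, -⟩ := h.exists_linearEquiv
  rw [← ψ.finrank_eq, Module.finrank_fin_fun]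

/-- The images of the standard basis vectors under an isomorphism. -/
theorem IsoTo.exists_table {d : LieStructure} (h : IsoTo L d) : ∃ e₁ e₂ e₃ e₄ : L,
    (∀ a b c d : ℂ, a • e₁ + b • e₂ + c • e₃ + d • e₄ = 0 → a = 0 ∧ b = 0 ∧ c = 0 ∧ d = 0) ∧
    ∀ i j : Fin 4, ⁅![e₁, e₂, e₃, e₄] i, ![e₁, e₂, e₃, e₄] j⁆ =
      ∑ k : Fin 4, d.bracket (Pi.single i 1) (Pi.single j 1) k • ![e₁, e₂, e₃, e₄] k := by
  obtain ⟨ψ, hψ⟩ := h.exists_linearEquiv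
  have hv : ∀ i : Fin 4, ![ψ (Pi.single 0 1), ψ (Pi.single 1 1), ψ (Pi.single 2 1),
      ψ (Pi.single 3 1)] i = ψ (Pi.single i 1) := fun i => by fin_cases i <;> rfl
  refine ⟨ψ (Pi.single 0 1), ψ (Pi.single 1 1), ψ (Pi.single 2 1), ψ (Pi.single 3 1),
    fun a b c d h => ?_, fun i j => ?_⟩
  · rw [← map_smul, ← map_smul, ← map_smul, ← map_smul, ← map_add, ← map_add, ← map_add,
      LinearEquiv.map_eq_zero_iff] at h
    have h0 := congrFun h 0
    have h1 := congrFun h 1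
    have h2 := congrFun h 2
    have h3 := congrFun h 3
    simp at h0 h1 h2 h3
    exact ⟨h0, h1, h2, h3⟩
  · simp only [hv]
    rw [← hψ]
    simp only [← map_smul]
    rw [← map_sum]
    congr 1
    ext m
    simp [Pi.single_apply]

/-- The isomorphism class of `d₃(a : b : c)` only depends on the elementary symmetric functions of
`a, b, c`. -/
theorem IsoTo.d3Family_of_symm {a b c a' b' c' : ℂ} (h₁ : a + b + c = a' + b' + c')
    (h₂ : a * b + b * c + c * a = a' * b' + b' * c' + c' * a') (h₃ : a * b * c = a' * b' * c')
    (h : IsoTo L (d3Family a b c)) :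
    IsoTo L (d3Family a' b' c') := by
  have hL := h.finrank_eq
  obtain ⟨e₁, e₂, e₃, e₄, hli, h⟩ := h.exists_table
  have h12 := h 0 1
  have h13 := h 0 2
  have h14 := h 0 3
  have h23 := h 1 2
  have h24 := h 1 3
  have h34 := h 2 3
  have h32 := h 2 1
  simp [d3Family, psi_apply, Fin.sum_univ_four] at h12 h13 h14 h23 h24 h34 h32
  -- With `T = [·, e₄]`, the new basis is `(T - b')(T - c') e₃`, `(T - c') e₃`, `e₃`, built from the
  -- same cyclic vector. The identities `k₂` and `k₃` are Cayley–Hamilton: `T - a'` kills the first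
  -- of these vectors.
  obtain rfl : a' = a + b + c - b' - c' := by linear_combination -h₁
  have k₂ : (b + c - b' - c') * b + (c - c') * (c - b') =
      (a + b + c - b' - c') * (b + c - b' - c') := by linear_combination -h₂
  have k₃ : (c - c') * (c - b') * c = (a + b + c - b' - c') * ((c - c') * (c - b')) := by
    linear_combination -c * h₂ + h₃
  refine isoTo_d3Family hL
    (e₁ := e₁ + (b + c - b' - c') • e₂ + ((c - c') * (c - b')) • e₃)
    (e₂ := e₂ + (c - c') • e₃) (e₃ := e₃) (e₄ := e₄) ?_ _ _ _ ?_ ?_ ?_ ?_ ?_ ?_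
  · intro p q r s hs
    obtain ⟨rfl, h2, h3, rfl⟩ := hli p (q + p * (b + c - b' - c'))
      (r + q * (c - c') + p * ((c - c') * (c - b'))) s (by rw [← hs]; module)
    obtain rfl : q = 0 := by linear_combination h2
    exact ⟨rfl, rfl, by linear_combination h3, rfl⟩
  · simp [h12, h13, h23, h32]
  · simp [h13, h23]
  · simp [h23]
  · simp only [add_lie, smul_lie, h14, h24, h34]
    linear_combination (norm := module) k₂ • e₂ + k₃ • e₃
  · simp only [add_lie, smul_lie, h24, h34]; module
  · rw [h34]; module

theorem IsoTo.d3Family_smul {t : ℂ} (ht : t ≠ 0) (a b c : ℂ)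
    (h : IsoTo L (d3Family a b c)) :
    IsoTo L (d3Family (t * a) (t * b) (t * c)) := by
  have hL := h.finrank_eq
  obtain ⟨e₁, e₂, e₃, e₄, hli, h⟩ := h.exists_table
  have h12 := h 0 1
  have h13 := h 0 2
  have h14 := h 0 3
  have h23 := h 1 2
  have h24 := h 1 3
  have h34 := h 2 3
  simp [d3Family, psi_apply, Fin.sum_univ_four] at h12 h13 h14 h23 h24 h34
  -- Scaling `e₄` multiplies the spectrum by `t`; the powers of `t` on `e₁` and `e₂` restore the
  -- unit entries.
  refine isoTo_d3Family hL (e₁ := (t ^ 2) • e₁) (e₂ := t • e₂) (e₃ := e₃)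
    (e₄ := t • e₄) ?_ _ _ _ ?_ ?_ ?_ ?_ ?_ ?_
  · intro p q r s hs
    have := hli (p * t ^ 2) (q * t) r (s * t) (by rw [← hs]; module)
    simpa [ht] using this
  · simp [h12]
  · simp [h13]
  · simp [h23]
  · simp only [smul_lie, lie_smul, h14]; module
  · simp only [smul_lie, lie_smul, h24]; module
  · simp only [lie_smul, h34]; module

/-- The vector `e₃` is cyclic for the action of `e₄` modulo `e₁`, so the two eigenvalues can be
taken in either order. The change of basis is a shear and so does not affect `[e₂, e₃] = e₁`. -/
theorem IsoTo.d1Family_swap (a b : ℂ)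
    (h : IsoTo L (d1Family a b)) :
    IsoTo L (d1Family b a) := by
  have hL := h.finrank_eq
  obtain ⟨e₁, e₂, e₃, e₄, hli, h⟩ := h.exists_table
  have h12 := h 0 1
  have h13 := h 0 2
  have h14 := h 0 3
  have h23 := h 1 2
  have h24 := h 1 3
  have h34 := h 2 3
  simp [d1Family, psi_apply, Fin.sum_univ_four] at h12 h13 h14 h23 h24 h34
  refine isoTo_d1Family hL (e₁ := e₁) (e₂ := e₂ + (b - a) • e₃) (e₃ := e₃)
    (e₄ := e₄) ?_ _ _ ?_ ?_ ?_ ?_ ?_ ?_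
  · intro p q r s hs
    obtain ⟨rfl, rfl, h3, rfl⟩ := hli p q (r + q * (b - a)) s (by rw [← hs]; module)
    exact ⟨rfl, rfl, by simpa using h3, rfl⟩
  · simp [h12, h13]
  · simp [h13]
  · simp [h23]
  · rw [h14, add_comm]
  · simp only [add_lie, smul_lie, h24, h34]; module
  · simp only [h34]; module

theorem IsoTo.d1Family_smul {t : ℂ} (ht : t ≠ 0) (a b : ℂ)
    (h : IsoTo L (d1Family a b)) :
    IsoTo L (d1Family (t * a) (t * b)) := by
  have hL := h.finrank_eq
  obtain ⟨e₁, e₂, e₃, e₄, hli, h⟩ := h.exists_table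
  have h12 := h 0 1
  have h13 := h 0 2
  have h14 := h 0 3
  have h23 := h 1 2
  have h24 := h 1 3
  have h34 := h 2 3
  simp [d1Family, psi_apply, Fin.sum_univ_four] at h12 h13 h14 h23 h24 h34
  refine isoTo_d1Family hL (e₁ := t • e₁) (e₂ := t • e₂) (e₃ := e₃)
    (e₄ := t • e₄) ?_ _ _ ?_ ?_ ?_ ?_ ?_ ?_
  · intro p q r s hs
    have := hli (p * t) (q * t) r (s * t) (by rw [← hs]; module)
    simpa [ht] using this
  · simp [h12]
  · simp [h13]
  · simp [h23]
  · simp only [smul_lie, lie_smul, h14]; module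
  · simp only [smul_lie, lie_smul, h24]; module
  · simp only [lie_smul, h34]; module

theorem IsoTo.d3SmallFamily_smul {t : ℂ} (ht : t ≠ 0) (a b : ℂ)
    (h : IsoTo L (d3SmallFamily a b)) :
    IsoTo L (d3SmallFamily (t * a) (t * b)) := by
  have hL := h.finrank_eq
  obtain ⟨e₁, e₂, e₃, e₄, hli, h⟩ := h.exists_table
  have h12 := h 0 1
  have h13 := h 0 2
  have h14 := h 0 3
  have h23 := h 1 2
  have h24 := h 1 3
  have h34 := h 2 3
  simp [d3SmallFamily, psi_apply, Fin.sum_univ_four] at h12 h13 h14 h23 h24 h34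
  refine isoTo_d3SmallFamily hL (e₁ := e₁) (e₂ := t • e₂) (e₃ := e₃)
    (e₄ := t • e₄) ?_ _ _ ?_ ?_ ?_ ?_ ?_ ?_
  · intro p q r s hs
    have := hli p (q * t) r (s * t) (by rw [← hs]; module)
    simpa [ht] using this
  · simp [h12]
  · simp [h13]
  · simp [h23]
  · simp only [lie_smul, h14]; module
  · simp only [smul_lie, lie_smul, h24]; module
  · simp only [lie_smul, h34]; module

theorem ProjOrbifold.mk_eq_mk_iff {n : ℕ} {v w : Fin n → ℂ} {hv : v ≠ 0} {hw : w ≠ 0} :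
    ProjOrbifold.mk v hv = ProjOrbifold.mk w hw ↔
      ∃ (t : ℂ) (σ : Equiv.Perm (Fin n)), t ≠ 0 ∧ ∀ i, v i = t * w (σ i) := by
  rw [ProjOrbifold.mk, ProjOrbifold.mk, Quotient.eq, MulAction.orbitRel_apply, MulAction.mem_orbit_iff]
  constructor
  · rintro ⟨g, hg⟩
    rw [Projectivization.smul_mk, Projectivization.mk_eq_mk_iff'] at hg
    obtain ⟨a, ha⟩ := hg
    have ha0 : a ≠ 0 := by
      rintro rfl
      rw [zero_smul] at ha
      exact hw ((smul_eq_zero_iff_eq g).1 ha.symm)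
    refine ⟨a⁻¹, DomMulAct.mk.symm g, inv_ne_zero ha0, fun i => ?_⟩
    have := congrFun ha i
    rw [DomMulAct.smul_apply] at this
    simp only [Pi.smul_apply, smul_eq_mul, Equiv.Perm.smul_def] at this
    rw [← this]
    field_simp
  · rintro ⟨t, σ, ht, h⟩
    refine ⟨DomMulAct.mk σ, ?_⟩
    rw [Projectivization.smul_mk, Projectivization.mk_eq_mk_iff']
    refine ⟨t⁻¹, ?_⟩
    ext i
    rw [DomMulAct.smul_apply]
    simp [h, ht]

theorem ProjOrbifold.exists_eq_mk {n : ℕ} (p : ProjOrbifold n) :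
    ∃ (v : Fin n → ℂ) (hv : v ≠ 0), p = ProjOrbifold.mk v hv := by
  induction p using Quotient.inductionOn with
  | h q => exact ⟨q.rep, q.rep_nonzero, by rw [ProjOrbifold.mk, q.mk_rep]⟩

theorem isoClass_d3Family_congr {v w : Fin 3 → ℂ} {t : ℂ} {σ : Equiv.Perm (Fin 3)} (ht : t ≠ 0)
    (h : ∀ i, v i = t * w (σ i)) :
    isoClass (d3Family (v 0) (v 1) (v 2)) = isoClass (d3Family (w 0) (w 1) (w 2)) := by
  rw [eq_comm, isoClass_eq_iff, h, h, h]
  have h₁ := Equiv.sum_comp σ w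
  have h₃ := Equiv.prod_comp σ w
  -- The second elementary symmetric function is recovered from the first two power sums.
  have h₂ := Equiv.sum_comp σ (fun i => w i ^ 2)
  simp only [Fin.sum_univ_three, Fin.prod_univ_three] at h₁ h₂ h₃
  refine ((IsoTo.refl _).d3Family_smul ht _ _ _).d3Family_of_symm ?_ ?_ ?_
  · linear_combination -t * h₁
  · linear_combination -t ^ 2 / 2 * ((w (σ 0) + w (σ 1) + w (σ 2) + (w 0 + w 1 + w 2)) * h₁ - h₂)
  · linear_combination -t ^ 3 * h₃

theorem isoClass_d1Family_congr {v w : Fin 2 → ℂ} {t : ℂ} {σ : Equiv.Perm (Fin 2)} (ht : t ≠ 0)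
    (h : ∀ i, v i = t * w (σ i)) :
    isoClass (d1Family (v 0) (v 1)) = isoClass (d1Family (w 0) (w 1)) := by
  rw [eq_comm, isoClass_eq_iff, h, h]
  have h₁ := σ.injective.ne (show (0 : Fin 2) ≠ 1 by decide)
  obtain ⟨h0, h1⟩ | ⟨h0, h1⟩ : (σ 0 = 0 ∧ σ 1 = 1) ∨ (σ 0 = 1 ∧ σ 1 = 0) := by omega
  · rw [h0, h1]
    exact (IsoTo.refl _).d1Family_smul ht _ _
  · rw [h0, h1]
    exact ((IsoTo.refl _).d1Family_smul ht _ _).d1Family_swap _ _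

end WellDefined

/-! ### Invariants separating the structures of the list -/

section Invariants

theorem exists_linearEquiv_of_isoClass_eq {d d' : LieStructure} (h : isoClass d = isoClass d') :
    ∃ ψ : V ≃ₗ[ℂ] V, ∀ x y, ψ (d.bracket x y) = d'.bracket (ψ x) (ψ y) := by
  obtain ⟨φ⟩ := isoClass_eq_iff.1 h
  exact ⟨φ.toLinearEquiv, fun x y => φ.map_lie x y⟩

namespace LieStructure

/-- `x` is ad-nilpotent for the bracket of `d`. -/
def AdNilpotent (d : LieStructure) (x : V) : Prop :=
  -- On a four-dimensional space, nilpotency of `ad x` means that its fourth power vanishes.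
  ∀ y, d.bracket x (d.bracket x (d.bracket x (d.bracket x y))) = 0

/-- On the list this fails only for the nonsolvable `d3`. -/
def BracketsAdNilpotent (d : LieStructure) : Prop := ∀ x y, d.AdNilpotent (d.bracket x y)

/-- Among the solvable structures of the list this fails only for `d2Sharp`, where the ad-nilpotent
elements form a subspace of codimension two. -/
def CodimAdNilpotentLeOne (d : LieStructure) : Prop :=
  ∀ x y, ∃ s t : ℂ, (s ≠ 0 ∨ t ≠ 0) ∧ d.AdNilpotent (s • x + t • y)

def AllAdNilpotent (d : LieStructure) : Prop := ∀ x, d.AdNilpotent x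

def TwoStepNilpotent (d : LieStructure) : Prop := ∀ x y z, d.bracket x (d.bracket y z) = 0

/-- For the non-nilpotent triangular structures the ad-nilpotent elements form the ideal spanned by
`e₁, e₂, e₃`; the condition tells whether it is abelian or Heisenberg. -/
def AdNilpotentsCommute (d : LieStructure) : Prop :=
  ∀ x y, d.AdNilpotent x → d.AdNilpotent y → d.bracket x y = 0

/-- When that ideal is abelian, this singles out `d3Star`. -/
def ScalarOnAdNilpotents (d : LieStructure) : Prop :=
  ∀ x, ∃ p : ℂ, ∀ n, d.AdNilpotent n → d.bracket x n = p • n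

/-- A minimal polynomial of degree at most two: this holds for `d3SmallFamily`, and fails for the
cyclic action in `d3Family`. -/
def QuadraticOnAdNilpotents (d : LieStructure) : Prop :=
  ∀ x, ∃ p q : ℂ, ∀ n, d.AdNilpotent n → d.bracket x (d.bracket x n) = p • d.bracket x n + q • n

/-- When the ideal is Heisenberg, this distinguishes `d1Sharp` from `d1Family`. -/
def ScalarModuloCenter (d : LieStructure) : Prop :=
  ∀ x, ∃ p : ℂ, ∀ n m, d.AdNilpotent n → d.AdNilpotent m → d.bracket m (d.bracket x n - p • n) = 0

open Classical in
/-- A number that only depends on the isomorphism class and separates the families and the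
single structures of the list. -/
noncomputable def kind (d : LieStructure) : ℕ :=
  if ¬ d.BracketsAdNilpotent then 0
  else if ¬ d.CodimAdNilpotentLeOne then 1
  else if d.AllAdNilpotent then if d.TwoStepNilpotent then 2 else 3
  else if d.AdNilpotentsCommute then
    if d.ScalarOnAdNilpotents then 4 else if d.QuadraticOnAdNilpotents then 5 else 6
  else if d.ScalarModuloCenter then 7 else 8

/-! ### Invariance under isomorphism -/

section Transport

variable {d d' : LieStructure} (ψ : V ≃ₗ[ℂ] V)
  (h : ∀ x y, ψ (d.bracket x y) = d'.bracket (ψ x) (ψ y))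

include h

theorem adNilpotent_iff (x : V) : d.AdNilpotent x ↔ d'.AdNilpotent (ψ x) := by
  refine ψ.toEquiv.forall_congr fun y => ?_
  change _ ↔ d'.bracket (ψ x) (d'.bracket (ψ x) (d'.bracket (ψ x) (d'.bracket (ψ x) (ψ y)))) = 0
  rw [← h, ← h, ← h, ← h, ψ.map_eq_zero_iff]

theorem bracketsAdNilpotent_iff : d.BracketsAdNilpotent ↔ d'.BracketsAdNilpotent := by
  refine ψ.toEquiv.forall_congr fun x => ψ.toEquiv.forall_congr fun y => ?_
  change _ ↔ d'.AdNilpotent (d'.bracket (ψ x) (ψ y))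
  rw [← h, adNilpotent_iff ψ h]

theorem codimAdNilpotentLeOne_iff : d.CodimAdNilpotentLeOne ↔ d'.CodimAdNilpotentLeOne := by
  refine ψ.toEquiv.forall_congr fun x => ψ.toEquiv.forall_congr fun y =>
    exists_congr fun p => exists_congr fun q => and_congr_right fun _ => ?_
  change _ ↔ d'.AdNilpotent (p • ψ x + q • ψ y)
  rw [adNilpotent_iff ψ h, map_add, map_smul, map_smul]

theorem allAdNilpotent_iff : d.AllAdNilpotent ↔ d'.AllAdNilpotent :=
  ψ.toEquiv.forall_congr fun x => adNilpotent_iff ψ h x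

theorem twoStepNilpotent_iff : d.TwoStepNilpotent ↔ d'.TwoStepNilpotent := by
  refine ψ.toEquiv.forall_congr fun x => ψ.toEquiv.forall_congr fun y =>
    ψ.toEquiv.forall_congr fun z => ?_
  change _ ↔ d'.bracket (ψ x) (d'.bracket (ψ y) (ψ z)) = 0
  rw [← h, ← h, ψ.map_eq_zero_iff]

theorem adNilpotentsCommute_iff : d.AdNilpotentsCommute ↔ d'.AdNilpotentsCommute := by
  refine ψ.toEquiv.forall_congr fun x => ψ.toEquiv.forall_congr fun y =>
    imp_congr (adNilpotent_iff ψ h x) (imp_congr (adNilpotent_iff ψ h y) ?_)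
  change _ ↔ d'.bracket (ψ x) (ψ y) = 0
  rw [← h, ψ.map_eq_zero_iff]

theorem scalarOnAdNilpotents_iff : d.ScalarOnAdNilpotents ↔ d'.ScalarOnAdNilpotents := by
  refine ψ.toEquiv.forall_congr fun x => exists_congr fun p => ψ.toEquiv.forall_congr fun n =>
    imp_congr (adNilpotent_iff ψ h n) ?_
  change _ ↔ d'.bracket (ψ x) (ψ n) = p • ψ n
  rw [← h, ← map_smul, ψ.injective.eq_iff]

theorem quadraticOnAdNilpotents_iff :
    d.QuadraticOnAdNilpotents ↔ d'.QuadraticOnAdNilpotents := by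
  refine ψ.toEquiv.forall_congr fun x => exists_congr fun p => exists_congr fun q =>
    ψ.toEquiv.forall_congr fun n => imp_congr (adNilpotent_iff ψ h n) ?_
  change _ ↔ d'.bracket (ψ x) (d'.bracket (ψ x) (ψ n)) =
    p • d'.bracket (ψ x) (ψ n) + q • ψ n
  rw [← h, ← h, ← map_smul ψ, ← map_smul ψ, ← map_add, ψ.injective.eq_iff]

theorem scalarModuloCenter_iff : d.ScalarModuloCenter ↔ d'.ScalarModuloCenter := by
  refine ψ.toEquiv.forall_congr fun x => exists_congr fun p => ψ.toEquiv.forall_congr fun n =>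
    ψ.toEquiv.forall_congr fun m => imp_congr (adNilpotent_iff ψ h n)
      (imp_congr (adNilpotent_iff ψ h m) ?_)
  change _ ↔ d'.bracket (ψ m) (d'.bracket (ψ x) (ψ n) - p • ψ n) = 0
  rw [← h, ← map_smul, ← map_sub, ← h, ψ.map_eq_zero_iff]

open Classical in
theorem kind_eq : d.kind = d'.kind :=
  if_congr (not_congr (bracketsAdNilpotent_iff ψ h)) rfl <|
    if_congr (not_congr (codimAdNilpotentLeOne_iff ψ h)) rfl <|
      if_congr (allAdNilpotent_iff ψ h) (if_congr (twoStepNilpotent_iff ψ h) rfl rfl) <|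
        if_congr (adNilpotentsCommute_iff ψ h)
          (if_congr (scalarOnAdNilpotents_iff ψ h) rfl
            (if_congr (quadraticOnAdNilpotents_iff ψ h) rfl rfl))
          (if_congr (scalarModuloCenter_iff ψ h) rfl rfl)

theorem charpoly_eq (x : V) :
    (d'.bracket (ψ x)).charpoly = (d.bracket x).charpoly := by
  rw [← LinearEquiv.charpoly_conj ψ (d.bracket x)]
  congr 1
  refine LinearMap.ext fun y => ?_
  obtain ⟨y, rfl⟩ := ψ.surjective y
  simp [LinearEquiv.conj_apply, h]

end Transport

/-- The bracket of `d` is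
`[e₂,e₃] = r e₁, [e₁,e₄] = a e₁, [e₂,e₄] = s e₁ + b e₂, [e₃,e₄] = u e₂ + c e₃`. -/
def IsTriangular (d : LieStructure) (r s u a b c : ℂ) : Prop :=
  ∀ x y : V, d.bracket x y =
    ![r * (x 1 * y 2 - x 2 * y 1) + a * (x 0 * y 3 - x 3 * y 0) + s * (x 1 * y 3 - x 3 * y 1),
      b * (x 1 * y 3 - x 3 * y 1) + u * (x 2 * y 3 - x 3 * y 2),
      c * (x 2 * y 3 - x 3 * y 2), 0]

end LieStructure

open LieStructure

theorem isTriangular_d3Family (a b c : ℂ) : (d3Family a b c).IsTriangular 0 1 1 a b c := by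
  intro x y
  ext i
  fin_cases i <;> simp [d3Family, psi_apply]

theorem isTriangular_d1Family (a b : ℂ) : (d1Family a b).IsTriangular 1 0 1 (a + b) a b := by
  intro x y
  ext i
  fin_cases i <;> simp [d1Family, psi_apply]

theorem isTriangular_d3SmallFamily (a b : ℂ) : (d3SmallFamily a b).IsTriangular 0 0 1 a a b := by
  intro x y
  ext i
  fin_cases i <;> simp [d3SmallFamily, psi_apply]

theorem isTriangular_d1 : d1.IsTriangular 0 1 0 0 0 0 := by
  intro x y
  ext i
  fin_cases i <;> simp [d1, psi_apply]

theorem isTriangular_d1Sharp : d1Sharp.IsTriangular 1 0 0 2 1 1 := by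
  intro x y
  ext i
  fin_cases i <;> simp [d1Sharp, psi_apply]

theorem isTriangular_d2Star : d2Star.IsTriangular 0 1 1 0 0 0 := by
  intro x y
  ext i
  fin_cases i <;> simp [d2Star, psi_apply]

theorem isTriangular_d3Star : d3Star.IsTriangular 0 0 0 1 1 1 := by
  intro x y
  ext i
  fin_cases i <;> simp [d3Star, psi_apply]

/-! ### Ad-nilpotent elements and characteristic polynomials of triangular structures -/

section Triangular

variable {d : LieStructure} {r s u a b c : ℂ} (hd : d.IsTriangular r s u a b c)

include hd

theorem LieStructure.IsTriangular.apply_zero (x y : V) : d.bracket x y 0 =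
    r * (x 1 * y 2 - x 2 * y 1) + a * (x 0 * y 3 - x 3 * y 0) + s * (x 1 * y 3 - x 3 * y 1) :=
  congrFun (hd x y) 0

theorem LieStructure.IsTriangular.apply_one (x y : V) : d.bracket x y 1 =
    b * (x 1 * y 3 - x 3 * y 1) + u * (x 2 * y 3 - x 3 * y 2) :=
  congrFun (hd x y) 1

theorem LieStructure.IsTriangular.apply_two (x y : V) : d.bracket x y 2 =
    c * (x 2 * y 3 - x 3 * y 2) :=
  congrFun (hd x y) 2

theorem LieStructure.IsTriangular.apply_three (x y : V) : d.bracket x y 3 = 0 :=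
  congrFun (hd x y) 3

theorem LieStructure.IsTriangular.adNilpotent_of_eq_zero {x : V} (hx : x 3 = 0) :
    d.AdNilpotent x := by
  intro y
  ext i
  fin_cases i <;> simp [hd.apply_zero, hd.apply_one, hd.apply_two, hd.apply_three, hx]

/-- In the standard basis `ad x` is upper triangular with diagonal `-x₄ a, -x₄ b, -x₄ c, 0`, where
`x₄` is the coordinate `x 3`. The forward direction reads off the diagonal of the fourth power.
Conversely, if `x₄ ≠ 0` the matrix is strictly triangular. -/
theorem LieStructure.IsTriangular.adNilpotent_iff (x : V) :
    d.AdNilpotent x ↔ x 3 * a = 0 ∧ x 3 * b = 0 ∧ x 3 * c = 0 := by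
  constructor
  · intro h
    have p₂ : ∀ z : V, z 3 = 0 → d.bracket x z 2 = -(x 3 * c) * z 2 := fun z h3 => by
      rw [hd.apply_two, h3]; ring
    have q₂ : ∀ z : V, z 3 = 0 → z 2 = 0 → d.bracket x z 2 = 0 := fun z h3 h2 => by
      rw [p₂ z h3, h2, mul_zero]
    have p₁ : ∀ z : V, z 3 = 0 → z 2 = 0 → d.bracket x z 1 = -(x 3 * b) * z 1 := fun z h3 h2 => by
      rw [hd.apply_one, h3, h2]; ring
    have e₀ : d.bracket x (Pi.single 0 1) = (-(x 3 * a)) • Pi.single 0 1 := by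
      ext i
      fin_cases i <;>
        simp [hd.apply_zero, hd.apply_one, hd.apply_two, hd.apply_three, mul_comm]
    have h0 := congrFun (h (Pi.single 0 1)) 0
    have h1 := congrFun (h (Pi.single 1 1)) 1
    have h2 := congrFun (h (Pi.single 2 1)) 2
    simp only [e₀, map_smul, smul_smul] at h0
    have t₃ := hd.apply_three
    rw [p₂ _ (t₃ _ _), p₂ _ (t₃ _ _), p₂ _ (t₃ _ _), p₂ _ (by simp)] at h2
    have g₁ : d.bracket x (Pi.single 1 1) 2 = 0 := q₂ _ (by simp) (by simp)
    have g₂ := q₂ _ (t₃ x _) g₁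
    have g₃ := q₂ _ (t₃ x _) g₂
    rw [p₁ _ (t₃ _ _) g₃, p₁ _ (t₃ _ _) g₂, p₁ _ (t₃ _ _) g₁, p₁ _ (by simp) (by simp)] at h1
    simp at h0 h1 h2
    simp only [mul_eq_zero]
    tauto
  · rintro ⟨ha, hb, hc⟩
    by_cases hx : x 3 = 0
    · exact hd.adNilpotent_of_eq_zero hx
    obtain rfl : a = 0 := by simpa [hx] using ha
    obtain rfl : b = 0 := by simpa [hx] using hb
    obtain rfl : c = 0 := by simpa [hx] using hc
    have h₂ : ∀ z, d.bracket x z 2 = 0 := fun z => by rw [hd.apply_two, zero_mul]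
    have h₁ : ∀ z, d.bracket x (d.bracket x z) 1 = 0 := fun z => by
      rw [hd.apply_one, hd.apply_three, h₂]; ring
    have h₀ : ∀ z, d.bracket x (d.bracket x (d.bracket x z)) 0 = 0 := fun z => by
      rw [hd.apply_zero, hd.apply_three, h₁, h₂]; ring
    intro y
    ext i
    fin_cases i
    exacts [h₀ _, h₁ _, h₂ _, hd.apply_three _ _]

theorem LieStructure.IsTriangular.adNilpotent_iff_of_ne (h0 : ![a, b, c] ≠ 0) (x : V) :
    d.AdNilpotent x ↔ x 3 = 0 := by
  refine ⟨fun h => ?_, hd.adNilpotent_of_eq_zero⟩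
  by_contra hx
  have := (hd.adNilpotent_iff x).1 h
  simp only [mul_eq_zero, hx, false_or] at this
  obtain ⟨rfl, rfl, rfl⟩ := this
  exact h0 (by ext i; fin_cases i <;> rfl)

theorem LieStructure.IsTriangular.bracketsAdNilpotent : d.BracketsAdNilpotent := fun x y =>
  hd.adNilpotent_of_eq_zero (hd.apply_three x y)

theorem LieStructure.IsTriangular.codimAdNilpotentLeOne : d.CodimAdNilpotentLeOne := by
  intro x y
  by_cases hx : x 3 = 0
  · exact ⟨1, 0, .inl one_ne_zero, hd.adNilpotent_of_eq_zero (by simp [hx])⟩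
  · exact ⟨y 3, -x 3, .inr (neg_ne_zero.2 hx), hd.adNilpotent_of_eq_zero (by simp; ring)⟩

theorem LieStructure.IsTriangular.not_allAdNilpotent (h0 : ![a, b, c] ≠ 0) :
    ¬ d.AllAdNilpotent := by
  intro h
  have := (hd.adNilpotent_iff_of_ne h0 _).1 (h (Pi.single 3 1))
  simp at this

open Polynomial in
theorem LieStructure.IsTriangular.charpoly_eq (x : V) : (d.bracket x).charpoly =
    (X + C (x 3 * a)) * (X + C (x 3 * b)) * (X + C (x 3 * c)) * X := by
  rw [← LinearMap.charpoly_toMatrix (d.bracket x) (Pi.basisFun ℂ (Fin 4)),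
    Matrix.charpoly_of_isUpperTriangular]
  · simp [Fin.prod_univ_four, hd.apply_zero, hd.apply_one, hd.apply_two, hd.apply_three, mul_comm]
  · intro i j hij
    fin_cases i <;> fin_cases j <;>
      first | exact absurd hij (by decide) | simp [hd.apply_one, hd.apply_two, hd.apply_three]

end Triangular

/-! ### The invariant of each structure of the list -/

theorem kind_d3 : d3.kind = 0 := by
  have : ¬ d3.BracketsAdNilpotent := fun h => by
    -- The bracket `[e₂, e₃] = e₁` exchanges `e₂` and `e₃`, so its adjoint is not nilpotent.
    have := congrFun (h (Pi.single 1 1) (Pi.single 2 1) (Pi.single 1 1)) 1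
    simp [d3, psi_apply] at this
  simp [kind, this]

theorem kind_d2Sharp : d2Sharp.kind = 1 := by
  have h₁ : d2Sharp.BracketsAdNilpotent := fun x y z => by
    ext i
    fin_cases i <;> simp [d2Sharp, psi_apply]
  have h₂ : ¬ d2Sharp.CodimAdNilpotentLeOne := fun h => by
    -- The element `s e₂ + t e₄` scales `e₁` by `-s` and `e₃` by `-t`.
    obtain ⟨s, t, hst, h⟩ := h (Pi.single 1 1) (Pi.single 3 1)
    have h0 := congrFun (h (Pi.single 0 1)) 0
    have h2 := congrFun (h (Pi.single 2 1)) 2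
    simp [d2Sharp, psi_apply] at h0 h2
    tauto
  simp [kind, h₁, h₂]

theorem kind_d1 : d1.kind = 2 := by
  have hd := isTriangular_d1
  have h₁ : d1.AllAdNilpotent := fun x => (hd.adNilpotent_iff x).2 (by simp)
  have h₂ : d1.TwoStepNilpotent := fun x y z => by
    ext i
    fin_cases i <;> simp [hd.apply_zero, hd.apply_one, hd.apply_two, hd.apply_three]
  simp [kind, hd.bracketsAdNilpotent, hd.codimAdNilpotentLeOne, h₁, h₂]

theorem kind_d2Star : d2Star.kind = 3 := by
  have hd := isTriangular_d2Star
  have h₁ : d2Star.AllAdNilpotent := fun x => (hd.adNilpotent_iff x).2 (by simp)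
  have h₂ : ¬ d2Star.TwoStepNilpotent := fun h => by
    have := congrFun (h (Pi.single 3 1) (Pi.single 3 1) (Pi.single 2 1)) 0
    simp [hd.apply_zero, hd.apply_one, hd.apply_two, hd.apply_three] at this
  simp [kind, hd.bracketsAdNilpotent, hd.codimAdNilpotentLeOne, h₁, h₂]

theorem LieStructure.IsTriangular.adNilpotentsCommute {d : LieStructure} {s u a b c : ℂ}
    (hd : d.IsTriangular 0 s u a b c) (h0 : ![a, b, c] ≠ 0) : d.AdNilpotentsCommute := by
  intro x y hx hy
  rw [hd.adNilpotent_iff_of_ne h0] at hx hy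
  ext i
  fin_cases i <;> simp [hd.apply_zero, hd.apply_one, hd.apply_two, hd.apply_three, hx, hy]

theorem LieStructure.IsTriangular.not_adNilpotentsCommute {d : LieStructure} {s u a b c : ℂ}
    (hd : d.IsTriangular 1 s u a b c) : ¬ d.AdNilpotentsCommute := by
  intro h
  have := congrFun (h (Pi.single 1 1) (Pi.single 2 1) (hd.adNilpotent_of_eq_zero (by simp))
    (hd.adNilpotent_of_eq_zero (by simp))) 0
  simp [hd.apply_zero] at this

theorem kind_d3Star : d3Star.kind = 4 := by
  have hd := isTriangular_d3Star
  have h0 : ![(1 : ℂ), 1, 1] ≠ 0 := fun h => one_ne_zero (congrFun h 0)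
  have h₁ : d3Star.ScalarOnAdNilpotents := fun x => ⟨-x 3, fun n hn => by
    rw [hd.adNilpotent_iff_of_ne h0] at hn
    ext i
    fin_cases i <;> simp [hd.apply_zero, hd.apply_one, hd.apply_two, hd.apply_three, hn]⟩
  simp [kind, hd.bracketsAdNilpotent, hd.codimAdNilpotentLeOne, hd.not_allAdNilpotent h0,
    hd.adNilpotentsCommute h0, h₁]

theorem not_scalarOnAdNilpotents {d : LieStructure} {s a b c : ℂ}
    (hd : d.IsTriangular 0 s 1 a b c) : ¬ d.ScalarOnAdNilpotents := by
  intro h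
  obtain ⟨p, hp⟩ := h (Pi.single 3 1)
  have := congrFun (hp (Pi.single 2 1) (hd.adNilpotent_of_eq_zero (by simp))) 1
  simp [hd.apply_one] at this

theorem kind_d3SmallFamily {a b : ℂ} (h0 : ![a, b] ≠ 0) : (d3SmallFamily a b).kind = 5 := by
  have hd := isTriangular_d3SmallFamily a b
  have h0' : ![a, a, b] ≠ 0 := fun h => h0 (by
    ext i; fin_cases i; exacts [congrFun h 0, congrFun h 2])
  have h₁ : (d3SmallFamily a b).QuadraticOnAdNilpotents := fun x =>
    -- On the ideal, `ad x` is annihilated by the product of `ad x + x₄ a` and `ad x + x₄ b`, with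
    -- `x₄ = x 3`.
    ⟨-(x 3 * (a + b)), -(x 3 ^ 2 * (a * b)), fun n hn => by
      rw [hd.adNilpotent_iff_of_ne h0'] at hn
      ext i
      fin_cases i <;> simp [hd.apply_zero, hd.apply_one, hd.apply_two, hd.apply_three, hn] <;> ring⟩
  simp [kind, hd.bracketsAdNilpotent, hd.codimAdNilpotentLeOne, hd.not_allAdNilpotent h0',
    hd.adNilpotentsCommute h0', not_scalarOnAdNilpotents hd, h₁]

theorem kind_d3Family {a b c : ℂ} (h0 : ![a, b, c] ≠ 0) : (d3Family a b c).kind = 6 := by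
  have hd := isTriangular_d3Family a b c
  have h₁ : ¬ (d3Family a b c).QuadraticOnAdNilpotents := fun h => by
    obtain ⟨p, q, hpq⟩ := h (Pi.single 3 1)
    -- Applying `ad e₄` twice to `e₃` produces an `e₁`-component, which neither `e₃` nor `[e₄, e₃]`
    -- has.
    have := congrFun (hpq (Pi.single 2 1) (hd.adNilpotent_of_eq_zero (by simp))) 0
    simp [hd.apply_zero, hd.apply_one, hd.apply_two, hd.apply_three] at this
  simp [kind, hd.bracketsAdNilpotent, hd.codimAdNilpotentLeOne, hd.not_allAdNilpotent h0,
    hd.adNilpotentsCommute h0, not_scalarOnAdNilpotents hd, h₁]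

theorem kind_d1Sharp : d1Sharp.kind = 7 := by
  have hd := isTriangular_d1Sharp
  have h0 : ![(2 : ℂ), 1, 1] ≠ 0 := fun h => one_ne_zero (congrFun h 1)
  have h₁ : d1Sharp.ScalarModuloCenter := fun x => ⟨-x 3, fun n m hn hm => by
    rw [hd.adNilpotent_iff_of_ne h0] at hn hm
    ext i
    fin_cases i <;> simp [hd.apply_zero, hd.apply_one, hd.apply_two, hd.apply_three, hn, hm]⟩
  simp [kind, hd.bracketsAdNilpotent, hd.codimAdNilpotentLeOne, hd.not_allAdNilpotent h0,
    hd.not_adNilpotentsCommute, h₁]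

theorem kind_d1Family {a b : ℂ} (h0 : ![a, b] ≠ 0) : (d1Family a b).kind = 8 := by
  have hd := isTriangular_d1Family a b
  have h0' : ![a + b, a, b] ≠ 0 := fun h => h0 (by
    ext i; fin_cases i; exacts [congrFun h 1, congrFun h 2])
  have h₁ : ¬ (d1Family a b).ScalarModuloCenter := fun h => by
    obtain ⟨p, hp⟩ := h (Pi.single 3 1)
    -- Bracketing with `e₃` detects the `e₂`-component of `[e₄, e₃]`, which no multiple of `e₃` can
    -- cancel.
    have := congrFun (hp (Pi.single 2 1) (Pi.single 2 1) (hd.adNilpotent_of_eq_zero (by simp))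
      (hd.adNilpotent_of_eq_zero (by simp))) 0
    simp [hd.apply_zero, hd.apply_one, hd.apply_two, hd.apply_three] at this
  simp [kind, hd.bracketsAdNilpotent, hd.codimAdNilpotentLeOne, hd.not_allAdNilpotent h0',
    hd.not_adNilpotentsCommute, h₁]

theorem kind_eq_of_isoClass_eq {d d' : LieStructure} (h : isoClass d = isoClass d') :
    d.kind = d'.kind := by
  obtain ⟨ψ, hψ⟩ := exists_linearEquiv_of_isoClass_eq h
  exact kind_eq ψ hψ

open Polynomial in
/-- Isomorphic triangular structures have proportional spectra. -/
theorem LieStructure.IsTriangular.exists_multiset_eq {d d' : LieStructure}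
    {r s u a b c r' s' u' a' b' c' : ℂ} (hd : d.IsTriangular r s u a b c)
    (hd' : d'.IsTriangular r' s' u' a' b' c') (h : isoClass d = isoClass d') :
    ∃ t : ℂ, ({a, b, c} : Multiset ℂ) = {t * a', t * b', t * c'} := by
  obtain ⟨ψ, hψ⟩ := exists_linearEquiv_of_isoClass_eq h
  -- The spectrum of an adjoint map depends only on the fourth coordinate, so the factor is that of
  -- the image of `e₄`.
  refine ⟨ψ (Pi.single 3 1) 3, ?_⟩
  have h1 := LieStructure.charpoly_eq ψ hψ (Pi.single 3 1)
  rw [hd.charpoly_eq, hd'.charpoly_eq] at h1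
  have h2 := mul_right_cancel₀ X_ne_zero h1
  generalize ψ (Pi.single 3 1) 3 = t at h2
  simp only [Pi.single_eq_same, one_mul] at h2
  have key : ∀ x y z : ℂ, ((X + C x) * (X + C y) * (X + C z)).roots = {-x, -y, -z} := by
    intro x y z
    rw [roots_mul (mul_ne_zero (mul_ne_zero (X_add_C_ne_zero x) (X_add_C_ne_zero y))
      (X_add_C_ne_zero z)), roots_mul (mul_ne_zero (X_add_C_ne_zero x) (X_add_C_ne_zero y)),
      roots_X_add_C, roots_X_add_C, roots_X_add_C]
    rfl
  have h3 := congrArg roots h2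
  rw [key, key] at h3
  have h4 := congrArg (Multiset.map Neg.neg) h3
  simpa using h4.symm

end Invariants

/-! ### The parametrization, its injectivity and its image -/

section Parametrization

theorem isoClass_d3SmallFamily_congr {v w : Fin 2 → ℂ} {t : ℂ} (ht : t ≠ 0)
    (h : ∀ i, v i = t * w i) :
    isoClass (d3SmallFamily (v 0) (v 1)) = isoClass (d3SmallFamily (w 0) (w 1)) := by
  rw [eq_comm, isoClass_eq_iff, h, h]
  exact (IsoTo.refl _).d3SmallFamily_smul ht _ _

/-- The isomorphism class of the structure with a given parameter. -/
noncomputable def ListParameter.toIsoClass : ListParameter → ModuliSpace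
  | .big p => isoClass (d3Family (p.exists_eq_mk.choose 0) (p.exists_eq_mk.choose 1)
      (p.exists_eq_mk.choose 2))
  | .heisenberg p => isoClass (d1Family (p.exists_eq_mk.choose 0) (p.exists_eq_mk.choose 1))
  | .small p => isoClass (d3SmallFamily (p.rep 0) (p.rep 1))
  | .single s => isoClass s.structureAt

namespace ListParameter

theorem toIsoClass_big (v : Fin 3 → ℂ) (hv : v ≠ 0) :
    (big (ProjOrbifold.mk v hv)).toIsoClass = isoClass (d3Family (v 0) (v 1) (v 2)) := by
  obtain ⟨hw, h⟩ := (ProjOrbifold.mk v hv).exists_eq_mk.choose_spec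
  obtain ⟨t, σ, ht, h⟩ := ProjOrbifold.mk_eq_mk_iff.1 h
  exact (isoClass_d3Family_congr ht h).symm

theorem toIsoClass_heisenberg (v : Fin 2 → ℂ) (hv : v ≠ 0) :
    (heisenberg (ProjOrbifold.mk v hv)).toIsoClass = isoClass (d1Family (v 0) (v 1)) := by
  obtain ⟨hw, h⟩ := (ProjOrbifold.mk v hv).exists_eq_mk.choose_spec
  obtain ⟨t, σ, ht, h⟩ := ProjOrbifold.mk_eq_mk_iff.1 h
  exact (isoClass_d1Family_congr ht h).symm

theorem toIsoClass_small (v : Fin 2 → ℂ) (hv : v ≠ 0) :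
    (small (Projectivization.mk ℂ v hv)).toIsoClass =
      isoClass (d3SmallFamily (v 0) (v 1)) := by
  obtain ⟨t, ht⟩ := Projectivization.exists_smul_eq_mk_rep ℂ v hv
  exact isoClass_d3SmallFamily_congr t.ne_zero fun i => (congrFun ht i).symm

theorem toIsoClass_single (s : SinglePoint) :
    (single s).toIsoClass = isoClass s.structureAt := rfl

/-- The invariant `LieStructure.kind` of the structure with a given parameter. -/
def kind : ListParameter → ℕ
  | single .d3 => 0
  | single .d2Sharp => 1
  | single .d1 => 2
  | single .d2Star => 3
  | single .d3Star => 4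
  | small _ => 5
  | big _ => 6
  | single .d1Sharp => 7
  | heisenberg _ => 8

end ListParameter

theorem LieStructure.kind_eq_of_isoClass_eq_toIsoClass {d : LieStructure} {p : ListParameter}
    (h : isoClass d = p.toIsoClass) : d.kind = p.kind := by
  match p with
  | .big p =>
    obtain ⟨v, hv, rfl⟩ := p.exists_eq_mk
    rw [ListParameter.toIsoClass_big] at h
    rw [kind_eq_of_isoClass_eq h, kind_d3Family]
    · rfl
    · exact fun h => hv (by
        ext i; fin_cases i <;> [exact congrFun h 0; exact congrFun h 1; exact congrFun h 2])
  | .heisenberg p =>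
    obtain ⟨v, hv, rfl⟩ := p.exists_eq_mk
    rw [ListParameter.toIsoClass_heisenberg] at h
    rw [kind_eq_of_isoClass_eq h, kind_d1Family]
    · rfl
    · exact fun h => hv (by ext i; fin_cases i <;> [exact congrFun h 0; exact congrFun h 1])
  | .small p =>
    rw [kind_eq_of_isoClass_eq h, kind_d3SmallFamily]
    · rfl
    · exact fun h => p.rep_nonzero
        (by ext i; fin_cases i <;> [exact congrFun h 0; exact congrFun h 1])
  | .single .d1 => rw [kind_eq_of_isoClass_eq h]; exact kind_d1
  | .single .d1Sharp => rw [kind_eq_of_isoClass_eq h]; exact kind_d1Sharp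
  | .single .d2Star => rw [kind_eq_of_isoClass_eq h]; exact kind_d2Star
  | .single .d2Sharp => rw [kind_eq_of_isoClass_eq h]; exact kind_d2Sharp
  | .single .d3 => rw [kind_eq_of_isoClass_eq h]; exact kind_d3
  | .single .d3Star => rw [kind_eq_of_isoClass_eq h]; exact kind_d3Star

theorem ModuliSpace.exists_eq_isoClass (m : ModuliSpace) : ∃ d, isoClass d = m :=
  Quotient.exists_rep m

theorem eq_and_eq_or_of_pair_eq {α : Type*} {a b x y : α} (h : ({a, b} : Multiset α) = {x, y}) :
    a = x ∧ b = y ∨ a = y ∧ b = x := by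
  have ha : a ∈ ({x, y} : Multiset α) := h ▸ Multiset.mem_cons_self _ _
  obtain rfl | rfl : a = x ∨ a = y := by simpa using ha
  · exact .inl ⟨rfl, Multiset.singleton_inj.1 ((Multiset.cons_inj_right _).1 h)⟩
  · rw [Multiset.pair_comm x] at h
    exact .inr ⟨rfl, Multiset.singleton_inj.1 ((Multiset.cons_inj_right _).1 h)⟩

theorem exists_perm_of_pair_eq {α : Type*} {v w : Fin 2 → α}
    (h : ({v 0, v 1} : Multiset α) = {w 0, w 1}) :
    ∃ σ : Equiv.Perm (Fin 2), ∀ i, v i = w (σ i) := by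
  obtain ⟨h0, h1⟩ | ⟨h0, h1⟩ := eq_and_eq_or_of_pair_eq h
  · exact ⟨1, by simp [Fin.forall_fin_two, h0, h1]⟩
  · exact ⟨Equiv.swap 0 1, by simp [Fin.forall_fin_two, h0, h1]⟩

theorem exists_perm_of_triple_eq {α : Type*} {v w : Fin 3 → α}
    (h : ({v 0, v 1, v 2} : Multiset α) = {w 0, w 1, w 2}) :
    ∃ σ : Equiv.Perm (Fin 3), ∀ i, v i = w (σ i) := by
  have h0 : v 0 ∈ ({w 0, w 1, w 2} : Multiset α) := h ▸ Multiset.mem_cons_self _ _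
  obtain ⟨j, hj⟩ : ∃ j, v 0 = w j := by
    simp only [Multiset.insert_eq_cons, Multiset.mem_cons, Multiset.mem_singleton] at h0
    rcases h0 with h | h | h
    exacts [⟨_, h⟩, ⟨_, h⟩, ⟨_, h⟩]
  have hw : ({w 0, w 1, w 2} : Multiset α) =
      {w (Equiv.swap 0 j 0), w (Equiv.swap 0 j 1), w (Equiv.swap 0 j 2)} := by
    fin_cases j
    · simp
    · simpa [Equiv.swap_apply_def] using Multiset.cons_swap (w 0) (w 1) {w 2}
    · simpa [Equiv.swap_apply_def] using (Multiset.cons_swap (w 0) (w 1) {w 2}).trans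
        ((congrArg _ (Multiset.pair_comm (w 0) (w 2))).trans (Multiset.cons_swap _ _ _))
  rw [hw, Equiv.swap_apply_left, hj] at h
  have h' := (Multiset.cons_inj_right _).1 h
  obtain ⟨h1, h2⟩ | ⟨h1, h2⟩ := eq_and_eq_or_of_pair_eq h'
  · exact ⟨Equiv.swap 0 j, by simp [Fin.forall_fin_succ, hj, h1, h2]⟩
  · refine ⟨Equiv.swap 0 j * Equiv.swap 1 2, ?_⟩
    simp [Fin.forall_fin_succ, Equiv.swap_apply_def, hj, h1, h2]

theorem ne_zero_of_triple_eq_mul {a b c t x y z : ℂ} (h0 : ![a, b, c] ≠ 0)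
    (h : ({a, b, c} : Multiset ℂ) = {t * x, t * y, t * z}) : t ≠ 0 := by
  rintro rfl
  simp only [zero_mul] at h
  have key : ∀ m ∈ ({a, b, c} : Multiset ℂ), m = 0 := by rw [h]; simp
  refine h0 ?_
  ext i
  fin_cases i <;> exact key _ (by simp)

theorem ListParameter.toIsoClass_injective : Function.Injective toIsoClass := by
  intro p q h
  have hk : p.kind = q.kind := by
    obtain ⟨d, hd⟩ := ModuliSpace.exists_eq_isoClass p.toIsoClass
    rw [← LieStructure.kind_eq_of_isoClass_eq_toIsoClass hd,
      LieStructure.kind_eq_of_isoClass_eq_toIsoClass (hd.trans h)]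
  match p, q with
  | .big p, .big q =>
    obtain ⟨v, hv, rfl⟩ := p.exists_eq_mk
    obtain ⟨w, hw, rfl⟩ := q.exists_eq_mk
    rw [toIsoClass_big, toIsoClass_big] at h
    obtain ⟨t, ht⟩ := (isTriangular_d3Family _ _ _).exists_multiset_eq
      (isTriangular_d3Family _ _ _) h
    have hv' : ![v 0, v 1, v 2] ≠ 0 := fun h => hv (by
      ext i; fin_cases i <;> [exact congrFun h 0; exact congrFun h 1; exact congrFun h 2])
    obtain ⟨σ, hσ⟩ := exists_perm_of_triple_eq (v := v) (w := fun i => t * w i) ht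
    rw [ProjOrbifold.mk_eq_mk_iff.2 ⟨t, σ, ne_zero_of_triple_eq_mul hv' ht, hσ⟩]
  | .heisenberg p, .heisenberg q =>
    obtain ⟨v, hv, rfl⟩ := p.exists_eq_mk
    obtain ⟨w, hw, rfl⟩ := q.exists_eq_mk
    rw [toIsoClass_heisenberg, toIsoClass_heisenberg] at h
    obtain ⟨t, ht⟩ := (isTriangular_d1Family _ _).exists_multiset_eq (isTriangular_d1Family _ _) h
    have hv' : ![v 0 + v 1, v 0, v 1] ≠ 0 := fun h => hv (by
      ext i; fin_cases i <;> [exact congrFun h 1; exact congrFun h 2])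
    -- The spectrum `{a + b, a, b}` has sum `2 (a + b)`, which identifies the central eigenvalue and
    -- allows it to be cancelled from both sides.
    have hs : v 0 + v 1 = t * (w 0 + w 1) := by
      have := congrArg Multiset.sum ht
      simp only [Multiset.insert_eq_cons, Multiset.sum_cons, Multiset.sum_singleton] at this
      linear_combination this / 2
    have ht' := ht
    rw [hs] at ht'
    obtain ⟨σ, hσ⟩ := exists_perm_of_pair_eq (v := v) (w := fun i => t * w i)
      ((Multiset.cons_inj_right _).1 ht')
    rw [ProjOrbifold.mk_eq_mk_iff.2 ⟨t, σ, ne_zero_of_triple_eq_mul hv' ht, hσ⟩]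
  | .small p, .small q =>
    obtain ⟨t, ht⟩ := (isTriangular_d3SmallFamily _ _).exists_multiset_eq
      (isTriangular_d3SmallFamily _ _) h
    have hv' : ![p.rep 0, p.rep 0, p.rep 1] ≠ 0 := fun h => p.rep_nonzero (by
      ext i; fin_cases i <;> [exact congrFun h 0; exact congrFun h 2])
    have h0 : p.rep 0 ∈ ({t * q.rep 0, t * q.rep 0, t * q.rep 1} : Multiset ℂ) :=
      ht ▸ Multiset.mem_cons_self _ _
    have h1 : t * q.rep 0 ∈ ({p.rep 0, p.rep 0, p.rep 1} : Multiset ℂ) :=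
      ht ▸ Multiset.mem_cons_self _ _
    have hs := congrArg Multiset.sum ht
    simp only [Multiset.insert_eq_cons, Multiset.sum_cons, Multiset.sum_singleton,
      Multiset.mem_cons, Multiset.mem_singleton] at h0 h1 hs
    -- In `{a, a, b}` the repeated entry is determined by the multiset, so no permutation of the
    -- coordinates can occur.
    have e0 : t * q.rep 0 = p.rep 0 := by grind
    have e1 : t * q.rep 1 = p.rep 1 := by grind
    rw [← p.mk_rep, ← q.mk_rep, (Projectivization.mk_eq_mk_iff' ℂ _ _ p.rep_nonzero
      q.rep_nonzero).2 ⟨t, by ext i; fin_cases i; exacts [e0, e1]⟩]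
  | .single s, .single s' => cases s <;> cases s' <;> first | rfl | cases hk
  | .single s, .big q | .single s, .heisenberg q | .single s, .small q => cases s <;> cases hk
  | .big p, .single s | .heisenberg p, .single s | .small p, .single s => cases s <;> cases hk
  | .big p, .heisenberg q | .big p, .small q | .heisenberg p, .big q
  | .heisenberg p, .small q | .small p, .big q | .small p, .heisenberg q => cases hk

/-- The abelian structure shares this value only with `d1`, so `d1` is the one member of the list to
be compared with it directly. -/
theorem kind_zero : (0 : LieStructure).kind = 2 := by
  have h : ∀ x y : V, (0 : LieStructure).bracket x y = 0 := fun _ _ => rfl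
  have h' : (0 : LieStructure).CodimAdNilpotentLeOne := fun _ _ =>
    ⟨1, 0, .inl one_ne_zero, fun _ => rfl⟩
  simp [LieStructure.kind, LieStructure.BracketsAdNilpotent, LieStructure.AllAdNilpotent,
    LieStructure.TwoStepNilpotent, LieStructure.AdNilpotent, h, h']

theorem isoClass_d1_ne_zero : isoClass d1 ≠ isoClass 0 := by
  intro h
  obtain ⟨ψ, hψ⟩ := exists_linearEquiv_of_isoClass_eq h
  have h1 : d1.bracket (Pi.single 1 1) (Pi.single 3 1) = 0 := ψ.map_eq_zero_iff.1 (hψ _ _)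
  have := congrFun h1 0
  simp [isTriangular_d1.apply_zero] at this

theorem ListParameter.range_toIsoClass : Set.range toIsoClass = {isoClass 0}ᶜ := by
  ext m
  simp only [Set.mem_range, Set.mem_compl_iff, Set.mem_singleton_iff]
  constructor
  · rintro ⟨p, rfl⟩ h
    have hk := LieStructure.kind_eq_of_isoClass_eq_toIsoClass h.symm
    rw [kind_zero] at hk
    match p with
    | .single .d1 => exact isoClass_d1_ne_zero h
    | .single .d3 | .single .d2Sharp | .single .d2Star | .single .d3Star | .single .d1Sharp
    | .big p | .heisenberg p | .small p => cases hk
  · obtain ⟨d, rfl⟩ := ModuliSpace.exists_eq_isoClass m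
    intro h
    obtain h0 | ⟨a, b, c, habc, hd⟩ | ⟨a, b, hab, hd⟩ | ⟨a, b, hab, hd⟩ | ⟨s, hd⟩ :=
      isListed (IsoTo.refl d).finrank_eq
    · exact absurd (isoClass_eq_iff.2 h0) h
    · exact ⟨_, (toIsoClass_big _ habc).trans (isoClass_eq_iff.2 hd).symm⟩
    · exact ⟨_, (toIsoClass_heisenberg _ hab).trans (isoClass_eq_iff.2 hd).symm⟩
    · exact ⟨_, (toIsoClass_small _ hab).trans (isoClass_eq_iff.2 hd).symm⟩
    · exact ⟨.single s, (isoClass_eq_iff.2 hd).symm⟩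

end Parametrization

end FourDimLie

theorem mainTheorem1 :
    ∃ Φ : FourDimLie.ListParameter → FourDimLie.ModuliSpace,
      (∀ (a b c : ℂ) (h : ![a, b, c] ≠ 0),
        Φ (.big (FourDimLie.ProjOrbifold.mk ![a, b, c] h)) =
          FourDimLie.isoClass (FourDimLie.d3Family a b c)) ∧
      (∀ (a b : ℂ) (h : ![a, b] ≠ 0),
        Φ (.heisenberg (FourDimLie.ProjOrbifold.mk ![a, b] h)) =
          FourDimLie.isoClass (FourDimLie.d1Family a b)) ∧
      (∀ (a b : ℂ) (h : ![a, b] ≠ 0),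
        Φ (.small (Projectivization.mk ℂ ![a, b] h)) =
          FourDimLie.isoClass (FourDimLie.d3SmallFamily a b)) ∧
      (∀ s : FourDimLie.SinglePoint,
        Φ (.single s) = FourDimLie.isoClass s.structureAt) ∧
      Function.Injective Φ ∧
      Set.range Φ = {FourDimLie.isoClass 0}ᶜ :=
  ⟨FourDimLie.ListParameter.toIsoClass,
    fun a b c h => FourDimLie.ListParameter.toIsoClass_big ![a, b, c] h,
    fun a b h => FourDimLie.ListParameter.toIsoClass_heisenberg ![a, b] h,
    fun a b h => FourDimLie.ListParameter.toIsoClass_small ![a, b] h,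
    FourDimLie.ListParameter.toIsoClass_single,
    FourDimLie.ListParameter.toIsoClass_injective,
    FourDimLie.ListParameter.range_toIsoClass⟩
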